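/- **Setting.** Let $M$ be a connected smooth manifold (Hausdorff, second countable) of dimension $n$, $D\subset TM$ a smooth subbundle of rank $m$, and $g$ a smooth Euclidean inner product on $D$. A *horizontal curve* is an absolutely continuous curve $c:[a,b]\to M$ with $\dot c(t)\in D_{c(t)}$ for almost every $t$; its length is $\int_a^b g(\dot c,\dot c)^{1/2}\,dt$, and the Carnot–Carathéodory distance $d(x,y)$ is the infimum of the lengths of the horizontal curves from $x$ to $y$. $(M,D,g)$ is *sub-Riemannian* if $M$ is locally connected by horizontal curves: every neighbourhood $N$ of a point $x$ contains a neighbourhood of $x$ any two points of which are joined by a horizontal curve in $N$. For $O\subset M$ open, $\mathcal X^1(O)$ is the space of smooth vector fields on $O$ with values in $D$, $\mathcal X^{j+1}(O)=\mathcal X^j(O)+[\mathcal X^1(O),\mathcal X^j(O)]$, $V^j(y)=\{X(y):X\in\mathcal X^j(O)\}$ for $y\in O$, and $V^0=0$. Smooth fields $X_1,\dots,X_m$ on $O$ satisfy (C) with order $k$ if they span $D$ and their iterated brackets of order at most $k$ span $T_yM$ at every $y\in O$. $(M,D,g)$ is *regular* if the numbers $\nu_j=\dim V^j(y)$ do not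 depend on $y\in M$ and, for some $k$, every point has an open neighbourhood with a $g$-orthonormal family $X_1,\dots,X_m$ satisfying (C) with order $k$. **Normal frames.** Let $U\subset M$ be open. An *adapted frame* on $U$ consists of smooth vector fields $X_1,\dots,X_n$ on $U$, linearly independent at each point, such that $X_1,\dots,X_m$ satisfy (C) on $U$, each $X_i$ with $i>m$ is an iterated bracket $[X_{a_1},[\dots,X_{a_q}]\dots]$ of $X_1,\dots,X_m$, and $X_1(x),\dots,X_{\nu_j}(x)$ is a basis of $V^j(x)$ for all $x\in U$, $j\ge1$; the degree $p=\deg X_i$ is the positive integer with $X_i(x)\in V^p(x)\setminus V^{p-1}(x)$ for all $x\in U$. Here $\exp(\sum a_iX_i)(x)$ is the value at time $1$ of the integral curve of $\sum a_iX_i$ in $U$ that starts at $x$. Write $\varepsilon\cdot a=(\varepsilon^{\deg X_i}a_i)_i$. The frame is *normal* if (a) there are a compact neighbourhood $W_0$ of $0\in\mathbb R^n$ and a function $A_0(y,a)$, positive for $y\in U$ and $a\in W_0\setminus\{0\}$, with $\frac1\varepsilon d\big(\exp(\sum\varepsilon^{\deg X_i}a_iX_i)(y),y\big)\to A_0(y,a)$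 as $\varepsilon\to0_+$, uniformly in $a\in W_0$ and in $y$ in compact subsets of $U$; (b) for each $x_0\in U$, every compact $K\subset U$ that contains $x_0$ and has sufficiently small $d$-diameter admits a compact neighbourhood $U_K$ of $0\in\mathbb R^n$ and functions $P_i$ with $\exp(\sum a_iX_i)(x)=\exp(\sum P_i(a,b,x)X_i)\circ\exp(\sum b_iX_i)(x)$ for $x\in K$, $a,b\in U_K$, such that $\varepsilon^{-\deg X_i}P_i(\varepsilon\cdot a,\varepsilon\cdot b,x)$ has a finite limit as $\varepsilon\to0_+$, uniformly in $x\in K$, $a,b\in U_K$. **Strong dilation structures at a local scale.** Let $(X,d)$ be a metric space and $\rho:X\to(0,\infty)$ a continuous function such that every closed ball $\bar B(x,3\rho(x))$ is compact. A *strong dilation structure at scale $\rho$* consists of constants $1<A<B$, open neighbourhoods $U(x)$, $V_\varepsilon(x)$ $(0<\varepsilon\le1)$, $W_\varepsilon(x)$ $(\varepsilon>1)$ of each $x\in X$ with $\bar B(x,A\rho(x))\subset U(x)$, and homeomorphisms $\delta^x_\varepsilon:U(x)\to V_\varepsilon(x)$ for $\varepsilon\le1$, $\delta^x_\varepsilon:W_\varepsilon(x)\to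 U(x)$ for $\varepsilon>1$, such that: A0. For all $x$ and $\varepsilon\in(0,1)$: $B(x,\varepsilon\rho(x))\subset\delta^x_\varepsilon B(x,A\rho(x))\subset V_\varepsilon(x)\subset W_{\varepsilon^{-1}}(x)\subset\delta^x_\varepsilon\big(B(x,B\rho(x))\cap U(x)\big)$. For every compact $K$ there is an *admissible* $R>0$, i.e. for some $\varepsilon_0\in(0,1)$ and all $x\in K$, $u,v\in\bar B(x,R)$, $\varepsilon\in(0,\varepsilon_0)$ one has $\bar B(x,R)\subset U(x)$ and $\delta^x_\varepsilon v\in W_{\varepsilon^{-1}}(\delta^x_\varepsilon u)$. A1. $\delta^x_\varepsilon x=x$ and $\delta^x_1=\mathrm{id}$. With $\operatorname{dom}\delta$ the set of $(\varepsilon,x,y)$, $\varepsilon>0$, with $y\in U(x)$ if $\varepsilon\le1$ and $y\in W_\varepsilon(x)$ if $\varepsilon>1$, the map $(\varepsilon,x,y)\mapsto\delta^x_\varepsilon y$ extends continuously to the closure of $\operatorname{dom}\delta$ in $[0,\infty)\times X\times X$, with value $x$ at $(0,x,y)$. A2. For $\varepsilon,\mu>0$ and $u\in U(x)$: if $\delta^x_\varepsilon\delta^x_\mu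 u$ is defined, then so is $\delta^x_{\varepsilon\mu}u$ and they are equal; conversely, if $\delta^x_{\varepsilon\mu}u$ is defined and $\mu\le1$ or $\varepsilon\ge1$, then $\delta^x_\varepsilon\delta^x_\mu u$ is defined. A3. For each $x$ there is a distance function $d^x$ on $\bar B(x,A\rho(x))$ such that $\sup\{|\frac1\varepsilon d(\delta^x_\varepsilon u,\delta^x_\varepsilon v)-d^x(u,v)|:u,v\in\bar B(x,A\rho(x))\}\to0$ as $\varepsilon\to0$, uniformly in $x$ in compact sets. A4. The points $\delta^{\delta^x_\varepsilon u}_{\varepsilon^{-1}}\delta^x_\varepsilon v$ converge as $\varepsilon\to0$ to a limit $\Delta^x(u,v)\in X$, uniformly in $x\in K$, $u,v\in\bar B(x,R)$, for every compact $K$ and every $R$ admissible for $K$. **Theorem.** Let $(M,D,g)$ be a regular sub-Riemannian manifold and $U\subset M$ an open set with a normal frame $X_1,\dots,X_n$. Then the Carnot–Carathéodory distance $d$ of $M$ is a finite metric on $U$ that induces the manifold topology, and, for some continuous scale $\rho$ on $U$, $(U,d)$ carries a strong dilation structure at scale $\rho$ whose dilations are $$\delta^x_\varepsilon\Big(\exp\Big(\sum_{i=1}^n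 a_iX_i\Big)(x)\Big)=\exp\Big(\sum_{i=1}^n\varepsilon^{\deg X_i}a_iX_i\Big)(x),$$ where, for each $x\in U$, $a$ ranges over an open neighbourhood $O_x$ of $0\in\mathbb R^n$, stable under $a\mapsto\varepsilon\cdot a$ for $0<\varepsilon\le1$, that $a\mapsto\exp(\sum a_iX_i)(x)$ maps homeomorphically onto $U(x)$, and where $\varepsilon>0$ is arbitrary, subject to the left-hand side being defined. -/

import Mathlib

open Set Filter Topology MeasureTheory
open scoped Manifold ContDiff ENNReal

/-! ## Dilation structures -/

/-- `f` restricts to a homeomorphism from `S` onto `T`. -/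
def IsHomeoOn {X Y : Type*} [TopologicalSpace X] [TopologicalSpace Y]
    (f : X → Y) (S : Set X) (T : Set Y) : Prop :=
  BijOn f S T ∧ ContinuousOn f S ∧ ∃ g : Y → X, LeftInvOn g f S ∧ ContinuousOn g T

/-- `ϱ` is a distance function on the set `S`. -/
def IsDistanceOn {X : Type*} (ϱ : X → X → ℝ) (S : Set X) : Prop :=
  (∀ u ∈ S, ∀ v ∈ S, 0 ≤ ϱ u v ∧ ϱ u v = ϱ v u ∧ (ϱ u v = 0 ↔ u = v)) ∧
    ∀ u ∈ S, ∀ v ∈ S, ∀ w ∈ S, ϱ u w ≤ ϱ u v + ϱ v w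

/-- The data of a field of locally defined dilations on `X`. The dilation `δ ε x`, based at `x` and
of coefficient `ε > 0`, is only meaningful on `dom ε x`, which is `U x` for `ε ≤ 1` and `W ε x` for
`ε > 1`. The function `scale` is the local unit of length: at the base point `x` the radii that
occur in the axioms are measured in the unit `scale x`. -/
structure DilationData (X : Type*) where
  /-- the unit of length at each base point -/
  scale : X → ℝ
  /-- the constants `1 < A < B` of the axiom A0 -/
  A : ℝ
  B : ℝ
  /-- domain of the dilations of coefficient at most `1` -/
  U : X → Set X
  /-- image of the dilations of coefficient at most `1` -/
  V : ℝ → X → Set X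
  /-- domain of the dilations of coefficient larger than `1` -/
  W : ℝ → X → Set X
  /-- the dilations -/
  δ : ℝ → X → X → X

namespace DilationData

variable {X : Type*} (D : DilationData X)

/-- The domain of the dilation of coefficient `ε` based at `x`. -/
def dom (ε : ℝ) (x : X) : Set X :=
  {y | (ε ≤ 1 ∧ y ∈ D.U x) ∨ (1 < ε ∧ y ∈ D.W ε x)}

/-- The total domain `dom δ` of the field of dilations. -/
def totalDom : Set (ℝ × X × X) :=
  {p | 0 < p.1 ∧ p.2.2 ∈ D.dom p.1 p.2.1}

/-- The approximate difference `Δ^x_ε(u,v) = δ^{δ^x_ε u}_{ε⁻¹} δ^x_ε v`. -/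
noncomputable def approxDiff (ε : ℝ) (x u v : X) : X :=
  D.δ ε⁻¹ (D.δ ε x u) (D.δ ε x v)

/-- For base points `x ∈ K` and points `u, v` in the closed ball of radius `R` centred at `x`, the
approximate difference of `u` and `v` is defined for all sufficiently small `ε`. -/
def Admissible [MetricSpace X] (K : Set X) (R : ℝ) : Prop :=
  0 < R ∧ ∃ ε₀ ∈ Ioo (0 : ℝ) 1, ∀ x ∈ K, Metric.closedBall x R ⊆ D.U x ∧
    ∀ u ∈ Metric.closedBall x R, ∀ v ∈ Metric.closedBall x R, ∀ ε ∈ Ioo 0 ε₀,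
      D.δ ε x v ∈ D.W ε⁻¹ (D.δ ε x u)

/-- The axioms A0 - A3 of a dilation structure, at the scale `D.scale`. -/
structure IsDilationStructure [MetricSpace X] : Prop where
  -- the local unit of length, and local compactness
  scale_continuous : Continuous D.scale
  scale_pos : ∀ x, 0 < D.scale x
  compact_ball : ∀ x, IsCompact (Metric.closedBall x (3 * D.scale x))
  -- the dilations are homeomorphisms between open neighbourhoods of their base point
  U_nhd : ∀ x, IsOpen (D.U x) ∧ x ∈ D.U x
  V_nhd : ∀ x, ∀ ε ∈ Ioc (0 : ℝ) 1, IsOpen (D.V ε x) ∧ x ∈ D.V ε x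
  W_nhd : ∀ x, ∀ ε ∈ Ioi (1 : ℝ), IsOpen (D.W ε x) ∧ x ∈ D.W ε x
  homeo_le : ∀ x, ∀ ε ∈ Ioc (0 : ℝ) 1, IsHomeoOn (D.δ ε x) (D.U x) (D.V ε x)
  homeo_gt : ∀ x, ∀ ε ∈ Ioi (1 : ℝ), IsHomeoOn (D.δ ε x) (D.W ε x) (D.U x)
  -- A0
  one_lt_A : 1 < D.A
  A_lt_B : D.A < D.B
  ball_A_subset : ∀ x, Metric.closedBall x (D.A * D.scale x) ⊆ D.U x
  A0_incl : ∀ x, ∀ ε ∈ Ioo (0 : ℝ) 1,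
    Metric.ball x (ε * D.scale x) ⊆ D.δ ε x '' Metric.ball x (D.A * D.scale x) ∧
    D.δ ε x '' Metric.ball x (D.A * D.scale x) ⊆ D.V ε x ∧
    D.V ε x ⊆ D.W ε⁻¹ x ∧
    D.W ε⁻¹ x ⊆ D.δ ε x '' (Metric.ball x (D.B * D.scale x) ∩ D.U x)
  A0_diff : ∀ K : Set X, IsCompact K → ∃ R, D.Admissible K R
  -- A1
  A1_base : ∀ x, ∀ ε > 0, D.δ ε x x = x
  A1_one : ∀ x, ∀ y ∈ D.U x, D.δ 1 x y = y
  A1_cont : ∃ δ' : ℝ × X × X → X, ContinuousOn δ' (closure D.totalDom) ∧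
    (∀ p ∈ D.totalDom, δ' p = D.δ p.1 p.2.1 p.2.2) ∧
    ∀ x y, ((0 : ℝ), x, y) ∈ closure D.totalDom → δ' (0, x, y) = x
  -- A2; the composition may have a smaller domain than `δ (ε * μ) x` only when `ε < 1 < μ`
  A2 : ∀ x, ∀ ε > 0, ∀ μ > 0, ∀ u ∈ D.U x,
    (u ∈ D.dom μ x → D.δ μ x u ∈ D.dom ε x →
      u ∈ D.dom (ε * μ) x ∧ D.δ ε x (D.δ μ x u) = D.δ (ε * μ) x u) ∧
    ((μ ≤ 1 ∨ 1 ≤ ε) → u ∈ D.dom (ε * μ) x → u ∈ D.dom μ x ∧ D.δ μ x u ∈ D.dom ε x)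
  -- A3
  A3 : ∃ dx : X → X → X → ℝ,
    (∀ x, IsDistanceOn (dx x) (Metric.closedBall x (D.A * D.scale x))) ∧
    ∀ K : Set X, IsCompact K → ∀ η > 0, ∃ ε₀ ∈ Ioo (0 : ℝ) 1, ∀ ε ∈ Ioo 0 ε₀, ∀ x ∈ K,
      ∀ u ∈ Metric.closedBall x (D.A * D.scale x), ∀ v ∈ Metric.closedBall x (D.A * D.scale x),
        |1 / ε * dist (D.δ ε x u) (D.δ ε x v) - dx x u v| < η

/-- A strong dilation structure: the axioms A0 - A3, and A4, the uniform convergence of the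
approximate differences. A dilation structure over a complete space with compact closed balls of
radius `3`, with the same radii at all points, is the case of the constant scale `1`. -/
structure IsStrongDilationStructure [MetricSpace X] : Prop extends D.IsDilationStructure where
  A4 : ∃ Δ : X → X → X → X, ∀ K : Set X, IsCompact K → ∀ R, D.Admissible K R →
    ∀ η > 0, ∃ ε₀ ∈ Ioo (0 : ℝ) 1, ∀ ε ∈ Ioo 0 ε₀, ∀ x ∈ K,
      ∀ u ∈ Metric.closedBall x R, ∀ v ∈ Metric.closedBall x R,
        dist (D.approxDiff ε x u v) (Δ x u v) < η

end DilationData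

/-! ## Sub-Riemannian manifolds -/

section SubRiemannian

/-- (Not necessarily smooth) vector fields on `M`. -/
abbrev VField (n : ℕ) (M : Type*) [TopologicalSpace M]
    [ChartedSpace (EuclideanSpace ℝ (Fin n)) M] : Type _ :=
  (x : M) → TangentSpace (𝓡 n) x

variable {n : ℕ} {M : Type*} [TopologicalSpace M] [ChartedSpace (EuclideanSpace ℝ (Fin n)) M]

/-- The vector field `X` is smooth on `O`. -/
def SmoothField [IsManifold (𝓡 n) ∞ M] (O : Set M) (X : VField n M) : Prop :=
  ContMDiffOn (𝓡 n) (𝓡 n).tangent ∞ (fun x => (⟨x, X x⟩ : TangentBundle (𝓡 n) M)) O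

/-- A smooth distribution (subbundle of the tangent bundle) of rank `m`. -/
structure TangentDistribution (n m : ℕ) (M : Type*) [TopologicalSpace M]
    [ChartedSpace (EuclideanSpace ℝ (Fin n)) M] [IsManifold (𝓡 n) ∞ M] where
  fiber : (x : M) → Submodule ℝ (TangentSpace (𝓡 n) x)
  smooth : ∀ x : M, ∃ O : Set M, IsOpen O ∧ x ∈ O ∧ ∃ X : Fin m → VField n M,
    (∀ i, SmoothField O (X i)) ∧
    ∀ y ∈ O, LinearIndependent ℝ (fun i => X i y) ∧
      Submodule.span ℝ (range fun i => X i y) = fiber y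

/-- The velocity of a curve. -/
noncomputable def velocity (n : ℕ) {M : Type*} [TopologicalSpace M]
    [ChartedSpace (EuclideanSpace ℝ (Fin n)) M] (c : ℝ → M) (t : ℝ) :
    TangentSpace (𝓡 n) (c t) :=
  mfderiv 𝓘(ℝ, ℝ) (𝓡 n) c t (1 : ℝ)

/-- The multi-bracket `[X_{a₁}, [ … , X_{a_q}] … ]` of a word `a₁ … a_q`. -/
noncomputable def wordBracket {m : ℕ} (X : Fin m → VField n M) : List (Fin m) → VField n M
  | [] => 0
  | [a] => X a
  | a :: b :: w => VectorField.mlieBracket (𝓡 n) (X a) (wordBracket X (b :: w))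

variable [IsManifold (𝓡 n) ∞ M] {m : ℕ}

/-- `c` is a horizontal curve on `[a,b]`: it is absolutely continuous (read through smooth
functions), and for almost every `t` it is differentiable at `t` with velocity in `D`. -/
def IsHorizontal (D : TangentDistribution n m M) (c : ℝ → M) (a b : ℝ) : Prop :=
  a ≤ b ∧ ContinuousOn c (Icc a b) ∧
  (∀ f : M → ℝ, ContMDiff (𝓡 n) 𝓘(ℝ, ℝ) ∞ f → AbsolutelyContinuousOnInterval (f ∘ c) a b) ∧
  ∀ᵐ t ∂(volume.restrict (Icc a b)),
    MDifferentiableAt 𝓘(ℝ, ℝ) (𝓡 n) c t ∧ velocity n c t ∈ D.fiber (c t)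

/-- A sub-Riemannian structure on `M`: a completely non-integrable distribution `D` of rank `m`
(the manifold is locally connected by horizontal curves) and a smooth Euclidean inner product
`g` on the fibres of `D`. -/
structure SubRiemannian (n m : ℕ) (M : Type*) [TopologicalSpace M]
    [ChartedSpace (EuclideanSpace ℝ (Fin n)) M] [IsManifold (𝓡 n) ∞ M] where
  D : TangentDistribution n m M
  nonintegrable : ∀ x : M, ∀ N ∈ 𝓝 x, ∃ O ∈ 𝓝 x, ∀ p ∈ O, ∀ q ∈ O,
    ∃ (c : ℝ → M) (a b : ℝ), IsHorizontal D c a b ∧ c a = p ∧ c b = q ∧ ∀ t ∈ Icc a b, c t ∈ N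
  g : (x : M) → D.fiber x →ₗ[ℝ] D.fiber x →ₗ[ℝ] ℝ
  g_symm : ∀ x v w, g x v w = g x w v
  g_pos : ∀ x v, v ≠ 0 → 0 < g x v v
  g_smooth : ∀ (O : Set M), IsOpen O → ∀ X Y : (x : M) → D.fiber x,
    SmoothField O (fun x => (X x : TangentSpace (𝓡 n) x)) →
    SmoothField O (fun x => (Y x : TangentSpace (𝓡 n) x)) →
    ContMDiffOn (𝓡 n) 𝓘(ℝ, ℝ) ∞ (fun x => g x (X x) (Y x)) O

open Classical in
/-- The norm `g(v,v)^{1/2}` of a horizontal vector `v` (extended by `0`). -/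
noncomputable def SubRiemannian.hnorm (S : SubRiemannian n m M) (x : M)
    (v : TangentSpace (𝓡 n) x) : ℝ :=
  if h : v ∈ S.D.fiber x then Real.sqrt (S.g x ⟨v, h⟩ ⟨v, h⟩) else 0

/-- The length of a horizontal curve. -/
noncomputable def SubRiemannian.length (S : SubRiemannian n m M) (c : ℝ → M) (a b : ℝ) : ℝ≥0∞ :=
  ∫⁻ t in Icc a b, ENNReal.ofReal (S.hnorm (c t) (velocity n c t))

/-- The Carnot-Carathéodory distance. -/
noncomputable def SubRiemannian.ccEDist (S : SubRiemannian n m M) (x y : M) : ℝ≥0∞ :=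
  ⨅ (c : ℝ → M) (a : ℝ) (b : ℝ) (_ : IsHorizontal S.D c a b ∧ c a = x ∧ c b = y), S.length c a b

/-- The filtration `𝒳^j(O,D)` of vector fields: `𝒳^1` consists of the horizontal vector fields
smooth on `O`, and `𝒳^{j+1} = 𝒳^j + [𝒳^1, 𝒳^j]` (and `𝒳^0 = 0`). -/
noncomputable def fieldFiltration (D : TangentDistribution n m M) (O : Set M) :
    ℕ → Submodule ℝ (VField n M)
  | 0 => ⊥
  | 1 => Submodule.span ℝ {X | SmoothField O X ∧ ∀ y ∈ O, X y ∈ D.fiber y}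
  | j + 2 => fieldFiltration D O (j + 1) ⊔ Submodule.span ℝ
      {Z | ∃ X ∈ fieldFiltration D O 1, ∃ Y ∈ fieldFiltration D O (j + 1),
        Z = VectorField.mlieBracket (𝓡 n) X Y}

/-- `V^j(y,O,D) = {X(y) : X ∈ 𝒳^j(O,D)}`. -/
noncomputable def flag (D : TangentDistribution n m M) (O : Set M) (j : ℕ) (y : M) :
    Submodule ℝ (TangentSpace (𝓡 n) y) :=
  (fieldFiltration D O j).map (LinearMap.proj y)

/-- Condition (C) on `O`, with brackets of order at most `k`. -/
def ChowCondition (D : TangentDistribution n m M) (O : Set M) (k : ℕ) (X : Fin m → VField n M) : Prop :=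
  (∀ i, SmoothField O (X i)) ∧
  ∀ y ∈ O, Submodule.span ℝ (range fun i => X i y) = D.fiber y ∧
    Submodule.span ℝ {v | ∃ w : List (Fin m), w.length ≤ k ∧ v = wordBracket X w y} = ⊤

/-- The family `X` is orthonormal in `D` on `O`. -/
def OrthonormalOn (S : SubRiemannian n m M) (O : Set M) (X : Fin m → VField n M) : Prop :=
  ∀ y ∈ O, ∃ h : ∀ i, X i y ∈ S.D.fiber y,
    ∀ i j, S.g y ⟨X i y, h i⟩ ⟨X j y, h j⟩ = if i = j then 1 else 0

/-- Regular sub-Riemannian manifolds: orthonormal families satisfying (C) exist locally, and the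
dimensions `ν_j` of the spaces `V^j(y)` do not depend on the point. -/
def SubRiemannian.IsRegular (S : SubRiemannian n m M) : Prop :=
  ∃ (k : ℕ) (ν : ℕ → ℕ), ∀ x : M, ∃ O : Set M, IsOpen O ∧ x ∈ O ∧
    (∃ X : Fin m → VField n M, OrthonormalOn S O X ∧ ChowCondition S.D O k X) ∧
    ∀ y ∈ O, ∀ j, Module.finrank ℝ (flag S.D O j y) = ν j

/-! ## Normal frames -/

/-- `y = exp(∑ a_i X_i)(x)`, the flow taking place in `U`. -/
def IsExp (U : Set M) (X : Fin n → VField n M) (a : Fin n → ℝ) (x y : M) : Prop :=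
  ∃ γ : ℝ → M, γ 0 = x ∧ γ 1 = y ∧ (∀ t ∈ Icc (0 : ℝ) 1, γ t ∈ U) ∧
    IsMIntegralCurveOn γ (fun z => ∑ i, a i • X i z) (Icc 0 1)

/-- `(ε^{deg X_i} a_i)_i`. -/
def weightedDil {n : ℕ} (deg : Fin n → ℕ) (ε : ℝ) (a : Fin n → ℝ) : Fin n → ℝ :=
  fun i => ε ^ deg i * a i

/-- `X` is an adapted frame on `U`, and `deg i` is the degree of `X i`. -/
structure IsAdaptedFrame (S : SubRiemannian n m M) (U : Set M) (X : Fin n → VField n M)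
    (deg : Fin n → ℕ) : Prop where
  smooth : ∀ i, SmoothField U (X i)
  chow : ∃ (hmn : m ≤ n) (k : ℕ), ChowCondition S.D U k (fun i => X (Fin.castLE hmn i)) ∧
    ∀ i : Fin n, m ≤ i.val → ∃ w : List (Fin m),
      ∀ y ∈ U, X i y = wordBracket (fun i => X (Fin.castLE hmn i)) w y
  independent : ∀ y ∈ U, LinearIndependent ℝ (fun i => X i y)
  -- the first `ν_j` fields form a basis of `V^j`
  basis : ∀ y ∈ U, ∀ j, 1 ≤ j → Submodule.span ℝ
    {v | ∃ i : Fin n, i.val < Module.finrank ℝ (flag S.D U j y) ∧ v = X i y} = flag S.D U j y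
  deg_pos : ∀ i, 0 < deg i
  deg_mem : ∀ i, ∀ y ∈ U, X i y ∈ flag S.D U (deg i) y
  deg_not_mem : ∀ i, ∀ y ∈ U, X i y ∉ flag S.D U (deg i - 1) y

/-- Normal frames on the open set `U`. -/
structure IsNormalFrame (S : SubRiemannian n m M) (U : Set M) (X : Fin n → VField n M)
    (deg : Fin n → ℕ) : Prop extends IsAdaptedFrame S U X deg where
  limit_dist : ∃ Wn : Set (Fin n → ℝ), IsCompact Wn ∧ Wn ∈ 𝓝 0 ∧
    ∃ A : M → (Fin n → ℝ) → ℝ, (∀ y ∈ U, ∀ a ∈ Wn, a ≠ 0 → 0 < A y a) ∧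
    ∀ K : Set M, K ⊆ U → IsCompact K → ∀ η > 0, ∃ ε₀ > 0, ∀ ε ∈ Ioo (0 : ℝ) ε₀,
      ∀ y ∈ K, ∀ a ∈ Wn, ∃ z, IsExp U X (weightedDil deg ε a) y z ∧
        |1 / ε * (S.ccEDist z y).toReal - A y a| < η
  limit_comp : ∀ x₀ ∈ U, ∃ r > 0, ∀ K : Set M, K ⊆ U → IsCompact K → x₀ ∈ K →
    (∀ y ∈ K, ∀ z ∈ K, S.ccEDist y z < ENNReal.ofReal r) →
    ∃ Un : Set (Fin n → ℝ), IsCompact Un ∧ Un ∈ 𝓝 0 ∧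
    ∃ P : (Fin n → ℝ) → (Fin n → ℝ) → M → Fin n → ℝ,
      (∀ x ∈ K, ∀ a ∈ Un, ∀ b ∈ Un, ∃ z w,
        IsExp U X a x z ∧ IsExp U X b x w ∧ IsExp U X (P a b x) w z) ∧
      ∃ Q : (Fin n → ℝ) → (Fin n → ℝ) → M → Fin n → ℝ,
        ∀ η > 0, ∃ ε₀ > 0, ∀ ε ∈ Ioo (0 : ℝ) ε₀, ∀ x ∈ K, ∀ a ∈ Un, ∀ b ∈ Un, ∀ i,
          |(ε ^ deg i)⁻¹ * P (weightedDil deg ε a) (weightedDil deg ε b) x i - Q a b x i| < η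

/-- The dilations of `Dil` are those of the frame `X`: around each `x ∈ U`, in the coordinates
`a ↦ exp(∑ a_i X_i)(x)`, which map an open neighbourhood of `0` homeomorphically onto the domain
`Dil.U x`, the dilation `δ^x_ε` maps `exp(∑ a_i X_i)(x)` to `exp(∑ a_i ε^{deg X_i} X_i)(x)`. -/
def IsFrameDilation (U : Set M) (X : Fin n → VField n M) (deg : Fin n → ℕ)
    (Dil : DilationData U) : Prop :=
  ∀ x : U, ∃ (O : Set (Fin n → ℝ)) (e : (Fin n → ℝ) → U), IsOpen O ∧ 0 ∈ O ∧
    (∀ a ∈ O, ∀ ε ∈ Ioc (0 : ℝ) 1, weightedDil deg ε a ∈ O) ∧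
    IsHomeoOn e O (Dil.U x) ∧ (∀ a ∈ O, IsExp U X a x (e a)) ∧
    ∀ a ∈ O, ∀ ε > 0, e a ∈ Dil.dom ε x →
      IsExp U X (weightedDil deg ε a) x (Dil.δ ε x (e a))

end SubRiemannian

/-! Write `E x a` for `exp(∑ a_i X_i)(x)`, `L x` for the local inverse of `E x`, and `ε·a` for the
weighted dilation. Everything rests on two limits as `ε → 0`: the gauge `N x a = lim ε⁻¹ d(E x
(ε·a), x)` and the infinitesimal difference `Q x a b = lim ε⁻¹·L (E x (ε·b)) (E x (ε·a))`. Both are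
joint limits in `ε`, the base point and the vectors, hence continuous and uniform on compact sets;
`HasDilationLimits` records them, and the axioms follow formally from it.

Indeed `E x (ε·a) = E (E x (ε·b)) (ε·p)` with `p → Q x a b`, and the new base point tends to `x`.
Joint convergence of the gauge therefore gives `ε⁻¹ d(E x (ε·a), E x (ε·b)) → N x (Q x a b)`, which
is the distance `d^x` of A3 (`dist_tendsto`). Symmetry and the triangle inequality pass to the
limit. Separation comes from the change of base point `Q (Q a c) (Q b c) = Q a b` (`Q_cancel`). The
limit in A4 is `E x (Q x a b)`, with `a` and `b` the coordinates of `v` and `u`. Homogeneity of `N`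
and compactness of spheres make `N` comparable to the distance near the base point, so gauge balls
of radius `2ρ` serve as domains. A partition of unity makes `ρ` continuous.

Three inputs remain.

Exponential coordinates: in a chart with fields cut off to compact support, the time-one flow is
strictly differentiable in `(x, a)` at `(x₀, 0)`, and the inverse function theorem yields `L` with
the base point as a parameter (`exists_local_exp`).

The Carnot–Carathéodory distance is finite and induces the manifold topology. Compactly supported
smooth functions are Lipschitz for it, so its balls are small. Conversely, nearby points are joined
by short curves: flows expand as exponential series of differential operators, iterated commutators
of flows move by `t^q` along brackets of order `q`, and combining such moves halves the distance to
a target. Repeating this and concatenating infinitely many curves reaches the target exactly, in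
time at most `C ‖z - y‖^κ` (`exists_reach_of_span`).

The limits themselves: the functions `P` in the definition of a normal frame need not be small
solutions of the composition equation. Their asymptotic homogeneity excludes large branches, so that
for small `ε` they agree with `L` (`exists_eq_of_asymptotically_homogeneous`). The limits, known at
first for small vectors, extend to all vectors by homogeneity. -/

/-! ## Joint limits -/

section JointLimits

variable {Z T β : Type*} [TopologicalSpace Z] [PseudoMetricSpace T] {l : Filter β}

/-- Convergence along `l ×ˢ 𝓝 z` at the points `z` of a compact set is uniform on this set. -/
theorem eventually_forall_dist_lt_of_tendsto_prod [l.NeBot] {f : β × Z → T} {g : Z → T}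
    {K : Set Z} (hK : IsCompact K) (h : ∀ z ∈ K, Tendsto f (l ×ˢ 𝓝 z) (𝓝 (g z)))
    {η : ℝ} (hη : 0 < η) : ∀ᶠ ε in l, ∀ z ∈ K, dist (f (ε, z)) (g z) < η := by
  suffices H : ∀ᶠ ε in l, ∀ z ∈ K, z ∈ K → dist (f (ε, z)) (g z) < η from
    H.mono fun ε h z hz => h z hz hz
  refine hK.induction_on (p := fun s => ∀ᶠ ε in l, ∀ z ∈ s, z ∈ K → dist (f (ε, z)) (g z) < η)
    (by simp) (fun s t hst ht => ht.mono fun ε h z hz => h z (hst hz))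
    (fun s t hs ht => ?_) (fun z hz => ?_)
  · filter_upwards [hs, ht] with ε h1 h2 z hz
    exact hz.elim (h1 z) (h2 z)
  · have h1 := (h z hz).eventually (Metric.ball_mem_nhds (g z) (half_pos hη))
    obtain ⟨pa, hpa, pb, hpb, hp⟩ := eventually_prod_iff.mp h1
    refine ⟨{z' | pb z'}, mem_nhdsWithin_of_mem_nhds hpb, ?_⟩
    filter_upwards [hpa] with ε hε z' hz' hz'K
    have h2 : Tendsto (fun ε => f (ε, z')) l (𝓝 (g z')) :=
      (h z' hz'K).comp (tendsto_id.prodMk tendsto_const_nhds)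
    -- With `z'` fixed and `ε'` tending to its limit, the bound on `f` becomes a bound on `g`; one
    -- neighbourhood of `z` thus controls both functions.
    have h3 : dist (g z') (g z) ≤ η / 2 := by
      refine le_of_tendsto (h2.dist tendsto_const_nhds) ?_
      filter_upwards [hpa] with ε' hε'
      exact (hp hε' hz').le
    have h4 : dist (f (ε, z')) (g z) < η / 2 := hp hε hz'
    linarith [dist_triangle_right (f (ε, z')) (g z') (g z)]

/-- A limit along `l ×ˢ 𝓝 z` is a continuous function of `z`. -/
theorem continuousAt_of_tendsto_prod [l.NeBot] {f : β × Z → T} {g : Z → T} {z : Z}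
    (h : ∀ᶠ z' in 𝓝 z, Tendsto f (l ×ˢ 𝓝 z') (𝓝 (g z'))) : ContinuousAt g z := by
  rw [Metric.continuousAt_iff']
  intro η hη
  have h1 := (h.self_of_nhds).eventually (Metric.ball_mem_nhds (g z) (half_pos hη))
  obtain ⟨pa, hpa, pb, hpb, hp⟩ := eventually_prod_iff.mp h1
  filter_upwards [h, hpb] with z' hz' hz'b
  have h2 : Tendsto (fun ε => f (ε, z')) l (𝓝 (g z')) :=
    hz'.comp (tendsto_id.prodMk tendsto_const_nhds)
  have h3 : dist (g z') (g z) ≤ η / 2 := by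
    refine le_of_tendsto (h2.dist tendsto_const_nhds) ?_
    filter_upwards [hpa] with ε' hε'
    exact (hp hε' hz'b).le
  linarith

end JointLimits

/-! ## Weighted dilations of `ℝⁿ` -/

section WeightedDil

variable {n : ℕ} {deg : Fin n → ℕ}

theorem weightedDil_mul (ε μ : ℝ) (a : Fin n → ℝ) :
    weightedDil deg ε (weightedDil deg μ a) = weightedDil deg (ε * μ) a := by
  funext i; simp [weightedDil, mul_pow, mul_assoc]

@[simp] theorem weightedDil_one (a : Fin n → ℝ) : weightedDil deg 1 a = a := by
  funext i; simp [weightedDil]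

@[simp] theorem weightedDil_zero_right (ε : ℝ) : weightedDil deg ε (0 : Fin n → ℝ) = 0 := by
  funext i; simp [weightedDil]

theorem weightedDil_zero_left (hdeg : ∀ i, 0 < deg i) (a : Fin n → ℝ) :
    weightedDil deg 0 a = 0 := by
  funext i; simp [weightedDil, (hdeg i).ne']

theorem weightedDil_inv_self {ε : ℝ} (hε : ε ≠ 0) (a : Fin n → ℝ) :
    weightedDil deg ε⁻¹ (weightedDil deg ε a) = a := by
  rw [weightedDil_mul, inv_mul_cancel₀ hε, weightedDil_one]

theorem weightedDil_self_inv {ε : ℝ} (hε : ε ≠ 0) (a : Fin n → ℝ) :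
    weightedDil deg ε (weightedDil deg ε⁻¹ a) = a := by
  rw [weightedDil_mul, mul_inv_cancel₀ hε, weightedDil_one]

theorem continuous_weightedDil (deg : Fin n → ℕ) :
    Continuous fun p : ℝ × (Fin n → ℝ) => weightedDil deg p.1 p.2 := by
  unfold weightedDil; fun_prop

theorem continuous_weightedDil_right (deg : Fin n → ℕ) (ε : ℝ) :
    Continuous fun a : Fin n → ℝ => weightedDil deg ε a := by
  unfold weightedDil; fun_prop

theorem norm_weightedDil_le (hdeg : ∀ i, 0 < deg i) {ε : ℝ} (h0 : 0 ≤ ε) (h1 : ε ≤ 1)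
    (a : Fin n → ℝ) : ‖weightedDil deg ε a‖ ≤ ε * ‖a‖ := by
  refine (pi_norm_le_iff_of_nonneg (by positivity)).2 fun i => ?_
  rw [weightedDil, norm_mul, norm_pow, Real.norm_of_nonneg h0]
  exact mul_le_mul (pow_le_of_le_one h0 h1 (hdeg i).ne') (norm_le_pi_norm a i)
    (norm_nonneg _) h0

theorem norm_le_norm_weightedDil (hdeg : ∀ i, 0 < deg i) {ε : ℝ} (h1 : 1 ≤ ε)
    (a : Fin n → ℝ) : ε * ‖a‖ ≤ ‖weightedDil deg ε a‖ := by
  have h0 : 0 < ε := by linarith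
  have := norm_weightedDil_le hdeg (inv_nonneg.2 h0.le) (inv_le_one_of_one_le₀ h1)
    (weightedDil deg ε a)
  rw [weightedDil_inv_self h0.ne'] at this
  rwa [inv_mul_eq_div, le_div_iff₀' h0] at this

/-- Every nonzero vector is dilated to any prescribed norm. -/
theorem exists_norm_weightedDil_eq (hdeg : ∀ i, 0 < deg i) {a : Fin n → ℝ} (ha : a ≠ 0)
    {s : ℝ} (hs : 0 < s) : ∃ r > 0, ‖weightedDil deg r a‖ = s := by
  have hna : 0 < ‖a‖ := norm_pos_iff.2 ha
  -- All degrees are at least 1, so dilating by `b ≥ 1` multiplies the norm by at least `b`; the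
  -- intermediate value theorem then applies on `[0, b]`.
  set b : ℝ := max 1 (s / ‖a‖) with hb
  have hb1 : 1 ≤ b := le_max_left _ _
  have hcont : ContinuousOn (fun r : ℝ => ‖weightedDil deg r a‖) (Icc 0 b) :=
    ((continuous_weightedDil deg).comp (by fun_prop : Continuous fun r : ℝ => (r, a))).norm.continuousOn
  have hsb : s ≤ ‖weightedDil deg b a‖ := by
    refine le_trans ?_ (norm_le_norm_weightedDil hdeg hb1 a)
    rw [← div_le_iff₀ hna]; exact le_max_right _ _
  have h0 : ‖weightedDil deg 0 a‖ ≤ s := by rw [weightedDil_zero_left hdeg]; simpa using hs.le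
  obtain ⟨r, hr, hrs⟩ := intermediate_value_Icc (by linarith) hcont ⟨h0, hsb⟩
  refine ⟨r, lt_of_le_of_ne hr.1 ?_, hrs⟩
  rintro rfl
  simp only [weightedDil_zero_left hdeg, norm_zero] at hrs
  exact hs.ne hrs

theorem tendsto_weightedDil_zero (hdeg : ∀ i, 0 < deg i) (a : Fin n → ℝ) :
    Tendsto (fun p : ℝ × (Fin n → ℝ) => weightedDil deg p.1 p.2) (𝓝[>] 0 ×ˢ 𝓝 a) (𝓝 0) := by
  have := (continuous_weightedDil deg).tendsto (0, a)
  simp only [weightedDil_zero_left hdeg] at this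
  rw [nhds_prod_eq] at this
  exact this.mono_left (Filter.prod_mono_left _ nhdsWithin_le_nhds)

end WeightedDil

/-! ## Fields of exponential coordinates on a metric space -/

/-- Local coordinates `E x : ℝⁿ → Y` with inverse `L x`, such that the weighted dilations of the
coordinates have uniform infinitesimal limits: `N` for the distance to the base point, `Q` for the
difference of two points. -/
structure HasDilationLimits {Y : Type*} [MetricSpace Y] {n : ℕ} (deg : Fin n → ℕ)
    (E : Y → (Fin n → ℝ) → Y) (L : Y → Y → Fin n → ℝ) (N : Y → (Fin n → ℝ) → ℝ)
    (Q : Y → (Fin n → ℝ) → (Fin n → ℝ) → Fin n → ℝ) : Prop where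
  deg_pos : ∀ i, 0 < deg i
  E_zero : ∀ x, E x 0 = x
  L_self : ∀ x, L x x = 0
  E_good : ∀ x₀, ∀ᶠ p : Y × (Fin n → ℝ) in 𝓝 (x₀, 0),
    ContinuousAt (fun q : Y × (Fin n → ℝ) => E q.1 q.2) p ∧ L p.1 (E p.1 p.2) = p.2
  L_good : ∀ x₀, ∀ᶠ p : Y × Y in 𝓝 (x₀, x₀),
    ContinuousAt (fun q : Y × Y => L q.1 q.2) p ∧ E p.1 (L p.1 p.2) = p.2
  N_tendsto : ∀ x a, Tendsto
    (fun p : ℝ × Y × (Fin n → ℝ) => p.1⁻¹ * dist (E p.2.1 (weightedDil deg p.1 p.2.2)) p.2.1)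
    (𝓝[>] 0 ×ˢ 𝓝 (x, a)) (𝓝 (N x a))
  N_pos : ∀ x a, a ≠ 0 → 0 < N x a
  Q_tendsto : ∀ x a b, Tendsto
    (fun p : ℝ × Y × (Fin n → ℝ) × (Fin n → ℝ) => weightedDil deg p.1⁻¹
      (L (E p.2.1 (weightedDil deg p.1 p.2.2.2)) (E p.2.1 (weightedDil deg p.1 p.2.2.1))))
    (𝓝[>] 0 ×ˢ 𝓝 (x, a, b)) (𝓝 (Q x a b))

namespace HasDilationLimits

variable {Y : Type*} [MetricSpace Y] {n : ℕ} {deg : Fin n → ℕ}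
  {E : Y → (Fin n → ℝ) → Y} {L : Y → Y → Fin n → ℝ} {N : Y → (Fin n → ℝ) → ℝ}
  {Q : Y → (Fin n → ℝ) → (Fin n → ℝ) → Fin n → ℝ}

theorem continuousAt_E_zero (h : HasDilationLimits deg E L N Q) (x : Y) :
    ContinuousAt (fun q : Y × (Fin n → ℝ) => E q.1 q.2) (x, 0) :=
  (h.E_good x).self_of_nhds.1

theorem continuousAt_L_self (h : HasDilationLimits deg E L N Q) (x : Y) :
    ContinuousAt (fun q : Y × Y => L q.1 q.2) (x, x) :=
  (h.L_good x).self_of_nhds.1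

theorem continuous_N (h : HasDilationLimits deg E L N Q) :
    Continuous fun p : Y × (Fin n → ℝ) => N p.1 p.2 :=
  continuous_iff_continuousAt.2 fun _ => continuousAt_of_tendsto_prod
    (Eventually.of_forall fun q => h.N_tendsto q.1 q.2)

theorem N_tendsto_const (h : HasDilationLimits deg E L N Q) (x : Y) (a : Fin n → ℝ) :
    Tendsto (fun ε : ℝ => ε⁻¹ * dist (E x (weightedDil deg ε a)) x) (𝓝[>] 0) (𝓝 (N x a)) :=
  (h.N_tendsto x a).comp (tendsto_id.prodMk tendsto_const_nhds)

theorem Q_tendsto_const (h : HasDilationLimits deg E L N Q) (x : Y) (a b : Fin n → ℝ) :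
    Tendsto (fun ε : ℝ => weightedDil deg ε⁻¹
      (L (E x (weightedDil deg ε b)) (E x (weightedDil deg ε a)))) (𝓝[>] 0) (𝓝 (Q x a b)) :=
  (h.Q_tendsto x a b).comp (tendsto_id.prodMk tendsto_const_nhds)

theorem N_zero (h : HasDilationLimits deg E L N Q) (x : Y) : N x 0 = 0 := by
  refine tendsto_nhds_unique (h.N_tendsto_const x 0) ?_
  simp [h.E_zero]

theorem N_nonneg (h : HasDilationLimits deg E L N Q) (x : Y) (a : Fin n → ℝ) : 0 ≤ N x a := by
  rcases eq_or_ne a 0 with rfl | ha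
  · simp [h.N_zero]
  · exact (h.N_pos x a ha).le

theorem N_eq_zero (h : HasDilationLimits deg E L N Q) {x : Y} {a : Fin n → ℝ} :
    N x a = 0 ↔ a = 0 :=
  ⟨fun H => by_contra fun ha => (h.N_pos x a ha).ne' H, fun H => by simp [H, h.N_zero]⟩

/-- For `r > 0`, substitute `ε * r` for `ε` in the limit that defines `N`. -/
theorem N_weightedDil (h : HasDilationLimits deg E L N Q) (x : Y) (a : Fin n → ℝ) {r : ℝ}
    (hr : 0 ≤ r) : N x (weightedDil deg r a) = r * N x a := by
  rcases hr.eq_or_lt with rfl | hr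
  · simp [weightedDil_zero_left h.deg_pos, h.N_zero]
  refine tendsto_nhds_unique (h.N_tendsto_const x (weightedDil deg r a)) ?_
  have h1 : Tendsto (fun ε : ℝ => ε * r) (𝓝[>] 0) (𝓝[>] 0) := by
    refine tendsto_nhdsWithin_iff.2 ⟨?_, ?_⟩
    · have : Tendsto (fun ε : ℝ => ε * r) (𝓝 0) (𝓝 (0 * r)) := tendsto_id.mul_const r
      rw [zero_mul] at this
      exact this.mono_left nhdsWithin_le_nhds
    · filter_upwards [self_mem_nhdsWithin] with ε hε using mul_pos hε hr
  refine (((h.N_tendsto_const x a).comp h1).const_mul r).congr' ?_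
  filter_upwards [self_mem_nhdsWithin] with ε hε
  have hε' : ε ≠ 0 := ne_of_gt hε
  simp only [Function.comp, weightedDil_mul]
  field_simp

/-- Locally uniform positivity of `N` on spheres. -/
theorem exists_lt_N_on_sphere (h : HasDilationLimits deg E L N Q) (x₀ : Y) {δ : ℝ} (hδ : 0 < δ) :
    ∃ c > 0, ∀ᶠ x in 𝓝 x₀, ∀ a : Fin n → ℝ, ‖a‖ = δ → c < N x a := by
  have hS : IsCompact (Metric.sphere (0 : Fin n → ℝ) δ) := isCompact_sphere _ _
  obtain ⟨c, hc, hcS⟩ : ∃ c > 0, ∀ a ∈ Metric.sphere (0 : Fin n → ℝ) δ, c < N x₀ a := by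
    rcases (Metric.sphere (0 : Fin n → ℝ) δ).eq_empty_or_nonempty with he | hne
    · exact ⟨1, one_pos, by simp [he]⟩
    obtain ⟨a₀, ha₀, hmin⟩ := hS.exists_isMinOn hne
      (h.continuous_N.comp (by fun_prop : Continuous fun a : Fin n → ℝ => (x₀, a))).continuousOn
    have hp : 0 < N x₀ a₀ := h.N_pos _ _ (by
      rintro rfl; simp at ha₀; exact hδ.ne ha₀)
    exact ⟨N x₀ a₀ / 2, half_pos hp, fun a ha => (half_lt_self hp).trans_le (hmin ha)⟩
  refine ⟨c, hc, ?_⟩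
  have := hS.eventually_forall_of_forall_eventually (x₀ := x₀) (P := fun x a => c < N x a)
    fun a ha => (h.continuous_N.continuousAt (x := (x₀, a))).eventually (lt_mem_nhds (hcS a ha))
  filter_upwards [this] with x hx a ha
  exact hx a (by simpa using ha)

/-- A vector of norm at least `δ` is brought to the sphere of radius `δ` by a dilation of
coefficient `r ≤ 1`. There the gauge exceeds `c`, and homogeneity only makes it larger at the
original vector. -/
theorem exists_norm_lt_of_N_le (h : HasDilationLimits deg E L N Q) (x₀ : Y) {δ : ℝ} (hδ : 0 < δ) :
    ∃ c > 0, ∀ᶠ x in 𝓝 x₀, ∀ a : Fin n → ℝ, N x a ≤ c → ‖a‖ < δ := by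
  obtain ⟨c, hc, hx⟩ := h.exists_lt_N_on_sphere x₀ hδ
  refine ⟨c, hc, hx.mono fun x hx a ha => ?_⟩
  by_contra! hcon
  have ha0 : a ≠ 0 := by rintro rfl; simp at hcon; linarith
  obtain ⟨r, hr, hra⟩ := exists_norm_weightedDil_eq h.deg_pos ha0 hδ
  have hr1 : r ≤ 1 := by
    by_contra! h1
    have := norm_le_norm_weightedDil h.deg_pos h1.le a
    nlinarith
  have h2 := hx _ hra
  rw [h.N_weightedDil x a hr.le] at h2
  nlinarith [h.N_nonneg x a]

theorem exists_norm_le_of_N_le (h : HasDilationLimits deg E L N Q) (x₀ : Y) (C : ℝ) :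
    ∃ R, ∀ᶠ x in 𝓝 x₀, ∀ a : Fin n → ℝ, N x a ≤ C → ‖a‖ ≤ R := by
  obtain ⟨c, hc, hx⟩ := h.exists_norm_lt_of_N_le x₀ one_pos
  -- Dilating by `r` turns gauge at most `C` into gauge at most `c`, hence norm below 1; dilating
  -- back by `r⁻¹` keeps the set bounded.
  set r := min 1 (c / (|C| + 1)) with hr
  have hr0 : 0 < r := lt_min one_pos (by positivity)
  have hrC : r * C ≤ c := by
    have h1 : r ≤ c / (|C| + 1) := min_le_right _ _
    rw [le_div_iff₀ (by positivity)] at h1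
    nlinarith [le_abs_self C]
  have hcomp : IsCompact (weightedDil deg r⁻¹ '' Metric.closedBall (0 : Fin n → ℝ) 1) :=
    (isCompact_closedBall _ _).image (continuous_weightedDil_right deg _)
  obtain ⟨R, hR⟩ := hcomp.isBounded.exists_norm_le
  refine ⟨R, hx.mono fun x hx a ha => hR _ ⟨weightedDil deg r a, ?_, weightedDil_inv_self hr0.ne' a⟩⟩
  have : N x (weightedDil deg r a) ≤ c := by
    rw [h.N_weightedDil x a hr0.le]; nlinarith
  simpa using (hx _ this).le

theorem exists_norm_le_of_isCompact (h : HasDilationLimits deg E L N Q) {K : Set Y}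
    (hK : IsCompact K) (C : ℝ) : ∃ R, ∀ x ∈ K, ∀ a : Fin n → ℝ, N x a ≤ C → ‖a‖ ≤ R := by
  refine hK.induction_on (p := fun s => ∃ R, ∀ x ∈ s, ∀ a : Fin n → ℝ, N x a ≤ C → ‖a‖ ≤ R)
    ⟨0, by simp⟩ (fun s t hst ⟨R, hR⟩ => ⟨R, fun x hx => hR x (hst hx)⟩)
    (fun s t ⟨R, hR⟩ ⟨R', hR'⟩ => ⟨max R R', fun x hx a ha => ?_⟩) (fun x _ => ?_)
  · exact hx.elim (fun hx => (hR x hx a ha).trans (le_max_left _ _))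
      (fun hx => (hR' x hx a ha).trans (le_max_right _ _))
  · obtain ⟨R, hR⟩ := h.exists_norm_le_of_N_le x C
    exact ⟨_, mem_nhdsWithin_of_mem_nhds hR, R, fun x hx => hx⟩

/-- The pairs of vectors of bounded gauge over a compact set form a compact set. -/
theorem isCompact_gauge_le (h : HasDilationLimits deg E L N Q) {K : Set Y} (hK : IsCompact K)
    {f : Y → ℝ} (hf : Continuous f) :
    IsCompact {p : Y × (Fin n → ℝ) × (Fin n → ℝ) |
      p.1 ∈ K ∧ N p.1 p.2.1 ≤ f p.1 ∧ N p.1 p.2.2 ≤ f p.1} := by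
  obtain ⟨C, hC⟩ := hK.bddAbove_image hf.continuousOn
  obtain ⟨R, hR⟩ := h.exists_norm_le_of_isCompact hK C
  have hC' : ∀ x ∈ K, f x ≤ C := fun x hx => hC ⟨x, hx, rfl⟩
  refine (hK.prod ((isCompact_closedBall (0 : Fin n → ℝ) R).prod
    (isCompact_closedBall (0 : Fin n → ℝ) R))).of_isClosed_subset ?_ ?_
  · refine (hK.isClosed.preimage continuous_fst).inter (IsClosed.inter ?_ ?_)
    · exact isClosed_le (h.continuous_N.comp (by fun_prop :
        Continuous fun p : Y × (Fin n → ℝ) × (Fin n → ℝ) => (p.1, p.2.1))) (by fun_prop)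
    · exact isClosed_le (h.continuous_N.comp (by fun_prop :
        Continuous fun p : Y × (Fin n → ℝ) × (Fin n → ℝ) => (p.1, p.2.2))) (by fun_prop)
  · rintro ⟨x, a, b⟩ ⟨hx, ha, hb⟩
    exact ⟨hx, by simpa using hR x hx a (ha.trans (hC' x hx)),
      by simpa using hR x hx b (hb.trans (hC' x hx))⟩

/-- Near the base point, the distance is equivalent to the gauge `N`. -/
theorem exists_abs_dist_sub_N_le (h : HasDilationLimits deg E L N Q) (x₀ : Y) {θ : ℝ}
    (hθ : 0 < θ) : ∃ c > 0, ∀ᶠ x in 𝓝 x₀, ∀ a : Fin n → ℝ, N x a ≤ c →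
      |dist (E x a) x - N x a| ≤ θ * N x a := by
  obtain ⟨c', hc', hN⟩ := h.exists_lt_N_on_sphere x₀ one_pos
  have hS : IsCompact (Metric.sphere (0 : Fin n → ℝ) 1) := isCompact_sphere _ _
  -- The unit sphere is the compact set; the dilation coefficient and the base point together are
  -- the parameter.
  have h1 := eventually_forall_dist_lt_of_tendsto_prod (l := 𝓝[>] (0 : ℝ) ×ˢ 𝓝 x₀) hS
    (f := fun p => p.1.1⁻¹ * dist (E p.1.2 (weightedDil deg p.1.1 p.2)) p.1.2) (g := N x₀)
    (η := θ * c' / 2) (fun a _ => by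
      have := h.N_tendsto x₀ a
      rw [nhds_prod_eq, ← prod_assoc] at this
      simpa [Function.comp_def] using this) (by positivity)
  have h2 := eventually_forall_dist_lt_of_tendsto_prod (l := 𝓝 x₀) hS
    (f := fun p => N p.1 p.2) (g := N x₀) (η := θ * c' / 2) (fun a _ => by
      have := h.continuous_N.tendsto (x₀, a)
      rwa [nhds_prod_eq] at this) (by positivity)
  obtain ⟨pa, hpa, pb, hpb, hp⟩ := eventually_prod_iff.mp h1
  obtain ⟨ε₁, hε₁, hε₁p⟩ := mem_nhdsGT_iff_exists_Ioo_subset.1 hpa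
  have hε₁' : (0 : ℝ) < ε₁ := hε₁
  refine ⟨c' * ε₁ / 2, by positivity, ?_⟩
  filter_upwards [hN, h2, hpb] with x hx1 hx2 hx3 a ha
  rcases eq_or_ne a 0 with rfl | ha0
  · simp [h.N_zero, h.E_zero]
  -- `a` is the dilation by `r⁻¹` of a unit vector, and small gauge forces `r⁻¹ < ε₁`. The two
  -- errors on the sphere add up to `θ * c'`, which is below `θ` times the gauge there; homogeneity
  -- turns this into a relative error at `a`.
  obtain ⟨r, hr, hra⟩ := exists_norm_weightedDil_eq h.deg_pos ha0 one_pos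
  have haS : weightedDil deg r a ∈ Metric.sphere (0 : Fin n → ℝ) 1 := by simpa using hra
  have hlt := hx1 _ hra
  have hNr := h.N_weightedDil x a hr.le
  have hNr' : N x a = r⁻¹ * N x (weightedDil deg r a) := by rw [hNr]; field_simp
  have hrε : r⁻¹ < ε₁ := by
    have hri : 0 < r⁻¹ := inv_pos.2 hr
    have : r⁻¹ * c' < c' * ε₁ := by nlinarith
    nlinarith
  have h3 := hp (hε₁p ⟨inv_pos.2 hr, hrε⟩) hx3 _ haS
  have h4 := hx2 _ haS
  simp only [inv_inv, weightedDil_inv_self hr.ne'] at h3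
  have h5 : |r * dist (E x a) x - N x (weightedDil deg r a)| < θ * c' := by
    rw [Real.dist_eq] at h3 h4
    rw [abs_lt] at *
    constructor <;> linarith
  rw [hNr, ← mul_sub, abs_mul, abs_of_pos hr] at h5
  rw [hNr] at hlt
  have : r * |dist (E x a) x - N x a| ≤ r * (θ * N x a) := by nlinarith
  exact le_of_mul_le_mul_left this hr

theorem tendsto_E (h : HasDilationLimits deg E L N Q) (x : Y) (a : Fin n → ℝ) :
    Tendsto (fun p : ℝ × Y × (Fin n → ℝ) => E p.2.1 (weightedDil deg p.1 p.2.2))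
      (𝓝[>] 0 ×ˢ 𝓝 (x, a)) (𝓝 x) := by
  have h1 := h.continuousAt_E_zero x
  have h2 : Tendsto (fun p : ℝ × Y × (Fin n → ℝ) => (p.2.1, weightedDil deg p.1 p.2.2))
      (𝓝[>] 0 ×ˢ 𝓝 (x, a)) (𝓝 (x, 0)) := by
    refine Tendsto.prodMk_nhds ?_ ?_
    · exact (continuous_fst.tendsto (x, a)).comp tendsto_snd
    · exact (tendsto_weightedDil_zero h.deg_pos a).comp
        (tendsto_fst.prodMk ((continuous_snd.tendsto (x, a)).comp tendsto_snd))
  have h3 := h1.tendsto.comp h2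
  simp only [h.E_zero] at h3
  exact h3

theorem tendsto_E_fst (h : HasDilationLimits deg E L N Q) (x : Y) (a b : Fin n → ℝ) :
    Tendsto (fun p : ℝ × Y × (Fin n → ℝ) × (Fin n → ℝ) => E p.2.1 (weightedDil deg p.1 p.2.2.1))
      (𝓝[>] 0 ×ˢ 𝓝 (x, a, b)) (𝓝 x) :=
  (h.tendsto_E x a).comp (tendsto_fst.prodMk (((by fun_prop : Continuous
    fun q : Y × (Fin n → ℝ) × (Fin n → ℝ) => (q.1, q.2.1)).tendsto (x, a, b)).comp tendsto_snd))

theorem tendsto_E_snd (h : HasDilationLimits deg E L N Q) (x : Y) (a b : Fin n → ℝ) :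
    Tendsto (fun p : ℝ × Y × (Fin n → ℝ) × (Fin n → ℝ) => E p.2.1 (weightedDil deg p.1 p.2.2.2))
      (𝓝[>] 0 ×ˢ 𝓝 (x, a, b)) (𝓝 x) :=
  (h.tendsto_E x b).comp (tendsto_fst.prodMk (((by fun_prop : Continuous
    fun q : Y × (Fin n → ℝ) × (Fin n → ℝ) => (q.1, q.2.2)).tendsto (x, a, b)).comp tendsto_snd))

/-- Eventually, `exp (ε·a) x = exp (ε · p_ε) (exp (ε·b) x)` with `p_ε` the dilated difference. -/
theorem eventually_E_L (h : HasDilationLimits deg E L N Q) (x : Y) (a b : Fin n → ℝ) :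
    ∀ᶠ p : ℝ × Y × (Fin n → ℝ) × (Fin n → ℝ) in 𝓝[>] 0 ×ˢ 𝓝 (x, a, b),
      E (E p.2.1 (weightedDil deg p.1 p.2.2.2))
        (L (E p.2.1 (weightedDil deg p.1 p.2.2.2)) (E p.2.1 (weightedDil deg p.1 p.2.2.1))) =
      E p.2.1 (weightedDil deg p.1 p.2.2.1) :=
  (((h.tendsto_E_snd x a b).prodMk_nhds (h.tendsto_E_fst x a b)).eventually (h.L_good x)).mono
    fun _ hp => hp.2

theorem eventually_pos (x : Y) (a b : Fin n → ℝ) :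
    ∀ᶠ p : ℝ × Y × (Fin n → ℝ) × (Fin n → ℝ) in 𝓝[>] 0 ×ˢ 𝓝 (x, a, b), 0 < p.1 :=
  tendsto_fst.eventually self_mem_nhdsWithin

/-- Seen from `E x (ε·b)`, the point `E x (ε·a)` is `E _ (ε·p)` with `p → Q x a b`. The limit of the
gauge is joint in base point and vector, so the moving base point is harmless. -/
theorem dist_tendsto (h : HasDilationLimits deg E L N Q) (x : Y) (a b : Fin n → ℝ) :
    Tendsto (fun p : ℝ × Y × (Fin n → ℝ) × (Fin n → ℝ) => p.1⁻¹ *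
      dist (E p.2.1 (weightedDil deg p.1 p.2.2.1)) (E p.2.1 (weightedDil deg p.1 p.2.2.2)))
      (𝓝[>] 0 ×ˢ 𝓝 (x, a, b)) (𝓝 (N x (Q x a b))) := by
  have h1 := (h.N_tendsto x (Q x a b)).comp (tendsto_fst.prodMk
    ((h.tendsto_E_snd x a b).prodMk_nhds (h.Q_tendsto x a b)))
  refine h1.congr' ?_
  filter_upwards [h.eventually_E_L x a b, eventually_pos x a b] with p hp hp0
  simp only [Function.comp, weightedDil_self_inv hp0.ne', hp]

theorem dist_tendsto_const (h : HasDilationLimits deg E L N Q) (x : Y) (a b : Fin n → ℝ) :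
    Tendsto (fun ε : ℝ => ε⁻¹ * dist (E x (weightedDil deg ε a)) (E x (weightedDil deg ε b)))
      (𝓝[>] 0) (𝓝 (N x (Q x a b))) :=
  (h.dist_tendsto x a b).comp (tendsto_id.prodMk tendsto_const_nhds)

theorem N_Q_comm (h : HasDilationLimits deg E L N Q) (x : Y) (a b : Fin n → ℝ) :
    N x (Q x a b) = N x (Q x b a) :=
  tendsto_nhds_unique (h.dist_tendsto_const x a b)
    ((h.dist_tendsto_const x b a).congr fun ε => by rw [dist_comm])

theorem N_Q_triangle (h : HasDilationLimits deg E L N Q) (x : Y) (a b c : Fin n → ℝ) :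
    N x (Q x a c) ≤ N x (Q x a b) + N x (Q x b c) := by
  refine le_of_tendsto_of_tendsto (h.dist_tendsto_const x a c)
    ((h.dist_tendsto_const x a b).add (h.dist_tendsto_const x b c)) ?_
  filter_upwards [self_mem_nhdsWithin] with ε hε
  rw [← mul_add]
  exact mul_le_mul_of_nonneg_left (dist_triangle _ _ _) (inv_nonneg.2 (le_of_lt hε))

/-- Triangle inequality through the base point. It keeps differences of vectors of gauge at most
`2ρ` within gauge `4ρ`, where the coordinates are still valid. -/
theorem N_Q_le (h : HasDilationLimits deg E L N Q) (x : Y) (a b : Fin n → ℝ) :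
    N x (Q x a b) ≤ N x a + N x b := by
  refine le_of_tendsto_of_tendsto (h.dist_tendsto_const x a b)
    ((h.N_tendsto_const x a).add (h.N_tendsto_const x b)) ?_
  filter_upwards [self_mem_nhdsWithin] with ε hε
  rw [← mul_add]
  exact mul_le_mul_of_nonneg_left (dist_triangle_right _ _ _) (inv_nonneg.2 (le_of_lt hε))

theorem Q_self (h : HasDilationLimits deg E L N Q) (x : Y) (a : Fin n → ℝ) : Q x a a = 0 := by
  refine tendsto_nhds_unique (h.Q_tendsto_const x a a) ?_
  simp [h.L_self]

theorem Q_zero_right (h : HasDilationLimits deg E L N Q) (x : Y) (a : Fin n → ℝ) :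
    Q x a 0 = a := by
  refine tendsto_nhds_unique (h.Q_tendsto_const x a 0) ?_
  refine tendsto_const_nhds.congr' ?_
  have h1 : Tendsto (fun ε : ℝ => (x, weightedDil deg ε a)) (𝓝[>] 0) (𝓝 (x, 0)) :=
    tendsto_const_nhds.prodMk_nhds ((tendsto_weightedDil_zero h.deg_pos a).comp
      (tendsto_id.prodMk tendsto_const_nhds))
  filter_upwards [h1.eventually (h.E_good x), self_mem_nhdsWithin] with ε h2 hε
  rw [weightedDil_zero_right, h.E_zero, h2.2, weightedDil_inv_self (ne_of_gt hε)]

/-- Move the base point to `w = E x (ε·c)`: the dilated coordinates of `E x (ε·a)` and `E x (ε·b)`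
at `w` tend to `Q x a c` and `Q x b c`, while the difference of these two points does not depend on
the base point. Joint convergence of `Q` along `w → x` identifies the limits. -/
theorem Q_cancel (h : HasDilationLimits deg E L N Q) (x : Y) (a b c : Fin n → ℝ) :
    Q x (Q x a c) (Q x b c) = Q x a b := by
  have hx : Tendsto (fun ε : ℝ => E x (weightedDil deg ε c)) (𝓝[>] 0) (𝓝 x) :=
    (h.tendsto_E x c).comp (tendsto_id.prodMk tendsto_const_nhds)
  have h1 := (h.Q_tendsto x (Q x a c) (Q x b c)).comp (tendsto_id.prodMk
    (hx.prodMk_nhds ((h.Q_tendsto_const x a c).prodMk_nhds (h.Q_tendsto_const x b c))))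
  refine tendsto_nhds_unique h1 ((h.Q_tendsto_const x a b).congr' ?_)
  have h2 := (tendsto_id.prodMk tendsto_const_nhds).eventually (h.eventually_E_L x a c)
  have h3 := (tendsto_id.prodMk tendsto_const_nhds).eventually (h.eventually_E_L x b c)
  filter_upwards [h2, h3, self_mem_nhdsWithin] with ε h2 h3 hε
  have hε' : ε ≠ 0 := ne_of_gt hε
  simp only [id, Function.comp] at h2 h3 ⊢
  rw [weightedDil_self_inv hε', weightedDil_self_inv hε', h2, h3]

/-- By cancellation of `b`, `a = Q a 0 = Q (Q a b) (Q 0 b)` and `b = Q b 0 = Q (Q b b) (Q 0 b)`;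
both first arguments vanish. This is what makes `d^x` separate points. -/
theorem eq_of_Q_eq_zero (h : HasDilationLimits deg E L N Q) {x : Y} {a b : Fin n → ℝ}
    (H : Q x a b = 0) : a = b := by
  rw [← h.Q_zero_right x a, ← h.Q_cancel x a 0 b, H]
  nth_rewrite 2 [← h.Q_zero_right x b]
  rw [← h.Q_cancel x b 0 b, h.Q_self]

end HasDilationLimits

theorem exists_Ioo_of_eventually_nhdsGT {P : ℝ → Prop} (h : ∀ᶠ ε in 𝓝[>] (0 : ℝ), P ε) :
    ∃ ε₀ ∈ Ioo (0 : ℝ) 1, ∀ ε ∈ Ioo 0 ε₀, P ε := by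
  obtain ⟨ε₁, hε₁, hP⟩ := mem_nhdsGT_iff_exists_Ioo_subset.1 h
  have h1 : (0 : ℝ) < ε₁ := hε₁
  exact ⟨min ε₁ (1 / 2), ⟨by positivity, (min_le_right _ _).trans_lt (by norm_num)⟩,
    fun ε hε => hP ⟨hε.1, hε.2.trans_le (min_le_left _ _)⟩⟩

/-- A positive continuous function is bounded below on a uniform neighbourhood of a compact set. -/
theorem IsCompact.exists_forall_dist_lt_imp_lt {Y : Type*} [PseudoMetricSpace Y] {K : Set Y}
    (hK : IsCompact K) {f : Y → ℝ} (hf : Continuous f) (hpos : ∀ x, 0 < f x) :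
    ∃ r > 0, ∃ m > 0, ∀ x ∈ K, ∀ w, dist w x < r → m < f w := by
  refine hK.induction_on (p := fun s => ∃ r > 0, ∃ m > 0, ∀ x ∈ s, ∀ w, dist w x < r → m < f w)
    ⟨1, one_pos, 1, one_pos, by simp⟩
    (fun s t hst ⟨r, hr, m, hm, h⟩ => ⟨r, hr, m, hm, fun x hx => h x (hst hx)⟩)
    (fun s t ⟨r, hr, m, hm, h⟩ ⟨r', hr', m', hm', h'⟩ =>
      ⟨min r r', lt_min hr hr', min m m', lt_min hm hm', fun x hx w hw => ?_⟩) (fun x _ => ?_)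
  · exact hx.elim (fun hx => (min_le_left _ _).trans_lt (h x hx w (hw.trans_le (min_le_left _ _))))
      (fun hx => (min_le_right _ _).trans_lt (h' x hx w (hw.trans_le (min_le_right _ _))))
  · have h1 := hf.continuousAt.eventually (lt_mem_nhds (half_lt_self (hpos x)))
    obtain ⟨r, hr, h2⟩ := Metric.eventually_nhds_iff.1 h1
    refine ⟨_, mem_nhdsWithin_of_mem_nhds (Metric.ball_mem_nhds x (half_pos hr)), r / 2,
      half_pos hr, f x / 2, half_pos (hpos x), fun y hy w hw => h2 ?_⟩
    have := Metric.mem_ball.1 hy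
    linarith [dist_triangle w y x]

/-! ### A continuous scale on which the coordinates are valid -/

section GoodRadius

variable {Y : Type*} [MetricSpace Y] {n : ℕ}

/-- Within the distance `3 * r` of `x` the coordinates `E x` are valid, and the distance to `x` is
comparable to the gauge `N x` up to the factor `1 ± 1/10`. -/
structure IsGoodRadius (E : Y → (Fin n → ℝ) → Y) (L : Y → Y → Fin n → ℝ)
    (N : Y → (Fin n → ℝ) → ℝ) (Rel : Y → (Fin n → ℝ) → Prop) (x : Y) (r : ℝ) : Prop where
  pos : 0 < r
  compact : IsCompact (Metric.closedBall x (3 * r))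
  L_cont : ∀ y, dist y x ≤ 3 * r → ContinuousAt (fun q : Y × Y => L q.1 q.2) (x, y)
  E_L : ∀ y, dist y x ≤ 3 * r → E x (L x y) = y
  N_L : ∀ y, dist y x ≤ 3 * r → N x (L x y) ≤ 10 / 9 * dist y x
  E_cont : ∀ a, N x a ≤ 4 * r → ContinuousAt (fun q : Y × (Fin n → ℝ) => E q.1 q.2) (x, a)
  L_E : ∀ a, N x a ≤ 4 * r → L x (E x a) = a
  dist_E : ∀ a, N x a ≤ 4 * r → dist (E x a) x ≤ 11 / 10 * N x a
  rel : ∀ a, N x a ≤ 4 * r → Rel x a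

variable {deg : Fin n → ℕ} {E : Y → (Fin n → ℝ) → Y} {L : Y → Y → Fin n → ℝ}
  {N : Y → (Fin n → ℝ) → ℝ} {Q : Y → (Fin n → ℝ) → (Fin n → ℝ) → Fin n → ℝ}
  {Rel : Y → (Fin n → ℝ) → Prop}

theorem IsGoodRadius.mono {x : Y} {r r' : ℝ} (h : IsGoodRadius E L N Rel x r) (h0 : 0 < r')
    (hr : r' ≤ r) : IsGoodRadius E L N Rel x r' where
  pos := h0
  compact := h.compact.of_isClosed_subset Metric.isClosed_closedBall
    (Metric.closedBall_subset_closedBall (by linarith))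
  L_cont y hy := h.L_cont y (by linarith)
  E_L y hy := h.E_L y (by linarith)
  N_L y hy := h.N_L y (by linarith)
  E_cont a ha := h.E_cont a (by linarith)
  L_E a ha := h.L_E a (by linarith)
  dist_E a ha := h.dist_E a (by linarith)
  rel a ha := h.rel a (by linarith)

theorem HasDilationLimits.exists_isGoodRadius [LocallyCompactSpace Y]
    (h : HasDilationLimits deg E L N Q)
    (hRel : ∀ x₀, ∀ᶠ p : Y × (Fin n → ℝ) in 𝓝 (x₀, 0), Rel p.1 p.2) (x₀ : Y) :
    ∃ c, ∀ᶠ x in 𝓝 x₀, IsGoodRadius E L N Rel x c := by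
  have hE := (h.E_good x₀).and (hRel x₀)
  rw [nhds_prod_eq] at hE
  obtain ⟨pa, hpa, pb, hpb, hp⟩ := eventually_prod_iff.mp hE
  obtain ⟨δ, hδ, hδb⟩ := Metric.eventually_nhds_iff.1 hpb
  obtain ⟨c1, hc1, hN1⟩ := h.exists_norm_lt_of_N_le x₀ hδ
  obtain ⟨c2, hc2, hN2⟩ := h.exists_abs_dist_sub_N_le x₀ (θ := 1 / 10) (by norm_num)
  have hNL : ∀ᶠ q : Y × Y in 𝓝 (x₀, x₀), N q.1 (L q.1 q.2) < c2 := by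
    have hc : ContinuousAt (fun q : Y × Y => N q.1 (L q.1 q.2)) (x₀, x₀) :=
      ContinuousAt.comp (g := fun p : Y × (Fin n → ℝ) => N p.1 p.2)
        (f := fun q : Y × Y => (q.1, L q.1 q.2)) h.continuous_N.continuousAt
        (continuousAt_fst.prodMk (h.continuousAt_L_self x₀))
    refine hc.eventually (gt_mem_nhds ?_)
    simpa [h.L_self, h.N_zero] using hc2
  have hL := (h.L_good x₀).and hNL
  obtain ⟨r1, hr1, hr1L⟩ := Metric.eventually_nhds_iff.1 hL
  obtain ⟨K, hK, hKx⟩ := exists_compact_mem_nhds x₀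
  obtain ⟨r2, hr2, hr2K⟩ := Metric.nhds_basis_closedBall.mem_iff.1 hKx
  -- Gauges are used up to `4 * c`, hence the quarters. Points within `3 * c` of `x`, itself within
  -- half a radius of `x₀`, must stay within that radius of `x₀`, hence the twelfths.
  set c := min (min (c1 / 4) (c2 / 4)) (min (r1 / 12) (r2 / 12)) with hc
  have hcc1 : c ≤ c1 / 4 := (min_le_left _ _).trans (min_le_left _ _)
  have hcc2 : c ≤ c2 / 4 := (min_le_left _ _).trans (min_le_right _ _)
  have hcr1 : c ≤ r1 / 12 := (min_le_right _ _).trans (min_le_left _ _)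
  have hcr2 : c ≤ r2 / 12 := (min_le_right _ _).trans (min_le_right _ _)
  have hc0 : 0 < c := by positivity
  refine ⟨c, ?_⟩
  filter_upwards [hpa, hN1, hN2, Metric.ball_mem_nhds x₀ (half_pos hr1),
    Metric.ball_mem_nhds x₀ (half_pos hr2)] with x hx1 hx2 hx3 hx4 hx5
  rw [Metric.mem_ball] at hx4 hx5
  have hL' : ∀ y, dist y x ≤ 3 * c → (ContinuousAt (fun q : Y × Y => L q.1 q.2) (x, y) ∧
      E x (L x y) = y) ∧ N x (L x y) < c2 := fun y hy => hr1L (y := (x, y)) (by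
    rw [Prod.dist_eq]
    exact max_lt (by simp only; linarith) (by simp only; linarith [dist_triangle y x x₀]))
  have hE' : ∀ a, N x a ≤ 4 * c → (ContinuousAt (fun q : Y × (Fin n → ℝ) => E q.1 q.2) (x, a) ∧
      L x (E x a) = a) ∧ Rel x a := fun a ha => hp hx1 (hδb (by
    simpa using hx2 a (by linarith)))
  exact
    { pos := hc0
      compact := hK.of_isClosed_subset Metric.isClosed_closedBall
        ((Metric.closedBall_subset_closedBall' (by linarith)).trans hr2K)
      L_cont := fun y hy => (hL' y hy).1.1
      E_L := fun y hy => (hL' y hy).1.2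
      N_L := fun y hy => by
        have h1 := hx3 (L x y) (hL' y hy).2.le
        rw [(hL' y hy).1.2, abs_le] at h1
        linarith
      E_cont := fun a ha => (hE' a ha).1.1
      L_E := fun a ha => (hE' a ha).1.2
      dist_E := fun a ha => by
        have h1 := hx3 a (by linarith)
        rw [abs_le] at h1
        linarith
      rel := fun a ha => (hE' a ha).2 }

/-- Smaller positive radii stay good, so the good radii at a point form a convex set. Locally
constant choices can therefore be averaged by a partition of unity. -/
theorem HasDilationLimits.exists_scale [LocallyCompactSpace Y]
    (h : HasDilationLimits deg E L N Q)
    (hRel : ∀ x₀, ∀ᶠ p : Y × (Fin n → ℝ) in 𝓝 (x₀, 0), Rel p.1 p.2) :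
    ∃ ρ : Y → ℝ, Continuous ρ ∧ ∀ x, IsGoodRadius E L N Rel x (ρ x) := by
  obtain ⟨g, hg⟩ := exists_continuous_forall_mem_convex_of_local_const
    (t := fun x => {r : ℝ | IsGoodRadius E L N Rel x r})
    (fun x => OrdConnected.convex ⟨fun r hr r' hr' z hz =>
      IsGoodRadius.mono hr' (hr.pos.trans_le hz.1) hz.2⟩)
    (fun x => h.exists_isGoodRadius hRel x)
  exact ⟨g, g.continuous, hg⟩

/-! ## The dilation structure -/

/-- The dilations `E x a ↦ E x (ε·a)`, on the gauge balls of radius `2 * ρ x`. -/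
noncomputable def gaugeDilation (deg : Fin n → ℕ) (E : Y → (Fin n → ℝ) → Y)
    (L : Y → Y → Fin n → ℝ) (N : Y → (Fin n → ℝ) → ℝ) (ρ : Y → ℝ) : DilationData Y where
  scale := ρ
  -- Distance at most `3/2 ρ` gives gauge at most `10/9 · 3/2 ρ = 5/3 ρ < 2ρ`, so the closed ball of
  -- radius `A ρ` lies in `U`. Gauge below `2ρ` gives distance at most `11/5 ρ < 3ρ`, so `U` stays
  -- inside the range of validity and `B = 3` suffices.
  A := 3 / 2
  B := 3
  U x := {y | dist y x < 3 * ρ x ∧ N x (L x y) < 2 * ρ x}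
  V ε x := {y | dist y x < 3 * ρ x ∧ N x (L x y) < ε * (2 * ρ x)}
  -- With this choice `W ε⁻¹ x` and `V ε x` are the same gauge ball.
  W ε x := {y | dist y x < 3 * ρ x ∧ N x (L x y) < ε⁻¹ * (2 * ρ x)}
  δ ε x y := E x (weightedDil deg ε (L x y))

/-- The gauge ball of radius `s` around `x`. -/
def gaugeBall (L : Y → Y → Fin n → ℝ) (N : Y → (Fin n → ℝ) → ℝ) (ρ : Y → ℝ) (x : Y) (s : ℝ) :
    Set Y := {y | dist y x < 3 * ρ x ∧ N x (L x y) < s}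

variable {ρ : Y → ℝ}

section Gauge

variable (h : HasDilationLimits deg E L N Q) (hρ : ∀ x, IsGoodRadius E L N Rel x (ρ x))
include h hρ

theorem E_mem_gaugeBall {x : Y} {a : Fin n → ℝ} {s : ℝ} (hs : s ≤ 2 * ρ x) (ha : N x a < s) :
    E x a ∈ gaugeBall L N ρ x s := by
  have hp := (hρ x).pos
  have h1 := (hρ x).dist_E a (by linarith)
  refine ⟨by linarith, ?_⟩
  rwa [(hρ x).L_E a (by linarith)]

theorem isOpen_gaugeBall (x : Y) (s : ℝ) : IsOpen (gaugeBall L N ρ x s) := by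
  rw [isOpen_iff_mem_nhds]
  intro y hy
  have h1 : ContinuousAt (fun y => L x y) y :=
    ContinuousAt.comp (g := fun q : Y × Y => L q.1 q.2) (f := fun y => (x, y))
      ((hρ x).L_cont y hy.1.le) (by fun_prop)
  have h2 : ContinuousAt (fun y => N x (L x y)) y :=
    ContinuousAt.comp (g := fun p : Y × (Fin n → ℝ) => N p.1 p.2) (f := fun y => (x, L x y))
      h.continuous_N.continuousAt (continuousAt_const.prodMk h1)
  have h3 : ContinuousAt (fun y => dist y x) y := by fun_prop
  exact Filter.inter_mem (h3.eventually (gt_mem_nhds hy.1)) (h2.eventually (gt_mem_nhds hy.2))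

theorem self_mem_gaugeBall (x : Y) {s : ℝ} (hs : 0 < s) : x ∈ gaugeBall L N ρ x s :=
  ⟨by simpa using (hρ x).pos, by simpa [h.L_self, h.N_zero] using hs⟩

theorem dilation_mem_gaugeBall {x y : Y} {s ε : ℝ} (hε : 0 < ε) (hs' : ε * s ≤ 2 * ρ x)
    (hy : y ∈ gaugeBall L N ρ x s) :
    E x (weightedDil deg ε (L x y)) ∈ gaugeBall L N ρ x (ε * s) :=
  E_mem_gaugeBall h hρ hs' (by
    rw [h.N_weightedDil x _ hε.le]; exact mul_lt_mul_of_pos_left hy.2 hε)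

theorem L_dilation {x y : Y} {s ε : ℝ} (hε : 0 < ε) (hs' : ε * s ≤ 2 * ρ x)
    (hy : y ∈ gaugeBall L N ρ x s) :
    L x (E x (weightedDil deg ε (L x y))) = weightedDil deg ε (L x y) := by
  have hp := (hρ x).pos
  refine (hρ x).L_E _ ?_
  rw [h.N_weightedDil x _ hε.le]
  have := mul_lt_mul_of_pos_left hy.2 hε
  linarith

theorem dilation_inv_dilation {x y : Y} {s ε : ℝ} (hε : 0 < ε) (hs' : ε * s ≤ 2 * ρ x)
    (hy : y ∈ gaugeBall L N ρ x s) :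
    E x (weightedDil deg ε⁻¹ (L x (E x (weightedDil deg ε (L x y))))) = y := by
  rw [L_dilation h hρ hε hs' hy, weightedDil_inv_self hε.ne', (hρ x).E_L y hy.1.le]

theorem continuousOn_dilation {x : Y} {s ε : ℝ} (hε : 0 < ε) (hs' : ε * s ≤ 2 * ρ x) :
    ContinuousOn (fun y => E x (weightedDil deg ε (L x y))) (gaugeBall L N ρ x s) := by
  intro y hy
  have hp := (hρ x).pos
  refine ContinuousAt.continuousWithinAt ?_
  have h1 : ContinuousAt (fun y => L x y) y :=
    ContinuousAt.comp (g := fun q : Y × Y => L q.1 q.2) (f := fun y => (x, y))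
      ((hρ x).L_cont y hy.1.le) (by fun_prop)
  refine ContinuousAt.comp (g := fun q : Y × (Fin n → ℝ) => E q.1 q.2)
    (f := fun y => (x, weightedDil deg ε (L x y))) ((hρ x).E_cont _ ?_)
    (continuousAt_const.prodMk ((continuous_weightedDil_right deg ε).continuousAt.comp h1))
  rw [h.N_weightedDil x _ hε.le]
  have := mul_lt_mul_of_pos_left hy.2 hε
  linarith

/-- The inverse is the dilation of coefficient `ε⁻¹`. The radius `s` is free so that contractions
(`s = 2ρ`) and expansions (`s = ε⁻¹ * 2ρ`) are both covered. -/
theorem isHomeoOn_dilation {x : Y} {s ε : ℝ} (hε : 0 < ε) (hs : s ≤ 2 * ρ x)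
    (hs' : ε * s ≤ 2 * ρ x) :
    IsHomeoOn (fun y => E x (weightedDil deg ε (L x y))) (gaugeBall L N ρ x s)
      (gaugeBall L N ρ x (ε * s)) := by
  have hi : ε⁻¹ * (ε * s) = s := by field_simp
  have h1 : ε⁻¹ * (ε * s) ≤ 2 * ρ x := by rwa [hi]
  refine ⟨InvOn.bijOn (f' := fun y => E x (weightedDil deg ε⁻¹ (L x y)))
    ⟨fun y hy => dilation_inv_dilation h hρ hε hs' hy, fun y hy => ?_⟩
    (fun y hy => dilation_mem_gaugeBall h hρ hε hs' hy) (fun y hy => ?_),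
    continuousOn_dilation h hρ hε hs', fun y => E x (weightedDil deg ε⁻¹ (L x y)),
    fun y hy => dilation_inv_dilation h hρ hε hs' hy,
    continuousOn_dilation h hρ (inv_pos.2 hε) h1⟩
  · have := dilation_inv_dilation h hρ (inv_pos.2 hε) h1 hy
    rwa [inv_inv] at this
  · have := dilation_mem_gaugeBall h hρ (inv_pos.2 hε) h1 hy
    rwa [hi] at this

/-- The cases `ε ≤ 1` and `ε > 1` merge: the gauges before and after dilation must both be below
`2ρ`, and in each case one of these bounds implies the other. -/
theorem mem_dom_gaugeDilation {x y : Y} {ε : ℝ} (hε : 0 < ε) :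
    y ∈ (gaugeDilation deg E L N ρ).dom ε x ↔
      dist y x < 3 * ρ x ∧ N x (L x y) < 2 * ρ x ∧ ε * N x (L x y) < 2 * ρ x := by
  have hN := h.N_nonneg x (L x y)
  have hW : N x (L x y) < ε⁻¹ * (2 * ρ x) ↔ ε * N x (L x y) < 2 * ρ x := by
    rw [inv_mul_eq_div, lt_div_iff₀' hε]
  simp only [DilationData.dom, gaugeDilation, mem_ofPred_eq, hW]
  constructor
  · rintro (⟨h1, h2, h3⟩ | ⟨h1, h2, h3⟩)
    · exact ⟨h2, h3, by nlinarith⟩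
    · exact ⟨h2, by nlinarith, h3⟩
  · rintro ⟨h1, h2, h3⟩
    rcases le_or_gt ε 1 with h4 | h4
    · exact Or.inl ⟨h4, h1, h2⟩
    · exact Or.inr ⟨h4, h1, h3⟩

theorem mem_gaugeBall_of_dist_le {x y : Y} {s : ℝ} (hy : dist y x ≤ 3 / 2 * ρ x)
    (hs : 5 / 3 * ρ x < s) : y ∈ gaugeBall L N ρ x s := by
  have hp := (hρ x).pos
  have h1 := (hρ x).N_L y (by linarith)
  exact ⟨by linarith, by linarith⟩

theorem gaugeDilation_A0_incl (x : Y) {ε : ℝ} (hε : ε ∈ Ioo (0 : ℝ) 1) :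
    Metric.ball x (ε * ρ x) ⊆
      (fun y => E x (weightedDil deg ε (L x y))) '' Metric.ball x (3 / 2 * ρ x) ∧
    (fun y => E x (weightedDil deg ε (L x y))) '' Metric.ball x (3 / 2 * ρ x) ⊆
      gaugeBall L N ρ x (ε * (2 * ρ x)) ∧
    gaugeBall L N ρ x (ε * (2 * ρ x)) ⊆ (fun y => E x (weightedDil deg ε (L x y))) ''
      (Metric.ball x (3 * ρ x) ∩ gaugeBall L N ρ x (2 * ρ x)) := by
  have hp := (hρ x).pos
  have hε2 : ε * (2 * ρ x) ≤ 2 * ρ x := by nlinarith [hε.1, hε.2]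
  have hsurj := (isHomeoOn_dilation h hρ (s := 2 * ρ x) hε.1 le_rfl hε2).1.surjOn
  refine ⟨fun y hy => ?_, ?_, fun y hy => ?_⟩
  · rw [Metric.mem_ball] at hy
    have hlt : ε * ρ x < ρ x := by nlinarith [hε.1, hε.2]
    have hερ : 0 < ε * ρ x := mul_pos hε.1 hp
    have hNy := (hρ x).N_L y (by linarith)
    obtain ⟨z, hz, rfl⟩ := hsurj (⟨by linarith, by linarith⟩ :
      y ∈ gaugeBall L N ρ x (ε * (2 * ρ x)))
    refine ⟨z, ?_, rfl⟩
    simp only at hNy hy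
    rw [L_dilation h hρ hε.1 hε2 hz, h.N_weightedDil x _ hε.1.le] at hNy
    -- Undoing the dilation divides the gauge by `ε`; the preimage then lies at distance at most
    -- `11/10 · 10/9 ρ = 11/9 ρ < 3/2 ρ`.
    have h3 : N x (L x z) ≤ 10 / 9 * ρ x := by
      refine le_of_mul_le_mul_left ?_ hε.1
      linarith
    have h4 := (hρ x).dist_E (L x z) (by linarith)
    rw [(hρ x).E_L z hz.1.le] at h4
    rw [Metric.mem_ball]
    linarith
  · rintro _ ⟨y, hy, rfl⟩
    exact dilation_mem_gaugeBall h hρ hε.1 hε2 (mem_gaugeBall_of_dist_le h hρ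
      (Metric.mem_ball.1 hy).le (by linarith))
  · obtain ⟨z, hz, rfl⟩ := hsurj hy
    exact ⟨z, ⟨hz.1, hz⟩, rfl⟩

theorem gaugeDilation_exists_admissible (hρc : Continuous ρ) {K : Set Y} (hK : IsCompact K) :
    ∃ R, (gaugeDilation deg E L N ρ).Admissible K R := by
  -- The second dilation is based at `δ^x_ε u`, which may lie outside `K`; a lower bound for `ρ` is
  -- needed on a uniform neighbourhood of `K`.
  obtain ⟨r, hr, m, hm, hrm⟩ := hK.exists_forall_dist_lt_imp_lt hρc fun x => (hρ x).pos
  set R := min (m / 2) (r / 2) with hR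
  have hR0 : 0 < R := by positivity
  have hRm : R ≤ m / 2 := min_le_left _ _
  have hRr : R ≤ r / 2 := min_le_right _ _
  refine ⟨R, hR0, 1 / 2, by norm_num, fun x hx => ?_⟩
  have hmx := hrm x hx x (by simpa using hr)
  have hcoord : ∀ u ∈ Metric.closedBall x R, N x (L x u) ≤ 10 / 9 * R := fun u hu => by
    rw [Metric.mem_closedBall] at hu
    linarith [(hρ x).N_L u (by linarith)]
  refine ⟨fun u hu => ?_, fun u hu v hv ε hε => ?_⟩
  · exact mem_gaugeBall_of_dist_le h hρ (by linarith [Metric.mem_closedBall.1 hu])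
      (by linarith)
  have hd : ∀ u ∈ Metric.closedBall x R,
      dist (E x (weightedDil deg ε (L x u))) x ≤ 11 / 9 * (ε * R) := fun u hu => by
    have h1 := hcoord u hu
    have h2 := h.N_weightedDil x (L x u) hε.1.le
    have h3 : ε * N x (L x u) ≤ ε * (10 / 9 * R) := mul_le_mul_of_nonneg_left h1 hε.1.le
    have h4 := (hρ x).dist_E (weightedDil deg ε (L x u)) (by nlinarith [hε.1, hε.2])
    nlinarith
  have hu' := hd u hu
  have hv' := hd v hv
  simp only [gaugeDilation, mem_ofPred_eq, inv_inv]
  set w := E x (weightedDil deg ε (L x u))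
  set z := E x (weightedDil deg ε (L x v))
  have hεR : 0 < ε * R := mul_pos hε.1 hR0
  have hεR2 : ε * R ≤ R / 2 := by nlinarith [hε.1, hε.2]
  have hw := hrm x hx w (by linarith)
  -- Each point is within `11/9 ε R` of `x`. The gauge at `w` is then at most `10/9 · 22/9 ε R`,
  -- which is below `2 ε ρ w` because `R < ρ w / 2`.
  have hzw : dist z w ≤ 22 / 9 * (ε * R) := by
    linarith [dist_triangle_right z w x]
  have hNz := (hρ w).N_L z (by linarith)
  refine ⟨by linarith, ?_⟩
  have : ε * R < ε * (ρ w / 2) := mul_lt_mul_of_pos_left (by linarith) hε.1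
  nlinarith

/-- The same formula serves as the extension. On the closure the bounds on distance and dilated
gauge persist as `dist ≤ 11/5 ρ` and `ε N ≤ 2ρ`, strictly inside the ranges `3ρ` and `4ρ` where `L`
and `E` are continuous. -/
theorem gaugeDilation_continuous_extension (hρc : Continuous ρ) :
    ContinuousOn (fun p : ℝ × Y × Y => E p.2.1 (weightedDil deg p.1 (L p.2.1 p.2.2)))
      (closure (gaugeDilation deg E L N ρ).totalDom) := by
  rintro ⟨ε, x, y⟩ hp
  have hp0 := (hρ x).pos
  set S := (gaugeDilation deg E L N ρ).totalDom
  have hne : (𝓝[S] ((ε, x, y) : ℝ × Y × Y)).NeBot := mem_closure_iff_nhdsWithin_neBot.1 hp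
  have hS : ∀ᶠ p : ℝ × Y × Y in 𝓝[S] (ε, x, y), p ∈ S := self_mem_nhdsWithin
  have hid : Tendsto id (𝓝[S] ((ε, x, y) : ℝ × Y × Y)) (𝓝 (ε, x, y)) := nhdsWithin_le_nhds
  have h1 : Tendsto (fun p : ℝ × Y × Y => p.1) (𝓝[S] (ε, x, y)) (𝓝 ε) :=
    (continuous_fst.tendsto (ε, x, y)).comp hid
  have h2 : Tendsto (fun p : ℝ × Y × Y => ρ p.2.1) (𝓝[S] (ε, x, y)) (𝓝 (ρ x)) :=
    ((by fun_prop : Continuous fun p : ℝ × Y × Y => ρ p.2.1).tendsto (ε, x, y)).comp hid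
  have hmem : ∀ p ∈ S, dist p.2.2 p.2.1 ≤ 11 / 5 * ρ p.2.1 ∧
      N p.2.1 (L p.2.1 p.2.2) < 2 * ρ p.2.1 ∧ p.1 * N p.2.1 (L p.2.1 p.2.2) < 2 * ρ p.2.1 := by
    rintro ⟨ε, x, y⟩ ⟨hε, hy⟩
    obtain ⟨h3, h4, h5⟩ := (mem_dom_gaugeDilation h hρ hε).1 hy
    have h6 := (hρ x).dist_E (L x y) (by linarith [(hρ x).pos])
    simp only at h3 h4 h5 h6 ⊢
    rw [(hρ x).E_L y h3.le] at h6
    exact ⟨by linarith, h4, h5⟩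
  have hε0 : 0 ≤ ε := ge_of_tendsto h1 (hS.mono fun p hp => hp.1.le)
  have hdist : dist y x ≤ 11 / 5 * ρ x := le_of_tendsto_of_tendsto
    (((by fun_prop : Continuous fun p : ℝ × Y × Y => dist p.2.2 p.2.1).tendsto (ε, x, y)).comp hid)
    (h2.const_mul _) (hS.mono fun p hp => (hmem p hp).1)
  have hLc : ContinuousAt (fun p : ℝ × Y × Y => L p.2.1 p.2.2) (ε, x, y) :=
    ContinuousAt.comp (g := fun q : Y × Y => L q.1 q.2) (f := fun p : ℝ × Y × Y => p.2)
      ((hρ x).L_cont y (by linarith)) continuousAt_snd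
  have hNc : ContinuousAt (fun p : ℝ × Y × Y => N p.2.1 (L p.2.1 p.2.2)) (ε, x, y) :=
    ContinuousAt.comp (g := fun p : Y × (Fin n → ℝ) => N p.1 p.2)
      (f := fun p : ℝ × Y × Y => (p.2.1, L p.2.1 p.2.2))
      h.continuous_N.continuousAt ((by fun_prop : ContinuousAt _ _).prodMk hLc)
  have hNt : Tendsto (fun p : ℝ × Y × Y => N p.2.1 (L p.2.1 p.2.2)) (𝓝[S] (ε, x, y))
      (𝓝 (N x (L x y))) := hNc.tendsto.comp hid
  have hN2 : ε * N x (L x y) ≤ 2 * ρ x := le_of_tendsto_of_tendsto (h1.mul hNt)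
    (h2.const_mul _) (hS.mono fun p hp => (hmem p hp).2.2.le)
  refine ContinuousAt.continuousWithinAt ?_
  refine ContinuousAt.comp (g := fun q : Y × (Fin n → ℝ) => E q.1 q.2)
    (f := fun p : ℝ × Y × Y => (p.2.1, weightedDil deg p.1 (L p.2.1 p.2.2)))
    ((hρ x).E_cont _ ?_) ((by fun_prop : ContinuousAt _ _).prodMk ?_)
  · rw [h.N_weightedDil x _ hε0]; linarith
  · exact ContinuousAt.comp (g := fun q : ℝ × (Fin n → ℝ) => weightedDil deg q.1 q.2)
      (f := fun p : ℝ × Y × Y => (p.1, L p.2.1 p.2.2))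
      (continuous_weightedDil deg).continuousAt (continuousAt_fst.prodMk hLc)

/-- In coordinates this is multiplicativity of weighted dilations; only domains matter. The
intermediate bound `μ N < 2ρ` follows from `N < 2ρ` if `μ ≤ 1`, and from `ε μ N < 2ρ` if `ε ≥ 1`. -/
theorem gaugeDilation_A2 (x : Y) {ε μ : ℝ} (hε : 0 < ε) (hμ : 0 < μ) {u : Y}
    (hu : u ∈ gaugeBall L N ρ x (2 * ρ x)) :
    let D := gaugeDilation deg E L N ρ
    (u ∈ D.dom μ x → D.δ μ x u ∈ D.dom ε x →
      u ∈ D.dom (ε * μ) x ∧ D.δ ε x (D.δ μ x u) = D.δ (ε * μ) x u) ∧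
    ((μ ≤ 1 ∨ 1 ≤ ε) → u ∈ D.dom (ε * μ) x → u ∈ D.dom μ x ∧ D.δ μ x u ∈ D.dom ε x) := by
  intro D
  have hN := h.N_nonneg x (L x u)
  have key : μ * N x (L x u) < 2 * ρ x →
      L x (D.δ μ x u) = weightedDil deg μ (L x u) ∧ dist (D.δ μ x u) x < 3 * ρ x := fun hμu => by
    have hp := (hρ x).pos
    have h1 : N x (weightedDil deg μ (L x u)) < 2 * ρ x := by rwa [h.N_weightedDil x _ hμ.le]
    exact ⟨(hρ x).L_E _ (by linarith), (E_mem_gaugeBall h hρ le_rfl h1).1⟩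
  refine ⟨fun h1 h2 => ?_, fun h1 h2 => ?_⟩
  · rw [mem_dom_gaugeDilation h hρ hμ] at h1
    obtain ⟨k1, k2⟩ := key h1.2.2
    rw [mem_dom_gaugeDilation h hρ hε, k1, h.N_weightedDil x _ hμ.le] at h2
    refine ⟨(mem_dom_gaugeDilation h hρ (mul_pos hε hμ)).2 ⟨hu.1, hu.2, ?_⟩, ?_⟩
    · rw [mul_assoc]; exact h2.2.2
    · change E x (weightedDil deg ε (L x (D.δ μ x u))) = E x (weightedDil deg (ε * μ) (L x u))
      rw [k1, weightedDil_mul]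
  · rw [mem_dom_gaugeDilation h hρ (mul_pos hε hμ), mul_assoc] at h2
    have hμu : μ * N x (L x u) < 2 * ρ x := by
      rcases h1 with h1 | h1
      · nlinarith
      · nlinarith [mul_nonneg hμ.le hN]
    obtain ⟨k1, k2⟩ := key hμu
    refine ⟨(mem_dom_gaugeDilation h hρ hμ).2 ⟨hu.1, hu.2, hμu⟩,
      (mem_dom_gaugeDilation h hρ hε).2 ⟨k2, ?_, ?_⟩⟩ <;> rw [k1, h.N_weightedDil x _ hμ.le]
    · exact hμu
    · exact h2.2.2

theorem gaugeDilation_isDistanceOn (x : Y) :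
    IsDistanceOn (fun u v => N x (Q x (L x u) (L x v)))
      (Metric.closedBall x (3 / 2 * ρ x)) := by
  have hp := (hρ x).pos
  refine ⟨fun u hu v hv => ⟨h.N_nonneg _ _, h.N_Q_comm _ _ _, ?_⟩,
    fun u _ v _ w _ => h.N_Q_triangle _ _ _ _⟩
  rw [h.N_eq_zero]
  rw [Metric.mem_closedBall] at hu hv
  refine ⟨fun H => ?_, fun H => by rw [H, h.Q_self]⟩
  rw [← (hρ x).E_L u (by linarith), ← (hρ x).E_L v (by linarith), h.eq_of_Q_eq_zero H]

theorem gaugeDilation_A3 (hρc : Continuous ρ) {K : Set Y} (hK : IsCompact K) {η : ℝ}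
    (hη : 0 < η) : ∃ ε₀ ∈ Ioo (0 : ℝ) 1, ∀ ε ∈ Ioo 0 ε₀, ∀ x ∈ K,
      ∀ u ∈ Metric.closedBall x (3 / 2 * ρ x), ∀ v ∈ Metric.closedBall x (3 / 2 * ρ x),
        |1 / ε * dist (E x (weightedDil deg ε (L x u))) (E x (weightedDil deg ε (L x v))) -
          N x (Q x (L x u) (L x v))| < η := by
  have h1 := eventually_forall_dist_lt_of_tendsto_prod
    (h.isCompact_gauge_le hK (f := fun x => 2 * ρ x) (by fun_prop))
    (fun z _ => h.dist_tendsto z.1 z.2.1 z.2.2)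
    (g := fun z : Y × (Fin n → ℝ) × (Fin n → ℝ) => N z.1 (Q z.1 z.2.1 z.2.2)) hη
  obtain ⟨ε₀, hε₀, h2⟩ := exists_Ioo_of_eventually_nhdsGT h1
  refine ⟨ε₀, hε₀, fun ε hε x hx u hu v hv => ?_⟩
  have hp := (hρ x).pos
  have hb : ∀ u ∈ Metric.closedBall x (3 / 2 * ρ x), N x (L x u) ≤ 2 * ρ x := fun u hu =>
    (mem_gaugeBall_of_dist_le h hρ (Metric.mem_closedBall.1 hu) (by linarith :
      5 / 3 * ρ x < 2 * ρ x)).2.le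
  have h3 := h2 ε hε (x, L x u, L x v) ⟨hx, hb u hu, hb v hv⟩
  rw [Real.dist_eq] at h3
  simpa [one_div] using h3

/-- `u` is the new base point and `v` the point seen from it, so `v` comes first in `Q`. The limit
vector has gauge at most `2ρ + 2ρ`, which is why `E` is required to be continuous up to gauge `4ρ`.
-/
theorem gaugeDilation_A4 (hρc : Continuous ρ) {K : Set Y} (hK : IsCompact K) {η : ℝ}
    (hη : 0 < η) : ∃ ε₀ ∈ Ioo (0 : ℝ) 1, ∀ ε ∈ Ioo 0 ε₀, ∀ x ∈ K,
      ∀ u ∈ gaugeBall L N ρ x (2 * ρ x), ∀ v ∈ gaugeBall L N ρ x (2 * ρ x),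
        dist ((gaugeDilation deg E L N ρ).approxDiff ε x u v)
          (E x (Q x (L x v) (L x u))) < η := by
  have h1 := eventually_forall_dist_lt_of_tendsto_prod
    (h.isCompact_gauge_le hK (f := fun x => 2 * ρ x) (by fun_prop)) (l := 𝓝[>] (0 : ℝ))
    (f := fun p => E (E p.2.1 (weightedDil deg p.1 p.2.2.2)) (weightedDil deg p.1⁻¹
      (L (E p.2.1 (weightedDil deg p.1 p.2.2.2)) (E p.2.1 (weightedDil deg p.1 p.2.2.1)))))
    (g := fun z : Y × (Fin n → ℝ) × (Fin n → ℝ) => E z.1 (Q z.1 z.2.1 z.2.2))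
    (fun z hz => by
      have h3 : ContinuousAt (fun q : Y × (Fin n → ℝ) => E q.1 q.2) (z.1, Q z.1 z.2.1 z.2.2) :=
        (hρ z.1).E_cont _ ((h.N_Q_le _ _ _).trans (by linarith [hz.2.1, hz.2.2]))
      exact h3.tendsto.comp ((h.tendsto_E_snd z.1 z.2.1 z.2.2).prodMk_nhds
        (h.Q_tendsto z.1 z.2.1 z.2.2))) hη
  obtain ⟨ε₀, hε₀, h2⟩ := exists_Ioo_of_eventually_nhdsGT h1
  exact ⟨ε₀, hε₀, fun ε hε x hx u hu v hv => h2 ε hε (x, L x v, L x u) ⟨hx, hv.2.le, hu.2.le⟩⟩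

theorem gaugeDilation_isStrongDilationStructure (hρc : Continuous ρ) :
    (gaugeDilation deg E L N ρ).IsStrongDilationStructure where
  scale_continuous := hρc
  scale_pos x := (hρ x).pos
  compact_ball x := (hρ x).compact
  U_nhd x := ⟨isOpen_gaugeBall h hρ x _, self_mem_gaugeBall h hρ x (by linarith [(hρ x).pos])⟩
  V_nhd x ε hε := ⟨isOpen_gaugeBall h hρ x _,
    self_mem_gaugeBall h hρ x (mul_pos hε.1 (by linarith [(hρ x).pos]))⟩
  W_nhd x ε hε := ⟨isOpen_gaugeBall h hρ x _, self_mem_gaugeBall h hρ x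
    (mul_pos (inv_pos.2 (one_pos.trans hε)) (by linarith [(hρ x).pos]))⟩
  homeo_le x ε hε := isHomeoOn_dilation h hρ hε.1 le_rfl
    (by nlinarith [hε.1, hε.2, (hρ x).pos])
  homeo_gt x ε hε := by
    have hp := (hρ x).pos
    have h1 : (1 : ℝ) < ε := hε
    have h0 : (0 : ℝ) < ε := by linarith
    have h2 : ε * (ε⁻¹ * (2 * ρ x)) = 2 * ρ x := by field_simp
    have h3 : ε⁻¹ ≤ 1 := inv_le_one_of_one_le₀ h1.le
    have := isHomeoOn_dilation h hρ (s := ε⁻¹ * (2 * ρ x)) h0 (by nlinarith) h2.le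
    rwa [h2] at this
  one_lt_A := by norm_num [gaugeDilation]
  A_lt_B := by norm_num [gaugeDilation]
  ball_A_subset x y hy := mem_gaugeBall_of_dist_le h hρ (Metric.mem_closedBall.1 hy)
    (by linarith [(hρ x).pos])
  A0_incl x ε hε := by
    obtain ⟨h1, h2, h3⟩ := gaugeDilation_A0_incl h hρ x hε
    refine ⟨h1, h2, ?_, ?_⟩
    · change gaugeBall L N ρ x (ε * (2 * ρ x)) ⊆ gaugeBall L N ρ x (ε⁻¹⁻¹ * (2 * ρ x))
      rw [inv_inv]
    · change gaugeBall L N ρ x (ε⁻¹⁻¹ * (2 * ρ x)) ⊆ _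
      rw [inv_inv]
      exact h3
  A0_diff K hK := gaugeDilation_exists_admissible h hρ hρc hK
  A1_base x ε _ := by simp [gaugeDilation, h.L_self, h.E_zero]
  A1_one x y hy := by simpa [gaugeDilation] using (hρ x).E_L y hy.1.le
  A1_cont := ⟨_, gaugeDilation_continuous_extension h hρ hρc, fun _ _ => rfl, fun x y _ => by
    simp [weightedDil_zero_left h.deg_pos, h.E_zero]⟩
  A2 x ε hε μ hμ u hu := gaugeDilation_A2 h hρ x hε hμ hu
  A3 := ⟨_, gaugeDilation_isDistanceOn h hρ, fun K hK η hη => gaugeDilation_A3 h hρ hρc hK hη⟩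
  A4 := ⟨fun x u v => E x (Q x (L x v) (L x u)), fun K hK R hR η hη => by
    obtain ⟨ε₀, hε₀, h1⟩ := gaugeDilation_A4 h hρ hρc hK hη
    obtain ⟨_, _, _, h2⟩ := hR
    exact ⟨ε₀, hε₀, fun ε hε x hx u hu v hv =>
      h1 ε hε x hx u ((h2 x hx).1 hu) v ((h2 x hx).1 hv)⟩⟩

theorem gaugeDilation_coordinates (x : Y) : ∃ O : Set (Fin n → ℝ), IsOpen O ∧ 0 ∈ O ∧
    (∀ a ∈ O, ∀ ε ∈ Ioc (0 : ℝ) 1, weightedDil deg ε a ∈ O) ∧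
    IsHomeoOn (E x) O ((gaugeDilation deg E L N ρ).U x) ∧ (∀ a ∈ O, Rel x a) ∧
    ∀ a ∈ O, ∀ ε > 0, E x a ∈ (gaugeDilation deg E L N ρ).dom ε x →
      Rel x (weightedDil deg ε a) ∧
        (gaugeDilation deg E L N ρ).δ ε x (E x a) = E x (weightedDil deg ε a) := by
  have hp := (hρ x).pos
  have hNc : Continuous fun a => N x a := h.continuous_N.comp (by fun_prop :
    Continuous fun a : Fin n → ℝ => (x, a))
  have hLE : ∀ a, N x a < 2 * ρ x → L x (E x a) = a := fun a ha =>
    (hρ x).L_E a (by linarith)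
  have hmaps : MapsTo (E x) {a | N x a < 2 * ρ x} (gaugeBall L N ρ x (2 * ρ x)) :=
    fun a ha => E_mem_gaugeBall h hρ le_rfl ha
  refine ⟨{a | N x a < 2 * ρ x}, isOpen_lt hNc continuous_const, ?_, fun a ha ε hε => ?_,
    ⟨InvOn.bijOn (f' := L x) ⟨fun a ha => hLE a ha, fun y hy => (hρ x).E_L y hy.1.le⟩ hmaps
      (fun y hy => hy.2), fun a ha => ?_, L x, fun a ha => hLE a ha, fun y hy => ?_⟩,
    fun a ha => (hρ x).rel a ?_, fun a ha ε hε hdom => ?_⟩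
  · simpa [h.N_zero] using hp
  · simp only [mem_ofPred_eq, h.N_weightedDil x _ hε.1.le] at ha ⊢
    nlinarith [h.N_nonneg x a, hε.1, hε.2]
  · exact (ContinuousAt.comp (g := fun q : Y × (Fin n → ℝ) => E q.1 q.2) (f := fun a => (x, a))
      ((hρ x).E_cont a (by linarith [show N x a < 2 * ρ x from ha]))
      (by fun_prop)).continuousWithinAt
  · exact (ContinuousAt.comp (g := fun q : Y × Y => L q.1 q.2) (f := fun y => (x, y))
      ((hρ x).L_cont y hy.1.le) (by fun_prop)).continuousWithinAt
  · linarith [show N x a < 2 * ρ x from ha]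
  · have h1 := (mem_dom_gaugeDilation h hρ hε).1 hdom
    rw [hLE a ha] at h1
    refine ⟨(hρ x).rel _ ?_, ?_⟩
    · rw [h.N_weightedDil x _ hε.le]; linarith
    · change E x (weightedDil deg ε (L x (E x a))) = _
      rw [hLE a ha]

end Gauge

end GoodRadius

/-! ## Flows of bounded Lipschitz fields -/

section Flow

variable {F : Type*} [NormedAddCommGroup F] [NormedSpace ℝ F]

/-- Speed at most `B` keeps the solution in the ball of radius `2B` for times up to 2. The open
interval `(-2, 2)` provides two-sided derivatives on all of `[-1, 1]`. -/
theorem exists_flow_of_lipschitz [CompleteSpace F] {f : F → F} {K B : NNReal} (hK : LipschitzWith K f)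
    (hB : ∀ z, ‖f z‖ ≤ B) (x : F) :
    ∃ γ : ℝ → F, γ 0 = x ∧ ∀ t ∈ Ioo (-2 : ℝ) 2, HasDerivAt γ (f (γ t)) t := by
  have hpl : IsPicardLindelof (fun _ : ℝ => f) (tmin := -2) (tmax := 2) ⟨0, by norm_num⟩ x
      (B * 2) 0 B K :=
    IsPicardLindelof.of_time_independent (fun z _ => hB z) hK.lipschitzOnWith (by
      norm_num)
  obtain ⟨γ, h0, h1⟩ := hpl.exists_eq_forall_mem_Icc_hasDerivWithinAt₀
  exact ⟨γ, h0, fun t ht => (h1 t (Ioo_subset_Icc_self ht)).hasDerivAt (Icc_mem_nhds ht.1 ht.2)⟩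

theorem norm_flow_sub_le {f : F → F} {B : ℝ} (hB : ∀ z, ‖f z‖ ≤ B) {γ : ℝ → F}
    (hγ : ∀ t ∈ Ioo (-2 : ℝ) 2, HasDerivAt γ (f (γ t)) t) {s t : ℝ} (hs : s ∈ Ioo (-2 : ℝ) 2)
    (ht : t ∈ Ioo (-2 : ℝ) 2) : ‖γ t - γ s‖ ≤ B * |t - s| :=
  (convex_Ioo (-2 : ℝ) 2).norm_image_sub_le_of_norm_hasDerivWithin_le
    (fun u hu => (hγ u hu).hasDerivWithinAt) (fun _ _ => hB _) hs ht

end Flow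

/-! ## The exponential map of a frame of a vector space -/

section Exp

variable {F : Type*} [NormedAddCommGroup F] [NormedSpace ℝ F] {n : ℕ}

theorem norm_sum_smul_le (a : Fin n → ℝ) (w : Fin n → F) {W : ℝ} (hW : ∀ i, ‖w i‖ ≤ W) :
    ‖∑ i, a i • w i‖ ≤ n * (‖a‖ * W) := by
  calc ‖∑ i, a i • w i‖ ≤ ∑ i : Fin n, ‖a i • w i‖ := norm_sum_le _ _
    _ ≤ ∑ _i : Fin n, ‖a‖ * W := Finset.sum_le_sum fun i _ => by
        rw [norm_smul]
        exact mul_le_mul (norm_le_pi_norm a i) (hW i) (norm_nonneg _) (norm_nonneg _)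
    _ = n * (‖a‖ * W) := by simp

variable {Y : Fin n → F → F} {K B : NNReal}

theorem lipschitzWith_sum_smul (hK : ∀ i, LipschitzWith K (Y i)) (a : Fin n → ℝ) :
    LipschitzWith (n * (‖a‖₊ * K)) fun z => ∑ i, a i • Y i z := by
  refine LipschitzWith.of_dist_le_mul fun z z' => ?_
  rw [dist_eq_norm, ← Finset.sum_sub_distrib]
  simp only [← smul_sub]
  refine (norm_sum_smul_le a _ (W := K * dist z z') fun i => ?_).trans (le_of_eq ?_)
  · rw [← dist_eq_norm]; exact (hK i).dist_le_mul z z'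
  · push_cast; ring

theorem norm_sum_smul_field_le (hB : ∀ i z, ‖Y i z‖ ≤ B) (a : Fin n → ℝ) (z : F) :
    ‖∑ i, a i • Y i z‖ ≤ n * (‖a‖ * B) :=
  norm_sum_smul_le a _ fun i => hB i z

/-- `γ` is the integral curve of `∑ a_i Y_i` starting at `x`. -/
def IsFrameFlow (Y : Fin n → F → F) (a : Fin n → ℝ) (x : F) (γ : ℝ → F) : Prop :=
  γ 0 = x ∧ ∀ t ∈ Ioo (-2 : ℝ) 2, HasDerivAt γ (∑ i, a i • Y i (γ t)) t

theorem exists_isFrameFlow [CompleteSpace F] (hK : ∀ i, LipschitzWith K (Y i))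
    (hB : ∀ i z, ‖Y i z‖ ≤ B) (a : Fin n → ℝ) (x : F) : ∃ γ, IsFrameFlow Y a x γ :=
  exists_flow_of_lipschitz (B := n * (‖a‖₊ * B)) (lipschitzWith_sum_smul hK a)
    (fun z => by push_cast; exact norm_sum_smul_field_le hB a z) x

theorem IsFrameFlow.continuousOn {a : Fin n → ℝ} {x : F} {γ : ℝ → F} (h : IsFrameFlow Y a x γ) :
    ContinuousOn γ (Icc 0 1) := fun t ht =>
  (h.2 t ⟨by linarith [ht.1], by linarith [ht.2]⟩).continuousAt.continuousWithinAt

theorem IsFrameFlow.norm_sub_le (hB : ∀ i z, ‖Y i z‖ ≤ B) {a : Fin n → ℝ} {x : F} {γ : ℝ → F}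
    (h : IsFrameFlow Y a x γ) {t : ℝ} (ht : t ∈ Icc (0 : ℝ) 1) :
    ‖γ t - x‖ ≤ n * (‖a‖ * B) := by
  have h1 := norm_flow_sub_le (norm_sum_smul_field_le hB a) h.2 (s := 0) (t := t)
    (by norm_num) ⟨by linarith [ht.1], by linarith [ht.2]⟩
  rw [h.1, sub_zero, abs_of_nonneg ht.1] at h1
  refine h1.trans ?_
  have : (0 : ℝ) ≤ n * (‖a‖ * B) := by positivity
  nlinarith [ht.1, ht.2]

theorem gronwallBound_le {δ K ε t : ℝ} (hK : 1 ≤ K) (hδ : 0 ≤ δ) (hε : 0 ≤ ε) (ht : t ≤ 1) :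
    gronwallBound δ K ε t ≤ Real.exp K * (δ + ε) := by
  have hK0 : K ≠ 0 := by linarith
  rw [gronwallBound_of_K_ne_0 hK0]
  have h1 : Real.exp (K * t) ≤ Real.exp K := Real.exp_le_exp.2 (by nlinarith)
  have h2 : ε / K ≤ ε := div_le_self hε hK
  have h3 : 0 ≤ ε / K := by positivity
  have h4 := Real.exp_pos K
  nlinarith [mul_le_mul h2 h1 (Real.exp_pos _).le hε]

/-- Lipschitz dependence of the flow on the initial value and on the coefficients. -/
theorem IsFrameFlow.norm_sub_flow_le (hK : ∀ i, LipschitzWith K (Y i))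
    (hB : ∀ i z, ‖Y i z‖ ≤ B) {a a' : Fin n → ℝ} {x x' : F} {γ γ' : ℝ → F}
    (h : IsFrameFlow Y a x γ) (h' : IsFrameFlow Y a' x' γ') (ha : ‖a‖ ≤ 1) {t : ℝ}
    (ht : t ∈ Icc (0 : ℝ) 1) :
    ‖γ t - γ' t‖ ≤ Real.exp (n * K + 1) * (‖x - x'‖ + n * (‖a - a'‖ * B)) := by
  have hmem : ∀ t ∈ Ico (0 : ℝ) 1, t ∈ Ioo (-2 : ℝ) 2 := fun t ht =>
    ⟨by linarith [ht.1], by linarith [ht.2]⟩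
  have hlip : LipschitzWith (n * K + 1) fun z => ∑ i, a i • Y i z :=
    (lipschitzWith_sum_smul hK a).weaken (by
      rw [← NNReal.coe_le_coe]; push_cast
      have h1 : ‖a‖ * K ≤ K := mul_le_of_le_one_left K.2 ha
      have h2 : (n : ℝ) * (‖a‖ * K) ≤ n * K := mul_le_mul_of_nonneg_left h1 (by positivity)
      linarith)
  -- Grönwall's inequality: `γ'` solves the equation of `γ` up to the error `n * (‖a - a'‖ * B)`.
  have h1 := dist_le_of_approx_trajectories_ODE (v := fun _ z => ∑ i, a i • Y i z)
    (f := γ) (g := γ') (f' := fun t => ∑ i, a i • Y i (γ t))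
    (g' := fun t => ∑ i, a' i • Y i (γ' t)) (εf := 0) (εg := n * (‖a - a'‖ * B))
    (δ := ‖x - x'‖) (a := 0) (b := 1) (fun _ => hlip) h.continuousOn
    (fun t ht => (h.2 t (hmem t ht)).hasDerivWithinAt) (fun t _ => by simp) h'.continuousOn
    (fun t ht => (h'.2 t (hmem t ht)).hasDerivWithinAt) (fun t _ => by
      rw [dist_comm, dist_eq_norm, ← Finset.sum_sub_distrib]
      simp only [← sub_smul]
      exact norm_sum_smul_le (a - a') _ fun i => hB i _)
    (by rw [h.1, h'.1, dist_eq_norm]) t ht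
  rw [dist_eq_norm, zero_add, sub_zero] at h1
  refine h1.trans ?_
  push_cast
  exact gronwallBound_le (by have : (0 : ℝ) ≤ n * K := by positivity
                             linarith) (norm_nonneg _) (by positivity) ht.2

/-- The time-one map of the flows of `∑ a_i Y_i` is strictly differentiable at `(x₀, 0)`. -/
theorem hasStrictFDerivAt_frameFlow (hK : ∀ i, LipschitzWith K (Y i))
    (hB : ∀ i z, ‖Y i z‖ ≤ B) {γ : F → (Fin n → ℝ) → ℝ → F}
    (hγ : ∀ x a, IsFrameFlow Y a x (γ x a)) (x₀ : F) (A : (Fin n → ℝ) →L[ℝ] F)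
    (hA : ∀ a, A a = ∑ i, a i • Y i x₀) :
    HasStrictFDerivAt (fun p : F × (Fin n → ℝ) => γ p.1 p.2 1)
      (ContinuousLinearMap.fst ℝ F (Fin n → ℝ) + A.comp (ContinuousLinearMap.snd ℝ F (Fin n → ℝ)))
      (x₀, 0) := by
  refine .of_isLittleO <| Asymptotics.isLittleO_iff.2 fun c hc => ?_
  set C : ℝ := Real.exp (n * K + 1) * (1 + n * B) with hC
  have hC0 : 0 ≤ C := by positivity
  set δ : ℝ := min 1 (c / (2 * (n * (K * C) + n * (K * (1 + n * B)) + 1))) with hδ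
  have hδ0 : 0 < δ := by positivity
  have hδc : δ * (n * (K * C) + n * (K * (1 + n * B))) ≤ c := by
    have h1 : δ ≤ c / (2 * (n * (K * C) + n * (K * (1 + n * B)) + 1)) := min_le_right _ _
    rw [le_div_iff₀ (by positivity)] at h1
    have : 0 ≤ δ * (n * (K * C) + n * (K * (1 + n * B))) := by positivity
    nlinarith
  filter_upwards [(Metric.ball_mem_nhds (((x₀, 0), (x₀, 0)) :
    (F × (Fin n → ℝ)) × (F × (Fin n → ℝ))) hδ0)] with ⟨⟨x, a⟩, ⟨x', a'⟩⟩ hp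
  simp only [Metric.mem_ball, Prod.dist_eq, max_lt_iff, dist_zero_right] at hp
  obtain ⟨⟨hx, ha⟩, hx', ha'⟩ := hp
  rw [dist_eq_norm] at hx hx'
  have hδ1 : δ ≤ 1 := min_le_left _ _
  set Δ : ℝ := ‖((x, a) : F × (Fin n → ℝ)) - (x', a')‖ with hΔ
  have hΔx : ‖x - x'‖ ≤ Δ := norm_fst_le ((x, a) - (x', a') : F × (Fin n → ℝ))
  have hΔa : ‖a - a'‖ ≤ Δ := norm_snd_le ((x, a) - (x', a') : F × (Fin n → ℝ))
  have hΔ0 : 0 ≤ Δ := norm_nonneg _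
  have hflow : ∀ t ∈ Icc (0 : ℝ) 1, ‖γ x a t - γ x' a' t‖ ≤ C * Δ := fun t ht => by
    refine ((hγ x a).norm_sub_flow_le hK hB (hγ x' a') (by linarith) ht).trans ?_
    rw [hC, mul_assoc]
    refine mul_le_mul_of_nonneg_left ?_ (Real.exp_pos _).le
    have : n * (‖a - a'‖ * B) ≤ n * (Δ * B) := by gcongr
    linarith
  have hdisp : ∀ t ∈ Icc (0 : ℝ) 1, ‖γ x' a' t - x₀‖ ≤ (1 + n * B) * δ := fun t ht => by
    have h1 := (hγ x' a').norm_sub_le hB ht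
    have h2 : n * (‖a'‖ * B) ≤ n * (δ * B) := by gcongr
    have h3 := norm_add_le (γ x' a' t - x') (x' - x₀)
    rw [sub_add_sub_cancel] at h3
    linarith
  have hmem : ∀ t ∈ Icc (0 : ℝ) 1, t ∈ Ioo (-2 : ℝ) 2 := fun t ht =>
    ⟨by linarith [ht.1], by linarith [ht.2]⟩
  -- Mean value inequality for the difference of the two flows minus its linear part. The derivative
  -- splits into `∑ a_i (Y_i γ - Y_i γ')`, small because `‖a‖ < δ`, and `∑ (a - a')_i (Y_i γ' - Y_i
  -- x₀)`, small because `γ'` stays near `x₀`.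
  have hmv := norm_image_sub_le_of_norm_deriv_le_segment_01'
    (f := fun t => γ x a t - γ x' a' t - t • A (a - a'))
    (f' := fun t => (∑ i, a i • Y i (γ x a t)) - (∑ i, a' i • Y i (γ x' a' t)) -
      (1 : ℝ) • A (a - a')) (C := c * Δ)
    (fun t ht => ((((hγ x a).2 t (hmem t ht)).sub ((hγ x' a').2 t (hmem t ht))).sub
      ((hasDerivAt_id t).smul_const _)).hasDerivWithinAt)
    (fun t ht => by
      have ht' := Ico_subset_Icc_self ht
      have heq : (∑ i, a i • Y i (γ x a t)) - (∑ i, a' i • Y i (γ x' a' t)) -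
          (1 : ℝ) • A (a - a') = (∑ i, a i • (Y i (γ x a t) - Y i (γ x' a' t))) +
          ∑ i, (a - a') i • (Y i (γ x' a' t) - Y i x₀) := by
        rw [one_smul, hA, ← Finset.sum_sub_distrib, ← Finset.sum_sub_distrib,
          ← Finset.sum_add_distrib]
        refine Finset.sum_congr rfl fun i _ => ?_
        simp only [Pi.sub_apply, smul_sub, sub_smul]
        abel
      rw [heq]
      have h1 : ‖∑ i, a i • (Y i (γ x a t) - Y i (γ x' a' t))‖ ≤ n * (‖a‖ * (K * (C * Δ))) :=
        norm_sum_smul_le a _ fun i => by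
          have := (hK i).dist_le_mul (γ x a t) (γ x' a' t)
          rw [dist_eq_norm, dist_eq_norm] at this
          exact this.trans (mul_le_mul_of_nonneg_left (hflow t ht') K.2)
      have h2 : ‖∑ i, (a - a') i • (Y i (γ x' a' t) - Y i x₀)‖ ≤
          n * (‖a - a'‖ * (K * ((1 + n * B) * δ))) :=
        norm_sum_smul_le (a - a') _ fun i => by
          have := (hK i).dist_le_mul (γ x' a' t) x₀
          rw [dist_eq_norm, dist_eq_norm] at this
          exact this.trans (mul_le_mul_of_nonneg_left (hdisp t ht') K.2)
      have h3 : n * (‖a‖ * (K * (C * Δ))) ≤ n * (δ * (K * (C * Δ))) := by gcongr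
      have h4 : n * (‖a - a'‖ * (K * ((1 + n * B) * δ))) ≤ n * (Δ * (K * ((1 + n * B) * δ))) := by
        gcongr
      have h5 := mul_le_mul_of_nonneg_right hδc hΔ0
      refine (norm_add_le _ _).trans ?_
      nlinarith)
  have heq : γ x a 1 - γ x' a' 1 - (ContinuousLinearMap.fst ℝ F (Fin n → ℝ) +
      A.comp (ContinuousLinearMap.snd ℝ F (Fin n → ℝ))) ((x, a) - (x', a')) =
      (γ x a 1 - γ x' a' 1 - (1 : ℝ) • A (a - a')) -
      (γ x a 0 - γ x' a' 0 - (0 : ℝ) • A (a - a')) := by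
    rw [(hγ x a).1, (hγ x' a').1]
    simp
    abel
  simp only
  rw [heq]
  exact hmv

/-- Local exponential coordinates of a frame of a vector space. -/
theorem exists_local_exp [CompleteSpace F] (hK : ∀ i, LipschitzWith K (Y i))
    (hB : ∀ i z, ‖Y i z‖ ≤ B) (x₀ : F) (A : (Fin n → ℝ) ≃L[ℝ] F)
    (hA : ∀ a, A a = ∑ i, a i • Y i x₀) :
    ∃ (G : F → (Fin n → ℝ) → F) (Λ : F → F → Fin n → ℝ),
      (∀ x a, ∃ γ, IsFrameFlow Y a x γ ∧ γ 1 = G x a) ∧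
      (∀ᶠ p : F × (Fin n → ℝ) in 𝓝 (x₀, 0),
        ContinuousAt (fun q : F × (Fin n → ℝ) => G q.1 q.2) p ∧ Λ p.1 (G p.1 p.2) = p.2) ∧
      (∀ᶠ p : F × F in 𝓝 (x₀, x₀),
        ContinuousAt (fun q : F × F => Λ q.1 q.2) p ∧ G p.1 (Λ p.1 p.2) = p.2) ∧
      Λ x₀ x₀ = 0 ∧ G x₀ 0 = x₀ := by
  choose γ hγ using fun (x : F) (a : Fin n → ℝ) => exists_isFrameFlow hK hB a x
  have hG0 : γ x₀ 0 1 = x₀ := by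
    have := (hγ x₀ 0).norm_sub_le hB (t := 1) (by norm_num)
    simpa [sub_eq_zero] using this
  -- The derivative `(v, a) ↦ (v, v + A a)` of `(x, a) ↦ (x, exp)` is invertible since `A` is.
  -- Keeping `x` as a coordinate makes the inverse a logarithm with moving base point.
  set e : (F × (Fin n → ℝ)) ≃L[ℝ] F × F := (ContinuousLinearEquiv.refl ℝ F).skewProd A
    (ContinuousLinearMap.id ℝ F) with he
  have h1 : HasStrictFDerivAt (fun p : F × (Fin n → ℝ) => (p.1, γ p.1 p.2 1))
      (e : (F × (Fin n → ℝ)) →L[ℝ] F × F) (x₀, 0) := by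
    have h2 := (hasStrictFDerivAt_fst (𝕜 := ℝ) (E := F) (F := Fin n → ℝ) (p := (x₀, 0))).prodMk
      (hasStrictFDerivAt_frameFlow hK hB hγ x₀ (A : (Fin n → ℝ) →L[ℝ] F) hA)
    convert! h2 using 1
    ext p <;> simp [he]
  set Φ := h1.toOpenPartialHomeomorph _ with hΦ
  have hΦc : ∀ p, Φ p = (p.1, γ p.1 p.2 1) := fun p => by
    rw [hΦ, HasStrictFDerivAt.toOpenPartialHomeomorph_coe]
  have hsrc : ((x₀, 0) : F × (Fin n → ℝ)) ∈ Φ.source := h1.mem_toOpenPartialHomeomorph_source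
  have htgt : ((x₀, x₀) : F × F) ∈ Φ.target := by
    have := Φ.map_source hsrc
    rwa [hΦc, hG0] at this
  refine ⟨fun x a => γ x a 1, fun x y => (Φ.symm (x, y)).2, fun x a => ⟨_, hγ x a, rfl⟩,
    ?_, ?_, ?_, hG0⟩
  · filter_upwards [Φ.open_source.mem_nhds hsrc] with p hp
    constructor
    · have h3 := (Φ.continuousAt hp).snd
      exact h3.congr (Eventually.of_forall fun q => by simp only [hΦc])
    · have h3 := Φ.left_inv hp
      rw [hΦc] at h3
      rw [h3]
  · filter_upwards [Φ.open_target.mem_nhds htgt] with p hp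
    refine ⟨(Φ.symm.continuousAt hp).snd, ?_⟩
    have h3 := Φ.right_inv hp
    rw [hΦc] at h3
    have h4 : (Φ.symm p).1 = p.1 := congrArg Prod.fst h3
    have h5 : γ (Φ.symm p).1 (Φ.symm p).2 1 = p.2 := congrArg Prod.snd h3
    rwa [h4] at h5
  · have h3 := Φ.left_inv hsrc
    rw [hΦc, hG0] at h3
    simp [h3]

end Exp

/-! ## Formal expansions of families of maps -/

section Expansion

variable (E : Type*) [NormedAddCommGroup E] [NormedSpace ℝ E]

/-- The smooth maps from `E` to itself. -/
def SmoothMaps : Submodule ℝ (E → E) where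
  carrier := {f | ContDiff ℝ ∞ f}
  add_mem' hf hg := by
    rw [mem_ofPred_eq] at *
    exact hf.add hg
  zero_mem' := by
    rw [mem_ofPred_eq]
    exact contDiff_const
  smul_mem' c _ hf := by
    rw [mem_ofPred_eq] at *
    exact hf.const_smul c

variable {E}

theorem mem_smoothMaps {f : E → E} : f ∈ SmoothMaps E ↔ ContDiff ℝ ∞ f := by
  change f ∈ {f : E → E | ContDiff ℝ ∞ f} ↔ _
  rw [mem_ofPred_eq]

theorem smoothMaps_contDiff (f : SmoothMaps E) : ContDiff ℝ ∞ (f : E → E) :=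
  mem_smoothMaps.1 f.2

theorem smoothMaps_differentiableAt (f : SmoothMaps E) (z : E) : DifferentiableAt ℝ (f : E → E) z :=
  ((smoothMaps_contDiff f).differentiable (by simp)).differentiableAt

/-- Differentiation in the direction of a smooth field. -/
noncomputable def dirDeriv (V : SmoothMaps E) : Module.End ℝ (SmoothMaps E) where
  toFun f := ⟨fun z => fderiv ℝ (f : E → E) z ((V : E → E) z), mem_smoothMaps.2 <|
    ((smoothMaps_contDiff f).fderiv_right (m := ∞) (by simp)).clm_apply (smoothMaps_contDiff V)⟩
  map_add' f g := by
    ext z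
    simp [fderiv_add (smoothMaps_differentiableAt f z) (smoothMaps_differentiableAt g z)]
  map_smul' c f := by
    ext z
    simp [fderiv_const_smul (smoothMaps_differentiableAt f z)]

@[simp] theorem dirDeriv_apply (V f : SmoothMaps E) (z : E) :
    (dirDeriv V f : E → E) z = fderiv ℝ (f : E → E) z ((V : E → E) z) := rfl

/-- The identity, as a smooth map. -/
def smoothId : SmoothMaps E := ⟨fun z => z, mem_smoothMaps.2 contDiff_id⟩

@[simp] theorem dirDeriv_id (V : SmoothMaps E) : dirDeriv V smoothId = V := by
  ext z
  change fderiv ℝ (fun z : E => z) z _ = _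
  simp

/-- The Lie bracket of smooth fields. -/
noncomputable def smoothBracket (V W : SmoothMaps E) : SmoothMaps E :=
  ⟨VectorField.lieBracket ℝ V W, mem_smoothMaps.2 <| (smoothMaps_contDiff V).lieBracket_vectorField (smoothMaps_contDiff W) (by simp)⟩

theorem dirDeriv_bracket (V W : SmoothMaps E) :
    dirDeriv (smoothBracket V W) = dirDeriv V * dirDeriv W - dirDeriv W * dirDeriv V := by
  ext f z
  exact VectorField.fderiv_apply_lieBracket ((smoothMaps_contDiff f).contDiffAt (x := z)) (by
    rw [minSmoothness_of_isRCLikeNormedField]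
    exact WithTop.coe_le_coe.2 le_top) (smoothMaps_differentiableAt W z) (smoothMaps_differentiableAt V z)

/-- The maps `Φ t` have the expansion `∑ t^k p_k` at `t = 0`, tested on smooth maps. -/
def HasExpansion (Φ : ℝ → E → E) (p : PowerSeries (Module.End ℝ (SmoothMaps E))) : Prop :=
  ∀ (f : SmoothMaps E) (q : ℕ), ∃ C : ℝ, 0 ≤ C ∧ ∀ t : ℝ, |t| ≤ 1 → ∀ z,
    ‖(f : E → E) (Φ t z) - ∑ k ∈ Finset.range (q + 1), t ^ k • (PowerSeries.coeff k p f : E → E) z‖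
      ≤ C * |t| ^ (q + 1)

/-- Expand `f ∘ Ψ_t` first, then each coefficient along `Φ_t`: operators on functions compose in the
order opposite to maps, whence `p * r`. -/
theorem HasExpansion.comp {Φ Ψ : ℝ → E → E} {p r : PowerSeries (Module.End ℝ (SmoothMaps E))}
    (hΦ : HasExpansion Φ p) (hΨ : HasExpansion Ψ r) :
    HasExpansion (fun t z => Ψ t (Φ t z)) (p * r) := by
  intro f q
  obtain ⟨C, hC0, hC⟩ := hΨ f q
  -- Order `q - k` is enough, since the `k`-th coefficient already carries `t ^ k`.
  choose D hD0 hD using fun k : ℕ => hΦ (PowerSeries.coeff k r f) (q - k)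
  refine ⟨C + ∑ k ∈ Finset.range (q + 1), D k,
    add_nonneg hC0 (Finset.sum_nonneg fun k _ => hD0 k), fun t ht z => ?_⟩
  have hsum : ∑ k ∈ Finset.range (q + 1), t ^ k • (PowerSeries.coeff k (p * r) f : E → E) z =
      ∑ k ∈ Finset.range (q + 1), t ^ k • ∑ l ∈ Finset.range (q - k + 1),
        t ^ l • (PowerSeries.coeff l p (PowerSeries.coeff k r f) : E → E) z := by
    have h1 := Finset.sum_range_diag_flip (q + 1) (fun k l =>
      t ^ (k + l) • (PowerSeries.coeff l p (PowerSeries.coeff k r f) : E → E) z)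
    convert h1 using 1
    · refine Finset.sum_congr rfl fun s _ => ?_
      rw [PowerSeries.coeff_mul, ← Finset.Nat.sum_antidiagonal_swap,
        Finset.Nat.sum_antidiagonal_eq_sum_range_succ_mk]
      simp only [Prod.swap, LinearMap.sum_apply, Submodule.coe_sum, Finset.sum_apply,
        Finset.smul_sum, Module.End.mul_apply]
      refine Finset.sum_congr rfl fun k hk => ?_
      rw [Nat.add_sub_cancel' (Finset.mem_range_succ_iff.1 hk)]
    · refine Finset.sum_congr rfl fun k hk => ?_
      rw [Finset.smul_sum, Nat.sub_add_comm (Finset.mem_range_succ_iff.1 hk)]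
      exact Finset.sum_congr rfl fun l _ => by rw [smul_smul, pow_add]
  rw [hsum]
  have h2 : (f : E → E) (Ψ t (Φ t z)) - ∑ k ∈ Finset.range (q + 1), t ^ k •
        ∑ l ∈ Finset.range (q - k + 1),
          t ^ l • (PowerSeries.coeff l p (PowerSeries.coeff k r f) : E → E) z =
      ((f : E → E) (Ψ t (Φ t z)) -
        ∑ k ∈ Finset.range (q + 1), t ^ k • (PowerSeries.coeff k r f : E → E) (Φ t z)) +
      ∑ k ∈ Finset.range (q + 1), t ^ k • ((PowerSeries.coeff k r f : E → E) (Φ t z) -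
        ∑ l ∈ Finset.range (q - k + 1),
          t ^ l • (PowerSeries.coeff l p (PowerSeries.coeff k r f) : E → E) z) := by
    simp only [smul_sub, Finset.sum_sub_distrib]
    abel
  rw [h2, add_mul, Finset.sum_mul]
  refine (norm_add_le _ _).trans (add_le_add (hC t ht _) ?_)
  refine (norm_sum_le _ _).trans (Finset.sum_le_sum fun k hk => ?_)
  rw [norm_smul, norm_pow, Real.norm_eq_abs]
  calc |t| ^ k * _ ≤ |t| ^ k * (D k * |t| ^ (q - k + 1)) :=
        mul_le_mul_of_nonneg_left (hD k t ht z) (by positivity)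
    _ = D k * |t| ^ (q + 1) := by
        rw [mul_left_comm, ← pow_add]
        congr 2
        have := Finset.mem_range_succ_iff.1 hk
        omega

/-- The expansion of the flow of a field. -/
noncomputable def flowSeries (V : SmoothMaps E) : PowerSeries (Module.End ℝ (SmoothMaps E)) :=
  PowerSeries.mk fun k => ((k.factorial : ℝ)⁻¹) • dirDeriv V ^ k

/-- The identity `e^{tx} e^{-tx} = 1`: each coefficient is the binomial expansion of `(x + (-x))^k`,
as `x` and `-x` commute. -/
theorem mk_pow_mul_mk_neg_pow {A : Type*} [Ring A] [Algebra ℝ A] (x : A) :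
    (PowerSeries.mk fun k => ((k.factorial : ℝ)⁻¹) • x ^ k) *
      (PowerSeries.mk fun k => ((k.factorial : ℝ)⁻¹) • (-x) ^ k) = 1 := by
  ext1 k
  have h := (Commute.refl x).neg_right.add_pow' k
  rw [add_neg_cancel] at h
  have h2 : ∀ p ∈ Finset.HasAntidiagonal.antidiagonal k,
      PowerSeries.coeff p.1 (PowerSeries.mk fun k => ((k.factorial : ℝ)⁻¹) • x ^ k) *
        PowerSeries.coeff p.2 (PowerSeries.mk fun k => ((k.factorial : ℝ)⁻¹) • (-x) ^ k) =
      ((k.factorial : ℝ)⁻¹) • (k.choose p.1 • (x ^ p.1 * (-x) ^ p.2)) := by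
    intro p hp
    rw [PowerSeries.coeff_mk, PowerSeries.coeff_mk, smul_mul_smul_comm,
      ← Nat.cast_smul_eq_nsmul ℝ, smul_smul]
    congr 1
    obtain rfl := Finset.HasAntidiagonal.mem_antidiagonal.1 hp
    have := Nat.factorial_ne_zero p.1
    have := Nat.factorial_ne_zero p.2
    have := Nat.factorial_ne_zero (p.1 + p.2)
    rw [Nat.cast_add_choose ℝ]
    field_simp
  rw [PowerSeries.coeff_mul, Finset.sum_congr rfl h2, ← Finset.smul_sum, ← h, PowerSeries.coeff_one]
  rcases k with _ | k <;> simp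

theorem flowSeries_mul_neg (V : SmoothMaps E) : flowSeries V * flowSeries (-V) = 1 := by
  have : dirDeriv (-V) = -dirDeriv V := by
    ext f z
    simp
  rw [flowSeries, flowSeries, this]
  exact mk_pow_mul_mk_neg_pow (A := Module.End ℝ (SmoothMaps E)) (dirDeriv V)

theorem flowSeries_neg_mul (V : SmoothMaps E) : flowSeries (-V) * flowSeries V = 1 := by
  simpa using flowSeries_mul_neg (-V)

theorem hasDerivAt_comp_flow {V : SmoothMaps E} {γ : ℝ → E} {t : ℝ}
    (h : HasDerivAt γ ((V : E → E) (γ t)) t) (f : SmoothMaps E) :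
    HasDerivAt (fun s => (f : E → E) (γ s)) ((dirDeriv V f : E → E) (γ t)) t :=
  (smoothMaps_differentiableAt f (γ t)).hasFDerivAt.comp_hasDerivAt t h

/-- Taylor's formula along the flow: the remainder of `f` vanishes at 0, and its derivative is the
remainder of `V f` of one order less. -/
theorem flow_expansion_succ {V : SmoothMaps E} {γ : ℝ → E} {C : ℝ}
    (hγ : ∀ t ∈ Ioo (-2 : ℝ) 2, HasDerivAt γ ((V : E → E) (γ t)) t) (q : ℕ) (f : SmoothMaps E)
    (hf : ∀ z, ‖((dirDeriv V ^ q) f : E → E) z‖ ≤ C) {t : ℝ} (ht : |t| ≤ 1) :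
    ‖(f : E → E) (γ t) - ∑ k ∈ Finset.range q,
      t ^ k • (((k.factorial : ℝ)⁻¹ • dirDeriv V ^ k) f : E → E) (γ 0)‖ ≤ C * |t| ^ q := by
  induction q generalizing f t with
  | zero => simpa using hf (γ t)
  | succ q ih =>
    have hC : 0 ≤ C := (norm_nonneg _).trans (hf 0)
    set R : ℝ → E := fun s => (f : E → E) (γ s) - ∑ k ∈ Finset.range (q + 1),
      s ^ k • (((k.factorial : ℝ)⁻¹ • dirDeriv V ^ k) f : E → E) (γ 0) with hR
    have hR0 : R 0 = 0 := by
      simp [hR, Finset.sum_range_succ', Module.End.one_apply]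
    have hd : ∀ s ∈ Ioo (-2 : ℝ) 2, HasDerivAt R ((dirDeriv V f : E → E) (γ s) -
        ∑ k ∈ Finset.range q,
          s ^ k • (((k.factorial : ℝ)⁻¹ • dirDeriv V ^ k) (dirDeriv V f) : E → E) (γ 0)) s := by
      intro s hs
      refine (hasDerivAt_comp_flow (hγ s hs) f).sub ?_
      have h1 := HasDerivAt.fun_sum (u := Finset.range (q + 1)) (x := s) (A := fun k s =>
        s ^ k • (((k.factorial : ℝ)⁻¹ • dirDeriv V ^ k) f : E → E) (γ 0)) (fun k _ =>
          (hasDerivAt_pow k s).smul_const _)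
      convert h1 using 1
      rw [Finset.sum_range_succ']
      simp only [Nat.cast_zero, zero_mul, zero_smul, add_zero, Nat.add_sub_cancel]
      refine Finset.sum_congr rfl fun k _ => ?_
      simp only [LinearMap.smul_apply, Submodule.coe_smul, Pi.smul_apply, smul_smul, pow_succ,
        Module.End.mul_apply, Nat.factorial_succ]
      congr 1
      push_cast
      field_simp
    have hsub : uIcc 0 t ⊆ Ioo (-2 : ℝ) 2 := fun s hs => by
      have := abs_sub_left_of_mem_uIcc hs
      simp only [sub_zero] at this
      have := abs_le.1 (this.trans ht)
      constructor <;> linarith [this.1, this.2]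
    have h := (convex_uIcc 0 t).norm_image_sub_le_of_norm_hasDerivWithin_le (f := R)
      (C := C * |t| ^ q) (fun s hs => (hd s (hsub hs)).hasDerivWithinAt) (fun s hs => ?_)
      left_mem_uIcc right_mem_uIcc
    · rw [hR0] at h
      simpa [hR, pow_succ, mul_assoc] using h
    · have h3 : |s| ≤ |t| := by simpa using abs_sub_left_of_mem_uIcc hs
      refine (ih (dirDeriv V f) (fun z => ?_) (h3.trans ht)).trans
        (mul_le_mul_of_nonneg_left (pow_le_pow_left₀ (abs_nonneg _) h3 _) hC)
      have := hf z
      rwa [pow_succ] at this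

theorem hasCompactSupport_dirDeriv {V : SmoothMaps E} (hV : HasCompactSupport (V : E → E))
    (f : SmoothMaps E) : HasCompactSupport (dirDeriv V f : E → E) := by
  refine hV.mono' (fun z hz => subset_tsupport _ ?_)
  simp only [Function.mem_support, ne_eq, dirDeriv_apply] at hz ⊢
  intro h
  exact hz (by rw [h, map_zero])

/-- The test map `f` may be unbounded, but `V^{q+1} f` is supported in the support of `V`, which
gives a remainder bound uniform in `z`. -/
theorem hasExpansion_flow {V : SmoothMaps E} (hV : HasCompactSupport (V : E → E))
    {Φ : ℝ → E → E} (hΦ : ∀ z, Φ 0 z = z ∧ ∀ t ∈ Ioo (-2 : ℝ) 2,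
      HasDerivAt (fun s => Φ s z) ((V : E → E) (Φ t z)) t) :
    HasExpansion Φ (flowSeries V) := by
  intro f q
  have hb : ∃ C, ∀ z, ‖((dirDeriv V ^ (q + 1)) f : E → E) z‖ ≤ C := by
    have : HasCompactSupport ((dirDeriv V ^ (q + 1)) f : E → E) := by
      rw [pow_succ']
      exact hasCompactSupport_dirDeriv hV _
    exact this.exists_bound_of_continuous (smoothMaps_contDiff _).continuous
  obtain ⟨C, hC⟩ := hb
  refine ⟨C, (norm_nonneg _).trans (hC 0), fun t ht z => ?_⟩
  have h := flow_expansion_succ (γ := fun s => Φ s z) (hΦ z).2 (q + 1) f hC ht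
  simpa [flowSeries, (hΦ z).1] using h

/-- The leading term of the motion of a family of maps with expansion `1 + t^q u`. -/
theorem HasExpansion.norm_sub_le {Φ : ℝ → E → E}
    {u : PowerSeries (Module.End ℝ (SmoothMaps E))} {q : ℕ} (hq : 0 < q)
    (hΦ : HasExpansion Φ (1 + PowerSeries.X ^ q * u)) : ∃ C : ℝ, 0 ≤ C ∧ ∀ t : ℝ, |t| ≤ 1 → ∀ z,
      ‖Φ t z - z - t ^ q • (PowerSeries.coeff 0 u smoothId : E → E) z‖ ≤ C * |t| ^ (q + 1) := by
  obtain ⟨C, h0, hC⟩ := hΦ smoothId q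
  refine ⟨C, h0, fun t ht z => ?_⟩
  convert hC t ht z using 2
  obtain ⟨q, rfl⟩ : ∃ r, q = r + 1 := ⟨q - 1, by omega⟩
  rw [Finset.sum_range_succ, Finset.sum_range_succ']
  have h1 : ∑ k ∈ Finset.range q, t ^ (k + 1) • ((PowerSeries.coeff (k + 1)
      (1 + PowerSeries.X ^ (q + 1) * u) : Module.End ℝ (SmoothMaps E)) smoothId : E → E) z = 0 := by
    refine Finset.sum_eq_zero fun k hk => ?_
    rw [map_add, PowerSeries.coeff_X_pow_mul', if_neg (by have := Finset.mem_range.1 hk; omega)]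
    simp [PowerSeries.coeff_one]
  rw [h1, map_add, map_add, PowerSeries.coeff_X_pow_mul', PowerSeries.coeff_X_pow_mul',
    if_neg (by omega), if_pos le_rfl]
  simp [PowerSeries.coeff_one, Module.End.one_apply, sub_sub, smoothId]

end Expansion

/-! ## Curves that follow a family of fields -/

section Reach

variable {E : Type*} [NormedAddCommGroup E] [NormedSpace ℝ E] {ι : Type*}

/-- `c` is a Lipschitz curve from `z` to `z'` that follows, in time `T`, the fields `±Y i`. -/
structure IsReachCurve (Y : ι → E → E) (B : NNReal) (c : ℝ → E) (T : ℝ) (z z' : E) : Prop where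
  nonneg : 0 ≤ T
  lipschitz : LipschitzWith B c
  left : ∀ t ≤ 0, c t = z
  right : ∀ t, T ≤ t → c t = z'
  deriv : ∃ s : Set ℝ, s.Countable ∧ ∀ t ∈ Ioo 0 T, t ∉ s →
    ∃ (i : ι) (σ : ℝ), |σ| ≤ 1 ∧ HasDerivAt c (σ • Y i (c t)) t

/-- `z'` can be reached from `z` in time `T` along the fields `±Y i`. -/
def Reach (Y : ι → E → E) (B : NNReal) (T : ℝ) (z z' : E) : Prop :=
  ∃ c, IsReachCurve Y B c T z z'

variable {Y : ι → E → E} {B : NNReal}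

theorem isReachCurve_const (z : E) : IsReachCurve Y B (fun _ => z) 0 z z :=
  ⟨le_rfl, LipschitzWith.const' z, fun _ _ => rfl, fun _ _ => rfl, ∅, countable_empty,
    fun _ ht => absurd (ht.1.trans ht.2) (lt_irrefl _)⟩

theorem IsReachCurve.glue {c₁ c₂ : ℝ → E} {T₁ T₂ : ℝ} {z z' z'' : E}
    (h₁ : IsReachCurve Y B c₁ T₁ z z') (h₂ : IsReachCurve Y B c₂ T₂ z' z'') :
    IsReachCurve Y B (fun t => if t ≤ T₁ then c₁ t else c₂ (t - T₁)) (T₁ + T₂) z z'' := by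
  obtain ⟨s₁, hs₁, hd₁⟩ := h₁.deriv
  obtain ⟨s₂, hs₂, hd₂⟩ := h₂.deriv
  refine ⟨add_nonneg h₁.nonneg h₂.nonneg, LipschitzWith.of_dist_le_mul ?_, fun t ht => ?_,
    fun t ht => ?_, insert T₁ (s₁ ∪ (fun t => t + T₁) '' s₂),
    (hs₁.union (hs₂.image _)).insert _, fun t ht hts => ?_⟩
  · have key : ∀ t u, t ≤ u → dist (if t ≤ T₁ then c₁ t else c₂ (t - T₁))
        (if u ≤ T₁ then c₁ u else c₂ (u - T₁)) ≤ B * dist t u := by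
      intro t u htu
      rcases le_or_gt u T₁ with hu | hu
      · rw [if_pos hu, if_pos (htu.trans hu)]
        exact h₁.lipschitz.dist_le_mul t u
      · rw [if_neg hu.not_ge]
        rcases le_or_gt t T₁ with ht | ht
        · rw [if_pos ht]
          refine (dist_triangle _ z' _).trans ?_
          have e1 := h₁.lipschitz.dist_le_mul t T₁
          have e2 := h₂.lipschitz.dist_le_mul 0 (u - T₁)
          rw [h₁.right T₁ le_rfl] at e1
          rw [h₂.left 0 le_rfl] at e2
          refine (add_le_add e1 e2).trans (le_of_eq ?_)
          rw [← mul_add, Real.dist_eq, Real.dist_eq, Real.dist_eq, abs_of_nonpos (by linarith),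
            abs_of_nonpos (by linarith), abs_of_nonpos (by linarith)]
          ring
        · rw [if_neg ht.not_ge]
          refine (h₂.lipschitz.dist_le_mul _ _).trans (le_of_eq ?_)
          simp [Real.dist_eq]
    intro t u
    rcases le_total t u with h | h
    · exact key t u h
    · rw [dist_comm, dist_comm t u]
      exact key u t h
  · rw [if_pos (ht.trans h₁.nonneg), h₁.left t ht]
  · split_ifs with h
    · have h0 : T₂ = 0 := le_antisymm (by linarith) h₂.nonneg
      rw [h₁.right t (by linarith [h₂.nonneg]), ← h₂.left 0 le_rfl, h₂.right 0 h0.le]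
    · exact h₂.right _ (by linarith)
  · simp only [mem_insert_iff, mem_union, mem_image, not_or, not_exists, not_and] at hts
    rcases lt_or_gt_of_ne hts.1 with h | h
    · obtain ⟨i, σ, hσ, hd⟩ := hd₁ t ⟨ht.1, h⟩ hts.2.1
      refine ⟨i, σ, hσ, ?_⟩
      rw [if_pos h.le]
      exact hd.congr_of_eventuallyEq <| (eventually_lt_nhds h).mono fun u hu => if_pos hu.le
    · obtain ⟨i, σ, hσ, hd⟩ := hd₂ (t - T₁) ⟨by linarith, by linarith [ht.2]⟩
        fun h' => hts.2.2 _ h' (by ring)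
      refine ⟨i, σ, hσ, ?_⟩
      rw [if_neg h.not_ge]
      exact (hd.comp_sub_const t T₁).congr_of_eventuallyEq <|
        (eventually_gt_nhds h).mono fun u hu => if_neg hu.not_ge

theorem Reach.refl (z : E) : Reach Y B 0 z z := ⟨_, isReachCurve_const z⟩

theorem Reach.trans {T₁ T₂ : ℝ} {z z' z'' : E} (h₁ : Reach Y B T₁ z z')
    (h₂ : Reach Y B T₂ z' z'') : Reach Y B (T₁ + T₂) z z'' := by
  obtain ⟨c₁, h₁⟩ := h₁
  obtain ⟨c₂, h₂⟩ := h₂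
  exact ⟨_, h₁.glue h₂⟩

theorem Reach.norm_sub_le {T : ℝ} {z z' : E} (h : Reach Y B T z z') : ‖z' - z‖ ≤ B * T := by
  obtain ⟨c, h⟩ := h
  have := h.lipschitz.dist_le_mul T 0
  rw [h.right T le_rfl, h.left 0 le_rfl, dist_eq_norm, Real.dist_eq, sub_zero,
    abs_of_nonneg h.nonneg] at this
  exact this

/-- Infinite concatenation. -/
theorem Reach.of_tendsto {T : ℕ → ℝ} {z : ℕ → E} {y : E} {τ : ℝ}
    (h : ∀ k, Reach Y B (T k) (z k) (z (k + 1))) (hT : HasSum T τ) (hz : Tendsto z atTop (𝓝 y)) :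
    Reach Y B τ (z 0) y := by
  choose c hc using h
  have hT0 : ∀ k, 0 ≤ T k := fun k => (hc k).nonneg
  set S : ℕ → ℝ := fun k => ∑ i ∈ Finset.range k, T i with hS
  have hSτ : ∀ k, S k ≤ τ := fun k => sum_le_hasSum _ (fun i _ => hT0 i) hT
  have hSmono : Monotone S := monotone_nat_of_le_succ fun k => by
    simp only [hS, Finset.sum_range_succ]
    linarith [hT0 k]
  let G : ℕ → ℝ → E := fun k => Nat.rec (fun _ => z 0)
    (fun k g t => if t ≤ S k then g t else c k (t - S k)) k
  have hGs : ∀ k t, G (k + 1) t = if t ≤ S k then G k t else c k (t - S k) := fun k t => rfl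
  have hG : ∀ k, IsReachCurve Y B (G k) (S k) (z 0) (z k) := by
    intro k
    induction k with
    | zero => simpa [hS, G] using isReachCurve_const (Y := Y) (B := B) (z 0)
    | succ k ih =>
      have := ih.glue (hc k)
      rwa [← Finset.sum_range_succ] at this
  have hGeq : ∀ k j t, k ≤ j → t ≤ S k → G j t = G k t := by
    intro k j t hkj ht
    induction j, hkj using Nat.le_induction with
    | base => rfl
    | succ j hkj ih => rw [hGs, if_pos (ht.trans (hSmono hkj)), ih]
  -- `G k` concatenates the first `k` pieces. At a time reached by some `S k` the values stabilise;
  -- at a later time `G k t` is the endpoint `z k`, which tends to `y`.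
  have hlim : ∀ t, ∃ w, Tendsto (fun k => G k t) atTop (𝓝 w) := by
    intro t
    by_cases ht : ∃ k, t ≤ S k
    · obtain ⟨k, hk⟩ := ht
      exact ⟨G k t, tendsto_const_nhds.congr' <|
        (eventually_ge_atTop k).mono fun j hj => (hGeq k j t hj hk).symm⟩
    · push Not at ht
      exact ⟨y, hz.congr fun k => ((hG k).right t (ht k).le).symm⟩
  choose g hg using hlim
  have hgeq : ∀ k t, t ≤ S k → g t = G k t := fun k t ht => by
    refine tendsto_nhds_unique (hg t) (tendsto_const_nhds.congr' <|
      (eventually_ge_atTop k).mono fun j hj => (hGeq k j t hj ht).symm)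
  choose s hs hd using fun k => (hG k).deriv
  refine ⟨g, hT.nonneg hT0, LipschitzWith.of_dist_le_mul fun t u =>
    le_of_tendsto' ((hg t).dist (hg u)) fun k => (hG k).lipschitz.dist_le_mul t u,
    fun t ht => ?_, fun t ht => ?_, ⋃ k, s k, countable_iUnion hs, fun t ht hts => ?_⟩
  · rw [hgeq 0 t (by simpa [hS] using ht)]
    rfl
  · exact tendsto_nhds_unique (hg t) (hz.congr fun k => ((hG k).right t ((hSτ k).trans ht)).symm)
  · obtain ⟨k, hk⟩ := (hT.tendsto_sum_nat.eventually (eventually_gt_nhds ht.2)).exists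
    obtain ⟨i, σ, hσ, hd⟩ := hd k t ⟨ht.1, hk⟩ fun h' => hts (mem_iUnion.2 ⟨k, h'⟩)
    refine ⟨i, σ, hσ, ?_⟩
    rw [hgeq k t hk.le]
    exact hd.congr_of_eventuallyEq <| (eventually_lt_nhds hk).mono fun u hu => hgeq k u hu.le

theorem reach_flow {i : ι} (hB : ∀ z, ‖Y i z‖ ≤ B) {γ : ℝ → E}
    (hγ : ∀ t ∈ Ioo (-2 : ℝ) 2, HasDerivAt γ (Y i (γ t)) t) {t : ℝ} (ht : |t| ≤ 1) :
    Reach Y B |t| (γ 0) (γ t) := by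
  obtain ⟨σ, hσ, hσt⟩ : ∃ σ : ℝ, |σ| = 1 ∧ t = σ * |t| := by
    rcases le_total 0 t with h | h
    · exact ⟨1, by simp, by rw [abs_of_nonneg h, one_mul]⟩
    · exact ⟨-1, by simp, by rw [abs_of_nonpos h]; ring⟩
  have hm : ∀ s, |s| ≤ 1 → σ * s ∈ Ioo (-2 : ℝ) 2 := fun s hs => by
    have : |σ * s| ≤ 1 := by rw [abs_mul, hσ, one_mul]; exact hs
    have := abs_le.1 this
    constructor <;> linarith [this.1, this.2]
  have hcl : ∀ s : ℝ, |max 0 (min s |t|)| ≤ 1 := fun s => by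
    rw [abs_of_nonneg (le_max_left _ _)]
    exact max_le zero_le_one ((min_le_right _ _).trans ht)
  -- The sign `σ` turns negative times into positive ones, and the clamp freezes the curve outside
  -- `[0, |t|]`.
  refine ⟨fun s => γ (σ * max 0 (min s |t|)), abs_nonneg _, LipschitzWith.of_dist_le_mul ?_,
    fun s hs => ?_, fun s hs => ?_, ∅, countable_empty, fun s hs _ => ⟨i, σ, hσ.le, ?_⟩⟩
  · intro s u
    rw [dist_eq_norm]
    refine (norm_flow_sub_le hB hγ (hm _ (hcl u)) (hm _ (hcl s))).trans ?_
    refine mul_le_mul_of_nonneg_left ?_ B.2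
    rw [← mul_sub, abs_mul, hσ, one_mul, Real.dist_eq]
    refine (abs_max_sub_max_le_max _ _ _ _).trans ?_
    simp only [sub_self, abs_zero]
    refine max_le (abs_nonneg _) ((abs_min_sub_min_le_max _ _ _ _).trans ?_)
    simp
  · rw [max_eq_left ((min_le_left _ _).trans hs), mul_zero]
  · rw [min_eq_right hs, max_eq_right (abs_nonneg _), ← hσt]
  · have hs1 : |s| ≤ 1 := by rw [abs_of_pos hs.1]; exact hs.2.le.trans ht
    have e : max 0 (min s |t|) = s := by rw [min_eq_left hs.2.le, max_eq_right hs.1.le]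
    have h1 := (hγ (σ * s) (hm s hs1)).scomp s ((hasDerivAt_id s).const_mul σ)
    rw [mul_one] at h1
    rw [e]
    refine h1.congr_of_eventuallyEq ?_
    filter_upwards [Ioo_mem_nhds hs.1 hs.2] with u hu
    rw [min_eq_left hu.2.le, max_eq_right hu.1.le]
    rfl

end Reach

/-! ## Motions along iterated brackets -/

section Words

/-- `p` and `p'` are inverse to each other, and `p = 1 + x X^q + ⋯`. -/
def IsUnipotentPair {A : Type*} [Ring A] (q : ℕ) (x : A) (p p' : PowerSeries A) : Prop :=
  p * p' = 1 ∧ p' * p = 1 ∧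
    ∃ u, p = 1 + PowerSeries.X ^ q * u ∧ PowerSeries.constantCoeff u = x

section Ring

variable {A : Type*} [Ring A] {a b : ℕ} {x y : A} {p p' q q' : PowerSeries A}

theorem IsUnipotentPair.constantCoeff (ha : 0 < a) (h : IsUnipotentPair a x p p') :
    PowerSeries.constantCoeff p = 1 := by
  obtain ⟨-, -, u, rfl, -⟩ := h
  simp [ha.ne']

theorem IsUnipotentPair.constantCoeff_inv (ha : 0 < a) (h : IsUnipotentPair a x p p') :
    PowerSeries.constantCoeff p' = 1 := by
  have := congrArg PowerSeries.constantCoeff h.1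
  rwa [map_mul, h.constantCoeff ha, one_mul, map_one] at this

theorem IsUnipotentPair.symm (ha : 0 < a) (h : IsUnipotentPair a x p p') :
    IsUnipotentPair a (-x) p' p := by
  have hc := h.constantCoeff_inv ha
  obtain ⟨h1, h2, u, rfl, hu⟩ := h
  refine ⟨h2, h1, -u * p', ?_, by rw [map_mul, map_neg, hu, hc, mul_one]⟩
  have h3 : p' + PowerSeries.X ^ a * u * p' = 1 := by rw [← h1, add_mul, one_mul]
  rw [neg_mul, mul_neg, ← mul_assoc, ← sub_eq_add_neg, ← h3]
  abel

theorem commutator_mul_commutator {R : Type*} [Monoid R] {p p' q q' : R} (e₁ : p * p' = 1)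
    (e₁' : p' * p = 1) (e₂ : q * q' = 1) (e₂' : q' * q = 1) :
    p * (q * (p' * q')) * (q * (p * (q' * p'))) = 1 := by
  calc _ = p * q * p' * (q' * q) * p * q' * p' := by simp only [mul_assoc]
    _ = p * q * (p' * p) * q' * p' := by rw [e₂', mul_one]; simp only [mul_assoc]
    _ = p * (q * q') * p' := by rw [e₁', mul_one]; simp only [mul_assoc]
    _ = 1 := by rw [e₂, mul_one, e₁]

/-- With `p = 1 + X^a u` and `q = 1 + X^b v`, all terms of `pq - qp` cancel except `X^{a+b} (uv -
vu)`. Multiplying by `p' q'`, of constant term 1, leaves the leading coefficient unchanged. -/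
theorem IsUnipotentPair.commutator (ha : 0 < a) (hb : 0 < b) (h₁ : IsUnipotentPair a x p p')
    (h₂ : IsUnipotentPair b y q q') :
    IsUnipotentPair (a + b) (x * y - y * x) (p * (q * (p' * q'))) (q * (p * (q' * p'))) := by
  refine ⟨commutator_mul_commutator h₁.1 h₁.2.1 h₂.1 h₂.2.1,
    commutator_mul_commutator h₂.1 h₂.2.1 h₁.1 h₁.2.1, ?_⟩
  have hp := h₁.constantCoeff_inv ha
  have hq := h₂.constantCoeff_inv hb
  obtain ⟨hP, -, u, hu, hux⟩ := h₁
  obtain ⟨hQ, -, v, hv, hvy⟩ := h₂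
  refine ⟨(u * v - v * u) * (p' * q'), ?_, by simp [hp, hq, hux, hvy]⟩
  have h1 : p * q = q * p + PowerSeries.X ^ (a + b) * (u * v - v * u) := by
    have e1 : PowerSeries.X ^ a * u * (PowerSeries.X ^ b * v) =
        PowerSeries.X ^ (a + b) * (u * v) := by
      rw [mul_assoc, ← mul_assoc u, ← PowerSeries.X_pow_mul (φ := u), mul_assoc, ← mul_assoc,
        pow_add]
    have e2 : PowerSeries.X ^ b * v * (PowerSeries.X ^ a * u) =
        PowerSeries.X ^ (a + b) * (v * u) := by
      rw [mul_assoc, ← mul_assoc v, ← PowerSeries.X_pow_mul (φ := v), mul_assoc, ← mul_assoc,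
        ← pow_add, add_comm b]
    rw [hu, hv]
    simp only [mul_add, add_mul, mul_one, one_mul, e1, e2, mul_sub]
    abel
  calc _ = (p * q) * (p' * q') := by rw [mul_assoc]
    _ = q * ((p * p') * q') + PowerSeries.X ^ (a + b) * ((u * v - v * u) * (p' * q')) := by
        rw [h1]; simp only [add_mul, mul_assoc]
    _ = _ := by rw [hP, one_mul, hQ]

end Ring

variable {E : Type*} [NormedAddCommGroup E] [NormedSpace ℝ E] {ι : Type*}

/-- The families `Φ`, `Ψ` of motions along the fields `±Y i` have mutually inverse expansions, and
`Φ` moves to leading order by `t^q` in the direction of the field `V`. -/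
def IsWordFlow (Y : ι → E → E) (B : NNReal) (q : ℕ) (V : SmoothMaps E) (Φ Ψ : ℝ → E → E) : Prop :=
  (∃ p p' : PowerSeries (Module.End ℝ (SmoothMaps E)),
    HasExpansion Φ p ∧ HasExpansion Ψ p' ∧ IsUnipotentPair q (dirDeriv V) p p') ∧
  ∃ N : ℝ, ∀ t : ℝ, |t| ≤ 1 → ∀ z,
    (∃ T ≤ N * |t|, Reach Y B T z (Φ t z)) ∧ ∃ T ≤ N * |t|, Reach Y B T z (Ψ t z)

theorem exists_reach_commutator {Y : ι → E → E} {B : NNReal} {Φ₁ Ψ₁ Φ₂ Ψ₂ : ℝ → E → E} {N₁ N₂ t : ℝ}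
    (h₁ : ∀ z, ∃ T ≤ N₁ * |t|, Reach Y B T z (Φ₁ t z))
    (h₂ : ∀ z, ∃ T ≤ N₂ * |t|, Reach Y B T z (Φ₂ t z))
    (h₃ : ∀ z, ∃ T ≤ N₁ * |t|, Reach Y B T z (Ψ₁ t z))
    (h₄ : ∀ z, ∃ T ≤ N₂ * |t|, Reach Y B T z (Ψ₂ t z)) (z : E) :
    ∃ T ≤ (2 * N₁ + 2 * N₂) * |t|, Reach Y B T z (Ψ₂ t (Ψ₁ t (Φ₂ t (Φ₁ t z)))) := by
  obtain ⟨T₁, hT₁, r₁⟩ := h₁ z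
  obtain ⟨T₂, hT₂, r₂⟩ := h₂ (Φ₁ t z)
  obtain ⟨T₃, hT₃, r₃⟩ := h₃ (Φ₂ t (Φ₁ t z))
  obtain ⟨T₄, hT₄, r₄⟩ := h₄ (Ψ₁ t (Φ₂ t (Φ₁ t z)))
  exact ⟨_, by linarith, r₁.trans (r₂.trans (r₃.trans r₄))⟩

/-- The commutator of the two motions has the commutator of the two series as expansion, and the
leading coefficient `VW - WV` is differentiation along the bracket. -/
theorem IsWordFlow.bracket {Y : ι → E → E} {B : NNReal} {a b : ℕ} {V W : SmoothMaps E}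
    {Φ₁ Ψ₁ Φ₂ Ψ₂ : ℝ → E → E} (ha : 0 < a) (hb : 0 < b) (h₁ : IsWordFlow Y B a V Φ₁ Ψ₁)
    (h₂ : IsWordFlow Y B b W Φ₂ Ψ₂) :
    IsWordFlow Y B (a + b) (smoothBracket V W) (fun t z => Ψ₂ t (Ψ₁ t (Φ₂ t (Φ₁ t z))))
      (fun t z => Ψ₁ t (Ψ₂ t (Φ₁ t (Φ₂ t z)))) := by
  obtain ⟨⟨p, p', hP, hP', e₁⟩, N₁, hN₁⟩ := h₁
  obtain ⟨⟨q, q', hQ, hQ', e₂⟩, N₂, hN₂⟩ := h₂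
  refine ⟨⟨_, _, hP.comp (hQ.comp (hP'.comp hQ')), hQ.comp (hP.comp (hQ'.comp hP')), ?_⟩,
    2 * N₁ + 2 * N₂, fun t ht z => ⟨?_, ?_⟩⟩
  · rw [dirDeriv_bracket]
    exact e₁.commutator ha hb e₂
  · exact exists_reach_commutator (fun z => (hN₁ t ht z).1) (fun z => (hN₂ t ht z).1)
      (fun z => (hN₁ t ht z).2) (fun z => (hN₂ t ht z).2) z
  · rw [add_comm (2 * N₁)]
    exact exists_reach_commutator (fun z => (hN₂ t ht z).1) (fun z => (hN₁ t ht z).1)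
      (fun z => (hN₂ t ht z).2) (fun z => (hN₁ t ht z).2) z

variable [CompleteSpace E]

theorem exists_isWordFlow_field {Y : ι → SmoothMaps E}
    (hY : ∀ i, HasCompactSupport (Y i : E → E)) {B : NNReal} (hB : ∀ i z, ‖(Y i : E → E) z‖ ≤ B)
    (i : ι) : ∃ Φ Ψ, IsWordFlow (fun i => (Y i : E → E)) B 1 (Y i) Φ Ψ := by
  obtain ⟨K, hK⟩ := (smoothMaps_contDiff (Y i)).lipschitzWith_of_hasCompactSupport (hY i) (by simp)
  choose γ hγ0 hγ using fun z => exists_flow_of_lipschitz hK (hB i) z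
  have hneg : HasCompactSupport ((-Y i : SmoothMaps E) : E → E) := by
    simpa using (hY i).neg
  have h1 := hasExpansion_flow (Φ := fun t z => γ z t) (hY i) fun z => ⟨hγ0 z, hγ z⟩
  have h2 := hasExpansion_flow (Φ := fun t z => γ z (-t)) hneg fun z => by
    refine ⟨by simpa using hγ0 z, fun t ht => ?_⟩
    have := (hγ z (-t) ⟨by linarith [ht.2], by linarith [ht.1]⟩).scomp t (hasDerivAt_neg t)
    simpa [Function.comp_def] using this
  refine ⟨_, _, ⟨_, _, h1, h2, flowSeries_mul_neg (Y i), flowSeries_neg_mul (Y i),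
    PowerSeries.mk fun k => PowerSeries.coeff (k + 1) (flowSeries (Y i)), ?_, ?_⟩, 1,
    fun t ht z => ⟨⟨|t|, by simp, ?_⟩, |t|, by simp, ?_⟩⟩
  · conv_lhs => rw [PowerSeries.eq_X_mul_shift_add_const (flowSeries (Y i))]
    rw [pow_one, add_comm]
    congr 1
    rw [← PowerSeries.coeff_zero_eq_constantCoeff_apply, flowSeries, PowerSeries.coeff_mk]
    simp
  · simp [flowSeries, ← PowerSeries.coeff_zero_eq_constantCoeff_apply]
  · have := reach_flow (Y := fun i => (Y i : E → E)) (hB i) (hγ z) ht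
    rwa [hγ0 z] at this
  · have := reach_flow (Y := fun i => (Y i : E → E)) (hB i) (hγ z) (t := -t) (by rwa [abs_neg])
    rwa [hγ0 z, abs_neg] at this

/-- The multi-bracket of a word, for smooth fields on a vector space. -/
noncomputable def wordField (Y : ι → SmoothMaps E) : List ι → SmoothMaps E
  | [] => 0
  | [a] => Y a
  | a :: b :: w => smoothBracket (Y a) (wordField Y (b :: w))

theorem exists_isWordFlow {Y : ι → SmoothMaps E}
    (hY : ∀ i, HasCompactSupport (Y i : E → E)) {B : NNReal} (hB : ∀ i z, ‖(Y i : E → E) z‖ ≤ B)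
    (w : List ι) (hw : w ≠ []) :
    ∃ Φ Ψ, IsWordFlow (fun i => (Y i : E → E)) B w.length (wordField Y w) Φ Ψ := by
  induction w with
  | nil => exact absurd rfl hw
  | cons a w ih =>
    rcases w with _ | ⟨b, w⟩
    · exact exists_isWordFlow_field hY hB a
    · obtain ⟨Φ₁, Ψ₁, h₁⟩ := exists_isWordFlow_field hY hB a
      obtain ⟨Φ₂, Ψ₂, h₂⟩ := ih (by simp)
      have := h₁.bracket one_pos (by simp) h₂
      rw [add_comm] at this
      exact ⟨_, _, this⟩

omit [CompleteSpace E] in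
theorem hasCompactSupport_wordField {Y : ι → SmoothMaps E}
    (hY : ∀ i, HasCompactSupport (Y i : E → E)) (w : List ι) :
    HasCompactSupport (wordField Y w : E → E) := by
  induction w with
  | nil => exact HasCompactSupport.zero
  | cons a w ih =>
    rcases w with _ | ⟨b, w⟩
    · exact hY a
    · refine (hY a).mono' fun z hz => ?_
      by_contra h
      have h0 : (Y a : E → E) =ᶠ[𝓝 z] 0 := notMem_tsupport_iff_eventuallyEq.1 h
      apply hz
      change VectorField.lieBracket ℝ (Y a : E → E) (wordField Y (b :: w)) z = 0
      rw [h0.lieBracket_vectorField_eq EventuallyEq.rfl]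
      simp [VectorField.lieBracket]

end Words

/-! ## A quantitative accessibility theorem -/

section Chow

variable {E : Type*} [NormedAddCommGroup E] [NormedSpace ℝ E] {ι : Type*}

/-- Take `t = |c|^{1/q}`, so that `t^q = |c|`, and use `Φ` or `Ψ` according to the sign of `c`.
Since `|c| ≤ 1`, the exponent `1/q` can be lowered to `1/k`, common to all words of length at most
`k`. -/
theorem IsWordFlow.exists_move {Y : ι → E → E} {B : NNReal} {q k : ℕ} (hq : 0 < q) (hqk : q ≤ k)
    {V : SmoothMaps E} {Φ Ψ : ℝ → E → E} (h : IsWordFlow Y B q V Φ Ψ) :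
    ∃ C : ℝ, 0 ≤ C ∧ ∀ c : ℝ, |c| ≤ 1 → ∀ z, ∃ z', (∃ T ≤ C * |c| ^ (1 / k : ℝ), Reach Y B T z z') ∧
      ‖z' - z - c • (V : E → E) z‖ ≤ C * (|c| * |c| ^ (1 / k : ℝ)) := by
  obtain ⟨⟨p, p', hp, hp', hu⟩, N, hN⟩ := h
  have hu' := hu.symm hq
  obtain ⟨-, -, u, rfl, hux⟩ := hu
  obtain ⟨-, -, u', rfl, hux'⟩ := hu'
  obtain ⟨C₁, hC₁, h₁⟩ := hp.norm_sub_le hq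
  obtain ⟨C₂, hC₂, h₂⟩ := hp'.norm_sub_le hq
  rw [PowerSeries.coeff_zero_eq_constantCoeff_apply, hux, dirDeriv_id] at h₁
  rw [PowerSeries.coeff_zero_eq_constantCoeff_apply, hux', LinearMap.neg_apply, dirDeriv_id] at h₂
  refine ⟨max |N| (max C₁ C₂), le_max_of_le_left (abs_nonneg _), fun c hc z => ?_⟩
  set t : ℝ := |c| ^ (1 / q : ℝ) with ht
  have ht0 : 0 ≤ t := Real.rpow_nonneg (abs_nonneg c) _
  have hk0 : 0 < k := hq.trans_le hqk
  have ht1 : |t| ≤ 1 := by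
    rw [abs_of_nonneg ht0]
    exact Real.rpow_le_one (abs_nonneg c) hc (by positivity)
  have htq : t ^ q = |c| := by
    rw [ht, ← Real.rpow_natCast, ← Real.rpow_mul (abs_nonneg c), one_div_mul_cancel (by positivity),
      Real.rpow_one]
  have htk : t ≤ |c| ^ (1 / k : ℝ) := by
    refine Real.rpow_le_rpow_of_exponent_ge' (abs_nonneg c) hc (by positivity) ?_
    gcongr
  have hcost : N * |t| ≤ max |N| (max C₁ C₂) * |c| ^ (1 / k : ℝ) := by
    rw [abs_of_nonneg ht0]
    exact mul_le_mul ((le_abs_self N).trans (le_max_left _ _)) htk ht0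
      (le_max_of_le_left (abs_nonneg _))
  have herr : ∀ C ≤ max C₁ C₂, C * |t| ^ (q + 1) ≤
      max |N| (max C₁ C₂) * (|c| * |c| ^ (1 / k : ℝ)) := by
    intro C hC
    rw [abs_of_nonneg ht0, pow_succ, htq]
    exact mul_le_mul (hC.trans (le_max_right _ _))
      (mul_le_mul_of_nonneg_left htk (abs_nonneg c)) (by positivity)
      (le_max_of_le_left (abs_nonneg _))
  rcases le_total 0 c with h0 | h0
  · obtain ⟨T, hT, hr⟩ := (hN t ht1 z).1
    refine ⟨_, ⟨T, hT.trans hcost, hr⟩, ?_⟩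
    have := h₁ t ht1 z
    rw [htq, abs_of_nonneg h0] at this
    exact this.trans (by simpa [abs_of_nonneg h0] using herr C₁ (le_max_left _ _))
  · obtain ⟨T, hT, hr⟩ := (hN t ht1 z).2
    refine ⟨_, ⟨T, hT.trans hcost, hr⟩, ?_⟩
    have := h₂ t ht1 z
    rw [htq, abs_of_nonpos h0] at this
    simp only [Submodule.coe_neg, Pi.neg_apply, smul_neg, neg_smul, neg_neg] at this
    exact this.trans (by simpa [abs_of_nonpos h0] using herr C₂ (le_max_right _ _))

/-- Perform the moves one after another. The earlier moves shift the base point by at most `B C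
‖c‖^κ`, so a Lipschitz field times `c j` changes by an amount of the order of the error already
allowed. -/
theorem exists_move_sum {J : Type*} [Fintype J] {Y : ι → E → E} {B : NNReal}
    {κ : ℝ} (hκ : 0 ≤ κ) {Z : J → E → E} (hZ : ∀ j, ∃ K : NNReal, LipschitzWith K (Z j))
    (hmove : ∀ j, ∃ C : ℝ, 0 ≤ C ∧ ∀ c : ℝ, |c| ≤ 1 → ∀ z, ∃ z',
      (∃ T ≤ C * |c| ^ κ, Reach Y B T z z') ∧ ‖z' - z - c • Z j z‖ ≤ C * (|c| * |c| ^ κ))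
    (s : Finset J) : ∃ C : ℝ, 0 ≤ C ∧ ∀ c : J → ℝ, ‖c‖ ≤ 1 → ∀ z, ∃ z',
      (∃ T ≤ C * ‖c‖ ^ κ, Reach Y B T z z') ∧
        ‖z' - z - ∑ j ∈ s, c j • Z j z‖ ≤ C * (‖c‖ * ‖c‖ ^ κ) := by
  classical
  induction s using Finset.induction_on with
  | empty =>
    exact ⟨0, le_rfl, fun c _ z => ⟨z, ⟨0, by simp, Reach.refl z⟩, by simp⟩⟩
  | insert j s hj ih =>
    obtain ⟨C, hC0, hC⟩ := ih
    obtain ⟨D, hD0, hD⟩ := hmove j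
    obtain ⟨K, hK⟩ := hZ j
    refine ⟨C + D + K * (B * C), by positivity, fun c hc z => ?_⟩
    obtain ⟨z₁, ⟨T₁, hT₁, hr₁⟩, hz₁⟩ := hC c hc z
    have hcj : |c j| ≤ ‖c‖ := norm_le_pi_norm c j
    obtain ⟨z₂, ⟨T₂, hT₂, hr₂⟩, hz₂⟩ := hD (c j) (hcj.trans hc) z₁
    have hcκ : |c j| ^ κ ≤ ‖c‖ ^ κ := Real.rpow_le_rpow (abs_nonneg _) hcj hκ
    have hp : 0 ≤ ‖c‖ ^ κ := Real.rpow_nonneg (norm_nonneg _) _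
    have hBK : 0 ≤ (K : ℝ) * (B * C) := by positivity
    refine ⟨z₂, ⟨_, ?_, hr₁.trans hr₂⟩, ?_⟩
    · have := mul_le_mul_of_nonneg_left hcκ hD0
      nlinarith [mul_nonneg hBK hp]
    · rw [Finset.sum_insert hj]
      have e : z₂ - z - (c j • Z j z + ∑ j ∈ s, c j • Z j z) =
          (z₂ - z₁ - c j • Z j z₁) + (z₁ - z - ∑ j ∈ s, c j • Z j z) +
            c j • (Z j z₁ - Z j z) := by
        rw [smul_sub]
        abel
      rw [e]
      have h3 : ‖c j • (Z j z₁ - Z j z)‖ ≤ ‖c‖ * (K * (B * (C * ‖c‖ ^ κ))) := by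
        rw [norm_smul, ← dist_eq_norm (Z j z₁)]
        refine mul_le_mul hcj ((hK.dist_le_mul _ _).trans ?_) dist_nonneg (norm_nonneg _)
        rw [dist_eq_norm]
        exact mul_le_mul_of_nonneg_left (hr₁.norm_sub_le.trans
          (mul_le_mul_of_nonneg_left hT₁ B.2)) K.2
      have h4 : D * (|c j| * |c j| ^ κ) ≤ D * (‖c‖ * ‖c‖ ^ κ) :=
        mul_le_mul_of_nonneg_left (mul_le_mul hcj hcκ (Real.rpow_nonneg (abs_nonneg _) _)
          (norm_nonneg _)) hD0
      refine (norm_add₃_le).trans ?_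
      calc _ ≤ D * (‖c‖ * ‖c‖ ^ κ) + C * (‖c‖ * ‖c‖ ^ κ) + ‖c‖ * (K * (B * (C * ‖c‖ ^ κ))) :=
            add_le_add (add_le_add (hz₂.trans h4) hz₁) h3
        _ = _ := by ring

/-- Write `v` as a combination of the `Z j x₀` with coefficients of size at most `M ‖v‖`, and make
the corresponding moves from `z`. The miss is at most `‖v‖ (C M (M r)^κ + M Km r)`: the error of the
moves plus the variation of the `Z j` between `x₀` and `z`. A small `r` makes the factor at most
`1/2`. -/
theorem exists_reach_half [FiniteDimensional ℝ E] {J : Type*} [Fintype J] {Y : ι → E → E}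
    {B : NNReal} {κ : ℝ} (hκ : 0 < κ) {Z : J → E → E} (hZ : ∀ j, ∃ K : NNReal, LipschitzWith K (Z j))
    (hmove : ∀ j, ∃ C : ℝ, 0 ≤ C ∧ ∀ c : ℝ, |c| ≤ 1 → ∀ z, ∃ z',
      (∃ T ≤ C * |c| ^ κ, Reach Y B T z z') ∧ ‖z' - z - c • Z j z‖ ≤ C * (|c| * |c| ^ κ))
    {x₀ : E} (hspan : Submodule.span ℝ (range fun j => Z j x₀) = ⊤) :
    ∃ r > 0, ∃ C : ℝ, 0 ≤ C ∧ ∀ z ∈ Metric.ball x₀ r, ∀ v : E, ‖v‖ ≤ r → ∃ z',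
      (∃ T ≤ C * ‖v‖ ^ κ, Reach Y B T z z') ∧ ‖z' - z - v‖ ≤ ‖v‖ / 2 := by
  obtain ⟨C, hC0, hC⟩ := exists_move_sum hκ.le hZ hmove Finset.univ
  choose K hK using hZ
  set Km : ℝ := ∑ j, (K j : ℝ) with hKm
  have hKm0 : 0 ≤ Km := Finset.sum_nonneg fun j _ => (K j).2
  obtain ⟨R, hR⟩ := (Fintype.linearCombination ℝ (fun j => Z j x₀)).exists_rightInverse_of_surjective
    (by rw [Fintype.range_linearCombination, hspan])
  obtain ⟨M, hM0, hM⟩ : ∃ M : ℝ, 0 < M ∧ ∀ v, ‖R v‖ ≤ M * ‖v‖ := by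
    obtain ⟨M, h0, h⟩ := (LinearMap.toContinuousLinearMap R).bound
    exact ⟨M, h0, h⟩
  have hlim : Tendsto (fun r : ℝ => M * r) (𝓝[>] 0) (𝓝 0) := by
    have : Tendsto (fun r : ℝ => M * r) (𝓝 0) (𝓝 (M * 0)) := tendsto_id.const_mul M
    rw [mul_zero] at this
    exact this.mono_left nhdsWithin_le_nhds
  have hlim2 : Tendsto (fun r : ℝ => C * M * (M * r) ^ κ + M * Km * r) (𝓝[>] 0) (𝓝 0) := by
    have h1 := (hlim.rpow_const (p := κ) (Or.inr hκ.le)).const_mul (C * M)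
    have h2 : Tendsto (fun r : ℝ => M * Km * r) (𝓝[>] 0) (𝓝 (M * Km * 0)) :=
      (tendsto_id.const_mul (M * Km)).mono_left nhdsWithin_le_nhds
    simpa [Real.zero_rpow hκ.ne'] using h1.add h2
  obtain ⟨r, hr1, hr2, hr0⟩ := ((hlim.eventually (eventually_le_nhds one_pos)).and
    ((hlim2.eventually (eventually_le_nhds (show (0 : ℝ) < 1 / 2 by norm_num))).and
      self_mem_nhdsWithin)).exists
  have hr0 : 0 < r := hr0
  refine ⟨r, hr0, C * M ^ κ, by positivity, fun z hz v hv => ?_⟩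
  have hcM := hM v
  have hMr : M * ‖v‖ ≤ M * r := mul_le_mul_of_nonneg_left hv hM0.le
  have hsum : ∑ j, R v j • Z j x₀ = v := by
    have := LinearMap.congr_fun hR v
    simpa [Fintype.linearCombination_apply] using this
  obtain ⟨z', ⟨T, hT, hr⟩, hz'⟩ := hC (R v) (hcM.trans (hMr.trans hr1)) z
  have hpow : ‖R v‖ ^ κ ≤ (M * ‖v‖) ^ κ := Real.rpow_le_rpow (norm_nonneg _) hcM hκ.le
  have hpow' : ‖R v‖ ^ κ ≤ (M * r) ^ κ :=
    hpow.trans (Real.rpow_le_rpow (by positivity) hMr hκ.le)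
  refine ⟨z', ⟨T, ?_, hr⟩, ?_⟩
  · refine hT.trans ?_
    rw [mul_assoc, ← Real.mul_rpow hM0.le (norm_nonneg _)]
    exact mul_le_mul_of_nonneg_left hpow hC0
  · have e : z' - z - v = (z' - z - ∑ j, R v j • Z j z) + ∑ j, R v j • (Z j z - Z j x₀) := by
      simp only [smul_sub, Finset.sum_sub_distrib, hsum]
      abel
    rw [e]
    have h1 : ‖∑ j, R v j • (Z j z - Z j x₀)‖ ≤ (M * ‖v‖) * (Km * r) := by
      rw [hKm, Finset.sum_mul, Finset.mul_sum]
      refine (norm_sum_le _ _).trans (Finset.sum_le_sum fun j _ => ?_)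
      rw [norm_smul, ← dist_eq_norm]
      refine mul_le_mul ((norm_le_pi_norm (R v) j).trans hcM) (((hK j).dist_le_mul _ _).trans ?_)
        dist_nonneg (by positivity)
      exact mul_le_mul_of_nonneg_left (Metric.mem_ball.1 hz).le (K j).2
    calc _ ≤ C * (‖R v‖ * ‖R v‖ ^ κ) + (M * ‖v‖) * (Km * r) :=
          (norm_add_le _ _).trans (add_le_add hz' h1)
      _ ≤ C * ((M * ‖v‖) * (M * r) ^ κ) + (M * ‖v‖) * (Km * r) := by
          gcongr
      _ = ‖v‖ * (C * M * (M * r) ^ κ + M * Km * r) := by ring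
      _ ≤ ‖v‖ * (1 / 2) := mul_le_mul_of_nonneg_left hr2 (norm_nonneg _)
      _ = _ := by ring

/-- Aim repeatedly at `y` from the point just reached. The error halves each time, the times are
dominated by a geometric series of ratio `(1/2)^κ`, and the infinite concatenation ends exactly at
`y`. -/
theorem exists_reach_of_half {Y : ι → E → E} {B : NNReal} {κ : ℝ} (hκ : 0 < κ) {x₀ : E} {r C : ℝ}
    (h : ∀ z ∈ Metric.ball x₀ r, ∀ v : E, ‖v‖ ≤ r → ∃ z',
      (∃ T ≤ C * ‖v‖ ^ κ, Reach Y B T z z') ∧ ‖z' - z - v‖ ≤ ‖v‖ / 2) {z y : E}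
    (hz : z ∈ Metric.ball x₀ (r / 3)) (hy : y ∈ Metric.ball x₀ (r / 3)) :
    ∃ T ≤ C / (1 - (1 / 2) ^ κ) * ‖z - y‖ ^ κ, Reach Y B T z y := by
  have hzy : ‖z - y‖ < 2 * (r / 3) := by
    rw [← dist_eq_norm]
    have := dist_triangle_right z y x₀
    linarith [Metric.mem_ball.1 hz, Metric.mem_ball.1 hy]
  have hstep : ∀ w : E, ∃ w', ‖w - y‖ < 2 * (r / 3) →
      (∃ T ≤ C * ‖w - y‖ ^ κ, Reach Y B T w w') ∧ ‖w' - y‖ ≤ ‖w - y‖ / 2 := by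
    intro w
    by_cases hw : ‖w - y‖ < 2 * (r / 3)
    · have h0 := norm_nonneg (w - y)
      -- Every iterate is within `2r/3` of `y`, hence within `r` of `x₀`; this is the reason for the
      -- radius `r / 3`.
      obtain ⟨w', h1, h2⟩ := h w (by
        rw [Metric.mem_ball]
        have h3 := dist_triangle w y x₀
        rw [dist_eq_norm w y] at h3
        linarith [Metric.mem_ball.1 hy]) (y - w) (by rw [norm_sub_rev]; linarith)
      rw [norm_sub_rev y w] at h1 h2
      exact ⟨w', fun _ => ⟨h1, by rwa [sub_sub, add_sub_cancel] at h2⟩⟩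
    · exact ⟨w, fun h' => absurd h' hw⟩
  choose S hS using hstep
  set Z : ℕ → E := fun k => S^[k] z with hZ
  have hZs : ∀ k, Z (k + 1) = S (Z k) := fun k => Function.iterate_succ_apply' S k z
  have hdist : ∀ k, ‖Z k - y‖ ≤ ‖z - y‖ * (1 / 2) ^ k := by
    intro k
    induction k with
    | zero => simp [hZ]
    | succ k ih =>
      have h1 : ‖Z k - y‖ < 2 * (r / 3) := ih.trans_lt (lt_of_le_of_lt
        (mul_le_of_le_one_right (norm_nonneg _) (pow_le_one₀ (by norm_num) (by norm_num))) hzy)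
      have := (hS _ h1).2
      rw [hZs, pow_succ]
      linarith
  have hlt : ∀ k, ‖Z k - y‖ < 2 * (r / 3) := fun k => (hdist k).trans_lt (lt_of_le_of_lt
    (mul_le_of_le_one_right (norm_nonneg _) (pow_le_one₀ (by norm_num) (by norm_num))) hzy)
  choose T hT hr using fun k => (hS _ (hlt k)).1
  have hC0 : z ≠ y → 0 ≤ C := fun hne => by
    obtain ⟨c, hc⟩ := hr 0
    have h1 := hc.nonneg.trans (hT 0)
    have h2 : 0 < ‖z - y‖ ^ κ := Real.rpow_pos_of_pos (norm_pos_iff.2 (sub_ne_zero.2 hne)) _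
    exact nonneg_of_mul_nonneg_left (by simpa [hZ] using h1) h2
  rcases eq_or_ne z y with rfl | hne
  · exact ⟨0, by simp [Real.zero_rpow hκ.ne'], Reach.refl z⟩
  have hC := hC0 hne
  have hq : ((1 : ℝ) / 2) ^ κ < 1 := Real.rpow_lt_one (by norm_num) (by norm_num) hκ
  have hq0 : 0 ≤ ((1 : ℝ) / 2) ^ κ := by positivity
  have hTb : ∀ k, T k ≤ C * ‖z - y‖ ^ κ * (((1 : ℝ) / 2) ^ κ) ^ k := by
    intro k
    refine (hT k).trans ?_
    rw [mul_assoc]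
    refine mul_le_mul_of_nonneg_left ((Real.rpow_le_rpow (norm_nonneg _) (hdist k) hκ.le).trans ?_) hC
    rw [Real.mul_rpow (norm_nonneg _) (by positivity), ← Real.rpow_natCast, ← Real.rpow_natCast,
      ← Real.rpow_mul (by norm_num), ← Real.rpow_mul (by norm_num), mul_comm κ]
  have hT0 : ∀ k, 0 ≤ T k := fun k => by
    obtain ⟨c, hc⟩ := hr k
    exact hc.nonneg
  have hgeom := (hasSum_geometric_of_lt_one hq0 hq).mul_left (C * ‖z - y‖ ^ κ)
  have hsum : Summable T := Summable.of_nonneg_of_le hT0 hTb hgeom.summable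
  refine ⟨∑' k, T k, ?_, ?_⟩
  · refine (hasSum_le hTb hsum.hasSum hgeom).trans (le_of_eq ?_)
    ring
  · refine Reach.of_tendsto (z := Z) (fun k => ?_) hsum.hasSum ?_
    · rw [hZs]
      exact hr k
    · rw [tendsto_iff_norm_sub_tendsto_zero]
      refine squeeze_zero (fun _ => norm_nonneg _) hdist ?_
      have := (tendsto_pow_atTop_nhds_zero_of_lt_one (r := (1 : ℝ) / 2) (by norm_num)
        (by norm_num)).const_mul ‖z - y‖
      simpa using this

/-- Points near `x₀` are joined by short curves along fields whose iterated brackets span at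
`x₀`. -/
theorem exists_reach_of_span [FiniteDimensional ℝ E] [Finite ι] {Y : ι → SmoothMaps E}
    (hY : ∀ i, HasCompactSupport (Y i : E → E)) {B : NNReal} (hB : ∀ i z, ‖(Y i : E → E) z‖ ≤ B)
    {k : ℕ} {x₀ : E} (hspan : Submodule.span ℝ
      {v | ∃ w : List ι, w.length ≤ k ∧ v = (wordField Y w : E → E) x₀} = ⊤) :
    ∃ r > 0, ∃ C κ : ℝ, 0 < κ ∧ ∀ z ∈ Metric.ball x₀ r, ∀ y ∈ Metric.ball x₀ r,
      ∃ T ≤ C * ‖z - y‖ ^ κ, Reach (fun i => (Y i : E → E)) B T z y := by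
  have hfin : Finite {w : List ι // w.length ≤ k} := (List.finite_length_le ι k).to_subtype
  have := Fintype.ofFinite {w : List ι // w.length ≤ k}
  have hcomplete : CompleteSpace E := FiniteDimensional.complete ℝ E
  -- `k + 1` instead of `k`, because `k = 0` is allowed.
  have hκ : (0 : ℝ) < 1 / (k + 1 : ℕ) := by positivity
  have hspan' : Submodule.span ℝ
      (range fun w : {w : List ι // w.length ≤ k} => (wordField Y w.1 : E → E) x₀) = ⊤ := by
    rw [← hspan]
    congr 1
    ext v
    simp [eq_comm]
  obtain ⟨r, hr, C, -, h⟩ := exists_reach_half (Y := fun i => (Y i : E → E)) (B := B) hκ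
    (Z := fun w : {w : List ι // w.length ≤ k} => (wordField Y w.1 : E → E))
    (fun w => (smoothMaps_contDiff _).lipschitzWith_of_hasCompactSupport
      (hasCompactSupport_wordField hY w.1) (by simp)) (fun w => by
    rcases eq_or_ne w.1 [] with h0 | h0
    · refine ⟨0, le_rfl, fun c _ z => ⟨z, ⟨0, by simp, Reach.refl z⟩, ?_⟩⟩
      simp [h0, wordField]
    · obtain ⟨Φ, Ψ, hw⟩ := exists_isWordFlow hY hB w.1 h0
      exact hw.exists_move (List.length_pos_iff.2 h0) (w.2.trans k.le_succ)) hspan'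
  exact ⟨r / 3, by positivity, _, _, hκ, fun z hz y hy => exists_reach_of_half hκ h hz hy⟩

end Chow

/-! ## Vector fields in a chart -/

section ChartModel

variable {n : ℕ} {M : Type*} [TopologicalSpace M] [ChartedSpace (EuclideanSpace ℝ (Fin n)) M]

/-- The vector field `X` read in the chart at `x₀`. -/
noncomputable def chartField (x₀ : M) (X : VField n M) (z : EuclideanSpace ℝ (Fin n)) :
    EuclideanSpace ℝ (Fin n) :=
  VectorField.mpullback 𝓘(ℝ, EuclideanSpace ℝ (Fin n)) (𝓡 n) (extChartAt (𝓡 n) x₀).symm X z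

variable [IsManifold (𝓡 n) ∞ M]

theorem isManifold_minSmoothness (k : ℕ) : IsManifold (𝓡 n) (minSmoothness ℝ k) M := by
  rw [minSmoothness_of_isRCLikeNormedField]
  exact IsManifold.of_le (n := ∞) (WithTop.coe_le_coe.2 le_top)

theorem contMDiffAt_extChartAt_symm_of_mem {x₀ : M} {z : EuclideanSpace ℝ (Fin n)}
    (hz : z ∈ (extChartAt (𝓡 n) x₀).target) :
    ContMDiffAt 𝓘(ℝ, EuclideanSpace ℝ (Fin n)) (𝓡 n) ∞ (extChartAt (𝓡 n) x₀).symm z :=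
  (contMDiffOn_extChartAt_symm x₀).contMDiffAt ((isOpen_extChartAt_target x₀).mem_nhds hz)

theorem isInvertible_mfderiv_extChartAt_symm {x₀ : M} {z : EuclideanSpace ℝ (Fin n)}
    (hz : z ∈ (extChartAt (𝓡 n) x₀).target) :
    (mfderiv 𝓘(ℝ, EuclideanSpace ℝ (Fin n)) (𝓡 n) (extChartAt (𝓡 n) x₀).symm z).IsInvertible := by
  have : IsManifold (𝓡 n) 1 M := IsManifold.of_le (n := ∞) (by simp)
  have h := isInvertible_mfderivWithin_extChartAt_symm (I := 𝓡 n) hz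
  have hr : range (𝓡 n) = univ := ModelWithCorners.range_eq_univ _
  rwa [hr, mfderivWithin_univ] at h

theorem mfderiv_extChartAt_symm_chartField {x₀ : M} {z : EuclideanSpace ℝ (Fin n)}
    (hz : z ∈ (extChartAt (𝓡 n) x₀).target) (X : VField n M) :
    mfderiv 𝓘(ℝ, EuclideanSpace ℝ (Fin n)) (𝓡 n) (extChartAt (𝓡 n) x₀).symm z (chartField x₀ X z) =
      X ((extChartAt (𝓡 n) x₀).symm z) :=
  (isInvertible_mfderiv_extChartAt_symm hz).self_apply_inverse _

theorem SmoothField.contDiffOn_chartField {O : Set M} {X : VField n M}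
    (hX : SmoothField O X) (x₀ : M) : ContDiffOn ℝ ∞ (chartField x₀ X)
      ((extChartAt (𝓡 n) x₀).target ∩ (extChartAt (𝓡 n) x₀).symm ⁻¹' O) := by
  intro z hz
  have h := ContMDiffWithinAt.mpullback_vectorField_preimage (m := ∞) (n := ∞)
    (hX _ hz.2) (contMDiffAt_extChartAt_symm_of_mem hz.1)
    (isInvertible_mfderiv_extChartAt_symm hz.1) (by simp)
  exact (contMDiffWithinAt_vectorSpace_iff_contDiffWithinAt.1 h).mono inter_subset_right

theorem SmoothField.contMDiffAt {O : Set M} (hO : IsOpen O) {X : VField n M}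
    (hX : SmoothField O X) {x : M} (hx : x ∈ O) :
    ContMDiffAt (𝓡 n) (𝓡 n).tangent ∞ (fun x => (⟨x, X x⟩ : TangentBundle (𝓡 n) M)) x :=
  ContMDiffOn.contMDiffAt hX (hO.mem_nhds hx)

theorem smoothField_wordBracket {m : ℕ} {O : Set M} (hO : IsOpen O) {X : Fin m → VField n M}
    (hX : ∀ i, SmoothField O (X i)) (w : List (Fin m)) : SmoothField O (wordBracket X w) := by
  induction w with
  | nil => exact (Bundle.contMDiff_zeroSection ℝ (TangentSpace (𝓡 n) : M → Type _)).contMDiffOn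
  | cons a w ih =>
    rcases w with _ | ⟨b, w⟩
    · exact hX a
    · intro x hx
      have : IsManifold (𝓡 n) (minSmoothness ℝ 2) M := isManifold_minSmoothness 2
      have : IsManifold (𝓡 n) (minSmoothness ℝ 3) M := isManifold_minSmoothness 3
      have : IsManifold (𝓡 n) (((⊤ : ℕ∞) : WithTop ℕ∞) + 1) M := by simpa using ‹IsManifold (𝓡 n) ∞ M›
      exact (ContMDiffAt.mlieBracket_vectorField (m := (⊤ : ℕ∞)) (n := (⊤ : ℕ∞)) ((hX a).contMDiffAt hO hx)
        (ih.contMDiffAt hO hx) (by simp [minSmoothness_of_isRCLikeNormedField])).contMDiffWithinAt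

/-- The smooth compactly supported fields `Y i` on the model space are, in a ball around the image
of `x₀`, the expressions in the chart at `x₀` of the fields `X i`, which are smooth on `O`. -/
structure IsChartModel {ι : Type*} (x₀ : M) (O : Set M) (X : ι → VField n M)
    (Y : ι → SmoothMaps (EuclideanSpace ℝ (Fin n))) (r : ℝ) : Prop where
  pos : 0 < r
  hasCompactSupport : ∀ i, HasCompactSupport (Y i).1
  subset_target : Metric.ball (extChartAt (𝓡 n) x₀ x₀) r ⊆ (extChartAt (𝓡 n) x₀).target
  symm_mem : ∀ z ∈ Metric.ball (extChartAt (𝓡 n) x₀ x₀) r, (extChartAt (𝓡 n) x₀).symm z ∈ O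
  eq : ∀ z ∈ Metric.ball (extChartAt (𝓡 n) x₀ x₀) r, ∀ i,
    (Y i).1 z = chartField x₀ (X i) z

/-- Cutting the chart expressions off by a bump function makes them compactly supported, hence
bounded and Lipschitz on the whole model space; near the centre nothing changes. -/
theorem exists_isChartModel {ι : Type*} {x₀ : M} {O : Set M} (hO : IsOpen O) (hx₀ : x₀ ∈ O)
    {X : ι → VField n M} (hX : ∀ i, SmoothField O (X i)) : ∃ Y r, IsChartModel x₀ O X Y r := by
  obtain ⟨z₀, hz₀⟩ : ∃ z₀, z₀ = extChartAt (𝓡 n) x₀ x₀ := ⟨_, rfl⟩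
  have hopen : IsOpen ((extChartAt (𝓡 n) x₀).target ∩ (extChartAt (𝓡 n) x₀).symm ⁻¹' O) :=
    (continuousOn_extChartAt_symm x₀).isOpen_inter_preimage (isOpen_extChartAt_target x₀) hO
  have hmem : z₀ ∈ (extChartAt (𝓡 n) x₀).target ∩ (extChartAt (𝓡 n) x₀).symm ⁻¹' O :=
    by
    rw [hz₀]
    exact ⟨mem_extChartAt_target x₀, by simpa using hx₀⟩
  obtain ⟨R, hR, hsub⟩ := Metric.isOpen_iff.1 hopen z₀ hmem
  let χ : ContDiffBump z₀ := ⟨R / 4, R / 2, by positivity, by linarith⟩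
  have hχs : tsupport χ ⊆ Metric.ball z₀ R := by
    rw [χ.tsupport_eq]
    exact Metric.closedBall_subset_ball (by change R / 2 < R; linarith)
  have hsm : ∀ i, ContDiff ℝ ∞ fun z => χ z • chartField x₀ (X i) z := fun i => by
    refine contDiff_iff_contDiffAt.2 fun z => ?_
    by_cases hz : z ∈ tsupport χ
    · exact χ.contDiff.contDiffAt.smul
        (((hX i).contDiffOn_chartField x₀).contDiffAt (hopen.mem_nhds (hsub (hχs hz))))
    · refine contDiffAt_const (c := (0 : EuclideanSpace ℝ (Fin n))) |>.congr_of_eventuallyEq ?_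
      filter_upwards [notMem_tsupport_iff_eventuallyEq.1 hz] with y hy
      rw [hy, Pi.zero_apply, zero_smul]
  have hcs : ∀ i, HasCompactSupport fun z => χ z • chartField x₀ (X i) z := fun i =>
    χ.hasCompactSupport.mono fun z hz h0 => hz (by beta_reduce; rw [h0, zero_smul])
  let Y : ι → SmoothMaps (EuclideanSpace ℝ (Fin n)) := fun i => ⟨_, mem_smoothMaps.2 (hsm i)⟩
  have hY : ∀ z ∈ Metric.ball z₀ (R / 4), ∀ i, (Y i).1 z = chartField x₀ (X i) z := by
    intro z hz i
    change χ z • chartField x₀ (X i) z = _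
    rw [χ.one_of_mem_closedBall (Metric.ball_subset_closedBall hz), one_smul]
  have hsub' : ∀ z ∈ Metric.ball z₀ (R / 4), z ∈ Metric.ball z₀ R := fun z hz =>
    Metric.ball_subset_ball (by linarith) hz
  rw [hz₀] at hY hsub hsub'
  exact ⟨Y, R / 4, by positivity, hcs, fun z hz => (hsub (hsub' z hz)).1,
    fun z hz => (hsub (hsub' z hz)).2, hY⟩

theorem IsChartModel.mfderiv_apply {ι : Type*} {x₀ : M} {O : Set M} {X : ι → VField n M}
    {Y : ι → SmoothMaps (EuclideanSpace ℝ (Fin n))} {r : ℝ} (h : IsChartModel x₀ O X Y r)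
    {z : EuclideanSpace ℝ (Fin n)} (hz : z ∈ Metric.ball (extChartAt (𝓡 n) x₀ x₀) r) (i : ι) :
    mfderiv 𝓘(ℝ, EuclideanSpace ℝ (Fin n)) (𝓡 n) (extChartAt (𝓡 n) x₀).symm z
      ((Y i).1 z) = X i ((extChartAt (𝓡 n) x₀).symm z) := by
  rw [h.eq z hz]
  exact mfderiv_extChartAt_symm_chartField (h.subset_target hz) _

/-- Pullback commutes with Lie brackets, and brackets depend only on germs, so agreement on an open
ball is inherited by longer words. -/
theorem IsChartModel.wordField_eq {m : ℕ} {x₀ : M} {O : Set M} (hO : IsOpen O)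
    {X : Fin m → VField n M}
    (hX : ∀ i, SmoothField O (X i)) {Y : Fin m → SmoothMaps (EuclideanSpace ℝ (Fin n))} {r : ℝ}
    (h : IsChartModel x₀ O X Y r) (w : List (Fin m)) {z : EuclideanSpace ℝ (Fin n)}
    (hz : z ∈ Metric.ball (extChartAt (𝓡 n) x₀ x₀) r) :
    (wordField Y w).1 z = chartField x₀ (wordBracket X w) z := by
  induction w generalizing z with
  | nil =>
    change (0 : EuclideanSpace ℝ (Fin n)) = _
    exact (map_zero (mfderiv 𝓘(ℝ, EuclideanSpace ℝ (Fin n)) (𝓡 n)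
      (extChartAt (𝓡 n) x₀).symm z).inverse).symm
  | cons a w ih =>
    rcases w with _ | ⟨b, w⟩
    · exact h.eq z hz a
    · have hnhds := Metric.isOpen_ball.mem_nhds hz
      have e1 : (Y a).1 =ᶠ[𝓝 z] chartField x₀ (X a) :=
        eventually_of_mem hnhds fun z' hz' => h.eq z' hz' a
      have e2 : (wordField Y (b :: w)).1 =ᶠ[𝓝 z]
          chartField x₀ (wordBracket X (b :: w)) :=
        eventually_of_mem hnhds fun z' hz' => ih hz'
      change VectorField.lieBracket ℝ (Y a).1
        (wordField Y (b :: w)).1 z = _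
      rw [e1.lieBracket_vectorField_eq e2]
      have : IsManifold (𝓡 n) (minSmoothness ℝ 2) M := isManifold_minSmoothness 2
      have : IsManifold (𝓡 n) (minSmoothness ℝ 3) M := isManifold_minSmoothness 3
      have hs := contMDiffAt_extChartAt_symm_of_mem (h.subset_target hz)
      have hd1 := ((hX a).contMDiffAt hO (h.symm_mem z hz)).mdifferentiableAt (by simp)
      have hd2 := ((smoothField_wordBracket hO hX (b :: w)).contMDiffAt hO
        (h.symm_mem z hz)).mdifferentiableAt (by simp)
      have := VectorField.mpullback_mlieBracket hd1 hd2 hs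
        (by rw [minSmoothness_of_isRCLikeNormedField]; exact WithTop.coe_le_coe.2 le_top)
      refine Eq.trans ?_ this.symm
      rw [← VectorField.lieBracketWithin_univ, ← VectorField.mlieBracketWithin_univ]
      exact (congrFun VectorField.mlieBracketWithin_eq_lieBracketWithin z).symm

end ChartModel

/-! ## The exponential map of a frame of a manifold -/

section Curves

variable {n : ℕ} {M : Type*} [TopologicalSpace M] [ChartedSpace (EuclideanSpace ℝ (Fin n)) M]
  [IsManifold (𝓡 n) ∞ M]

theorem hasMFDerivAt_extChartAt_symm_comp {x₀ : M} {γ : ℝ → EuclideanSpace ℝ (Fin n)} {t : ℝ}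
    {v : EuclideanSpace ℝ (Fin n)} (hγ : HasDerivAt γ v t)
    (ht : γ t ∈ (extChartAt (𝓡 n) x₀).target) :
    HasMFDerivAt 𝓘(ℝ, ℝ) (𝓡 n) (fun s => (extChartAt (𝓡 n) x₀).symm (γ s)) t
      ((1 : ℝ →L[ℝ] ℝ).smulRight
        (mfderiv 𝓘(ℝ, EuclideanSpace ℝ (Fin n)) (𝓡 n) (extChartAt (𝓡 n) x₀).symm (γ t) v)) := by
  have h1 : HasMFDerivAt 𝓘(ℝ, EuclideanSpace ℝ (Fin n)) (𝓡 n) (extChartAt (𝓡 n) x₀).symm (γ t)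
      (mfderiv 𝓘(ℝ, EuclideanSpace ℝ (Fin n)) (𝓡 n) (extChartAt (𝓡 n) x₀).symm (γ t)) :=
    ((contMDiffAt_extChartAt_symm_of_mem ht).mdifferentiableAt (by simp)).hasMFDerivAt
  have h2 := h1.comp t hγ.hasFDerivAt.hasMFDerivAt
  refine h2.congr_mfderiv (ContinuousLinearMap.ext fun c => ?_)
  exact map_smul (mfderiv 𝓘(ℝ, EuclideanSpace ℝ (Fin n)) (𝓡 n) (extChartAt (𝓡 n) x₀).symm (γ t))
    (show ℝ from c) v

theorem hasDerivWithinAt_extChartAt_comp {x₀ : M} {η : ℝ → M} {s : Set ℝ} {t : ℝ}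
    {w : TangentSpace (𝓡 n) (η t)}
    (hη : HasMFDerivWithinAt 𝓘(ℝ, ℝ) (𝓡 n) η s t ((1 : ℝ →L[ℝ] ℝ).smulRight w))
    (ht : η t ∈ (extChartAt (𝓡 n) x₀).source) :
    HasDerivWithinAt (fun s => extChartAt (𝓡 n) x₀ (η s))
      (mfderiv (𝓡 n) 𝓘(ℝ, EuclideanSpace ℝ (Fin n)) (extChartAt (𝓡 n) x₀) (η t) w) s t := by
  have h1 : HasMFDerivAt (𝓡 n) 𝓘(ℝ, EuclideanSpace ℝ (Fin n)) (extChartAt (𝓡 n) x₀) (η t)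
      (mfderiv (𝓡 n) 𝓘(ℝ, EuclideanSpace ℝ (Fin n)) (extChartAt (𝓡 n) x₀) (η t)) :=
    ((contMDiffAt_extChartAt' (n := ∞) (by rwa [extChartAt_source] at ht)).mdifferentiableAt
      (by simp)).hasMFDerivAt
  have h2 := (h1.comp_hasMFDerivWithinAt t hη).hasFDerivWithinAt
  refine hasDerivWithinAt_iff_hasFDerivWithinAt.2 (h2.congr_fderiv (ContinuousLinearMap.ext
    fun c => ?_))
  exact map_smul (mfderiv (𝓡 n) 𝓘(ℝ, EuclideanSpace ℝ (Fin n)) (extChartAt (𝓡 n) x₀) (η t))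
    (show ℝ from c) w

theorem mfderiv_extChartAt_apply {x₀ : M} {z : EuclideanSpace ℝ (Fin n)}
    (hz : z ∈ (extChartAt (𝓡 n) x₀).target) (X : VField n M) :
    mfderiv (𝓡 n) 𝓘(ℝ, EuclideanSpace ℝ (Fin n)) (extChartAt (𝓡 n) x₀)
      ((extChartAt (𝓡 n) x₀).symm z) (X ((extChartAt (𝓡 n) x₀).symm z)) = chartField x₀ X z := by
  have : IsManifold (𝓡 n) 1 M := IsManifold.of_le (n := ∞) (by simp)
  have h := mfderiv_extChartAt_comp_mfderivWithin_extChartAt_symm (I := 𝓡 n) hz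
  have hr : range (𝓡 n) = univ := ModelWithCorners.range_eq_univ _
  rw [hr, mfderivWithin_univ] at h
  rw [← mfderiv_extChartAt_symm_chartField hz X]
  exact DFunLike.congr_fun h (chartField x₀ X z)

omit [IsManifold (𝓡 n) ∞ M] in
theorem chartField_sum (x₀ : M) (X : Fin n → VField n M) (a : Fin n → ℝ)
    (z : EuclideanSpace ℝ (Fin n)) :
    chartField x₀ (fun y => ∑ i, a i • X i y) z = ∑ i, a i • chartField x₀ (X i) z := by
  simp only [chartField, VectorField.mpullback_apply, map_sum, map_smul]
  rfl

variable {x₀ : M} {U : Set M} {X : Fin n → VField n M}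
  {Y : Fin n → SmoothMaps (EuclideanSpace ℝ (Fin n))} {r : ℝ}

omit [IsManifold (𝓡 n) ∞ M] in
theorem IsChartModel.chartField_sum_eq (h : IsChartModel x₀ U X Y r)
    {z : EuclideanSpace ℝ (Fin n)} (hz : z ∈ Metric.ball (extChartAt (𝓡 n) x₀ x₀) r)
    (a : Fin n → ℝ) : chartField x₀ (fun y => ∑ i, a i • X i y) z = ∑ i, a i • (Y i).1 z := by
  rw [chartField_sum]
  exact Finset.sum_congr rfl fun i _ => by rw [h.eq z hz]

theorem IsChartModel.isExp (h : IsChartModel x₀ U X Y r) {a : Fin n → ℝ}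
    {z : EuclideanSpace ℝ (Fin n)} {γ : ℝ → EuclideanSpace ℝ (Fin n)}
    (hγ : IsFrameFlow (fun i => (Y i).1) a z γ)
    (hball : ∀ t ∈ Icc (0 : ℝ) 1, γ t ∈ Metric.ball (extChartAt (𝓡 n) x₀ x₀) r) :
    IsExp U X a ((extChartAt (𝓡 n) x₀).symm z) ((extChartAt (𝓡 n) x₀).symm (γ 1)) := by
  refine ⟨fun t => (extChartAt (𝓡 n) x₀).symm (γ t), congrArg _ hγ.1, rfl,
    fun t ht => h.symm_mem _ (hball t ht), fun t ht => ?_⟩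
  have htgt := h.subset_target (hball t ht)
  have h1 := hasMFDerivAt_extChartAt_symm_comp (x₀ := x₀)
    (hγ.2 t ⟨by linarith [ht.1], by linarith [ht.2]⟩) htgt
  rw [← h.chartField_sum_eq (hball t ht), mfderiv_extChartAt_symm_chartField htgt] at h1
  exact h1.hasMFDerivWithinAt

/-- The competing curve `η` is not known to stay in the chart. The set of times at which it agrees
with the chart flow is closed since `M` is Hausdorff; after each such time `η` remains in the chart
for a while, and uniqueness of ODE solutions prolongs the agreement to the right. -/
theorem IsChartModel.eq_of_isExp [T2Space M] (h : IsChartModel x₀ U X Y r) {K : NNReal}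
    (hK : ∀ i, LipschitzWith K (Y i).1) {a : Fin n → ℝ} {z : EuclideanSpace ℝ (Fin n)}
    {γ : ℝ → EuclideanSpace ℝ (Fin n)} (hγ : IsFrameFlow (fun i => (Y i).1) a z γ)
    (hball : ∀ t ∈ Icc (0 : ℝ) 1, γ t ∈ Metric.ball (extChartAt (𝓡 n) x₀ x₀) r) {y : M}
    (hy : IsExp U X a ((extChartAt (𝓡 n) x₀).symm z) y) :
    y = (extChartAt (𝓡 n) x₀).symm (γ 1) := by
  obtain ⟨η, hη0, hη1, -, hη⟩ := hy
  set φ := extChartAt (𝓡 n) x₀ with hφ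
  set s : Set ℝ := (fun t => (η t, φ.symm (γ t))) ⁻¹' diagonal M with hs
  have hηc : ContinuousOn η (Icc 0 1) := fun t ht => (hη t ht).continuousWithinAt
  have hγd : ∀ t ∈ Icc (0 : ℝ) 1, HasDerivAt γ (∑ i, a i • (Y i).1 (γ t)) t := fun t ht =>
    hγ.2 t ⟨by linarith [ht.1], by linarith [ht.2]⟩
  have hγc : ContinuousOn γ (Icc 0 1) := fun t ht => (hγd t ht).continuousAt.continuousWithinAt
  have htgt : ∀ t ∈ Icc (0 : ℝ) 1, γ t ∈ φ.target := fun t ht => h.subset_target (hball t ht)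
  have hsub : Icc (0 : ℝ) 1 ⊆ s := by
    refine IsClosed.Icc_subset_of_forall_mem_nhdsGT_of_Icc_subset ?_ ?_ ?_
    · rw [inter_comm]
      exact (hηc.prodMk ((continuousOn_extChartAt_symm x₀).comp hγc htgt)).preimage_isClosed_of_isClosed
        isClosed_Icc isClosed_diagonal
    · change η 0 = φ.symm (γ 0)
      rw [hη0, hγ.1]
    · intro t ht hIt
      have ht' : t ∈ Icc (0 : ℝ) 1 := ⟨ht.1, ht.2.le⟩
      have hts : η t = φ.symm (γ t) := hIt ⟨ht.1, le_rfl⟩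
      have hsrc : η t ∈ φ.source := by
        rw [hts]
        exact φ.map_target (htgt t ht')
      have hφη : φ (η t) = γ t := by rw [hts, φ.right_inv (htgt t ht')]
      have hev : ∀ᶠ u in 𝓝[Icc 0 1] t, η u ∈ φ.source ∧
          φ (η u) ∈ Metric.ball (φ x₀) r := by
        have h1 : ∀ᶠ p in 𝓝 (η t), p ∈ φ.source :=
          (isOpen_extChartAt_source x₀).mem_nhds hsrc
        have h2 : ∀ᶠ p in 𝓝 (η t), φ p ∈ Metric.ball (φ x₀) r := by
          refine (continuousAt_extChartAt' hsrc).eventually (Metric.isOpen_ball.mem_nhds ?_)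
          rw [← hφ, hφη]
          exact hball t ht'
        exact (hηc t ht').eventually (h1.and h2)
      have hIcc : Icc (0 : ℝ) 1 ∈ 𝓝[≥] t :=
        mem_of_superset (Icc_mem_nhdsGE ht.2) (Icc_subset_Icc_left ht.1)
      obtain ⟨u, hu, hIu⟩ := mem_nhdsGE_iff_exists_Icc_subset.1
        (inter_mem hIcc ((nhdsWithin_le_of_mem hIcc) hev))
      have hd : ∀ v ∈ Icc t u, HasDerivWithinAt (fun w => φ (η w))
          (∑ i, a i • (Y i).1 (φ (η v))) (Icc 0 1) v := by
        intro v hv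
        have hv1 := (hIu hv).1
        have hv2 : η v ∈ φ.source ∧ φ (η v) ∈ Metric.ball (φ x₀) r := (hIu hv).2
        have h1 := hasDerivWithinAt_extChartAt_comp (x₀ := x₀) (hη v hv1) hv2.1
        have h2 := mfderiv_extChartAt_apply (h.subset_target hv2.2) fun y => ∑ i, a i • X i y
        rw [φ.left_inv hv2.1, h.chartField_sum_eq hv2.2] at h2
        rw [← h2]
        exact h1
      have heq := ODE_solution_unique_of_mem_Icc_right (s := fun _ => univ)
        (v := fun _ y => ∑ i, a i • (Y i).1 y) (f := fun w => φ (η w)) (g := γ) (a := t) (b := u)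
        (fun _ _ => (lipschitzWith_sum_smul hK a).lipschitzOnWith)
        (fun v hv => ((hd v hv).continuousWithinAt.mono fun w hw => (hIu hw).1))
        (fun v hv => (hd v ⟨hv.1, hv.2.le⟩).mono_of_mem_nhdsWithin
          (mem_of_superset (Icc_mem_nhdsGE hv.2) fun w hw => (hIu ⟨hv.1.trans hw.1, hw.2⟩).1))
        (fun _ _ => mem_univ _)
        (hγc.mono fun w hw => (hIu hw).1)
        (fun v hv => (hγd v (hIu ⟨hv.1, hv.2.le⟩).1).hasDerivWithinAt)
        (fun _ _ => mem_univ _) hφη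
      refine mem_of_superset (Ioc_mem_nhdsGT hu) fun v hv => ?_
      have hv' : v ∈ Icc t u := ⟨hv.1.le, hv.2⟩
      have hv2 : η v ∈ φ.source ∧ φ (η v) ∈ Metric.ball (φ x₀) r := (hIu hv').2
      change η v = φ.symm (γ v)
      rw [← heq hv', φ.left_inv hv2.1]
  rw [← hη1]
  exact hsub ⟨zero_le_one, le_rfl⟩

theorem exists_lipschitz_bound {ι E : Type*} [NormedAddCommGroup E] [NormedSpace ℝ E] [Finite ι]
    {Y : ι → SmoothMaps E} (hY : ∀ i, HasCompactSupport (Y i).1) :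
    ∃ K B : NNReal, (∀ i, LipschitzWith K (Y i).1) ∧ ∀ i z, ‖(Y i).1 z‖ ≤ B := by
  have := Fintype.ofFinite ι
  choose K hK using fun i =>
    (smoothMaps_contDiff (Y i)).lipschitzWith_of_hasCompactSupport (hY i) (by simp)
  choose B hB using fun i =>
    (hY i).exists_bound_of_continuous (smoothMaps_contDiff (Y i)).continuous
  refine ⟨∑ i, K i, ∑ i, (B i).toNNReal, fun i => (hK i).weaken
    (Finset.single_le_sum (fun _ _ => zero_le) (Finset.mem_univ i)), fun i z => ?_⟩
  refine ((hB i z).trans (Real.le_coe_toNNReal _)).trans (NNReal.coe_le_coe.2 ?_)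
  exact Finset.single_le_sum (f := fun i => (B i).toNNReal) (fun _ _ => zero_le)
    (Finset.mem_univ i)

theorem IsChartModel.linearIndependent (h : IsChartModel x₀ U X Y r)
    (hind : LinearIndependent ℝ fun i => X i x₀) :
    LinearIndependent ℝ fun i => (Y i).1 (extChartAt (𝓡 n) x₀ x₀) := by
  have hz := Metric.mem_ball_self (x := extChartAt (𝓡 n) x₀ x₀) h.pos
  have hind' : LinearIndependent ℝ
      fun i => X i ((extChartAt (𝓡 n) x₀).symm (extChartAt (𝓡 n) x₀ x₀)) := by
    rw [extChartAt_to_inv]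
    exact hind
  let D : EuclideanSpace ℝ (Fin n) →L[ℝ] EuclideanSpace ℝ (Fin n) :=
    mfderiv 𝓘(ℝ, EuclideanSpace ℝ (Fin n)) (𝓡 n) (extChartAt (𝓡 n) x₀).symm
      (extChartAt (𝓡 n) x₀ x₀)
  refine LinearIndependent.of_comp D.toLinearMap ?_
  have e : D.toLinearMap ∘ (fun i => (Y i).1 (extChartAt (𝓡 n) x₀ x₀)) =
      fun i => (X i ((extChartAt (𝓡 n) x₀).symm (extChartAt (𝓡 n) x₀ x₀)) :) :=
    funext fun i => h.mfderiv_apply hz i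
  rw [e]
  exact hind'

/-- Local exponential coordinates of a frame of a manifold. -/
theorem exists_local_isExp [T2Space M] (hU : IsOpen U) (hX : ∀ i, SmoothField U (X i))
    (hind : ∀ y ∈ U, LinearIndependent ℝ fun i => X i y) (hx₀ : x₀ ∈ U) :
    ∃ (G : M → (Fin n → ℝ) → M) (Λ : M → M → Fin n → ℝ),
      (∀ᶠ p : M × (Fin n → ℝ) in 𝓝 (x₀, 0),
        ContinuousAt (fun q : M × (Fin n → ℝ) => G q.1 q.2) p ∧ Λ p.1 (G p.1 p.2) = p.2) ∧
      (∀ᶠ p : M × M in 𝓝 (x₀, x₀),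
        ContinuousAt (fun q : M × M => Λ q.1 q.2) p ∧ G p.1 (Λ p.1 p.2) = p.2) ∧
      Λ x₀ x₀ = 0 ∧ G x₀ 0 = x₀ ∧
      ∀ᶠ p : M × (Fin n → ℝ) in 𝓝 (x₀, 0),
        IsExp U X p.2 p.1 (G p.1 p.2) ∧ ∀ y, IsExp U X p.2 p.1 y → y = G p.1 p.2 := by
  obtain ⟨Y, r, h⟩ := exists_isChartModel hU hx₀ hX
  obtain ⟨K, B, hK, hB⟩ := exists_lipschitz_bound h.hasCompactSupport
  set φ := extChartAt (𝓡 n) x₀ with hφ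
  have hli := h.linearIndependent (hind x₀ hx₀)
  let A : (Fin n → ℝ) ≃L[ℝ] EuclideanSpace ℝ (Fin n) :=
    ((Fintype.linearCombination ℝ fun i => (Y i).1 (φ x₀)).linearEquivOfInjective
      hli.fintypeLinearCombination_injective (by simp)).toContinuousLinearEquiv
  have hA : ∀ a, A a = ∑ i, a i • (Y i).1 (φ x₀) := fun a => by
    change (Fintype.linearCombination ℝ fun i => (Y i).1 (φ x₀)) a = _
    rw [Fintype.linearCombination_apply]
  obtain ⟨G, Λ, hG, hGc, hΛc, hΛ0, hG0⟩ := exists_local_exp hK hB (φ x₀) A hA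
  have hφc : ContinuousAt φ x₀ := continuousAt_extChartAt x₀
  have hsrc : ∀ᶠ x in 𝓝 x₀, x ∈ φ.source := extChartAt_source_mem_nhds x₀
  have hl1 : Tendsto (fun p : M × (Fin n → ℝ) => (φ p.1, p.2)) (𝓝 (x₀, 0)) (𝓝 (φ x₀, 0)) := by
    rw [nhds_prod_eq]
    exact (hφc.tendsto.comp tendsto_fst).prodMk_nhds tendsto_snd
  have hl2 : Tendsto (fun p : M × M => (φ p.1, φ p.2)) (𝓝 (x₀, x₀)) (𝓝 (φ x₀, φ x₀)) := by
    rw [nhds_prod_eq]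
    exact (hφc.tendsto.comp tendsto_fst).prodMk_nhds (hφc.tendsto.comp tendsto_snd)
  have hl1c := hl1.eventually hGc
  have hl2c := hl2.eventually hΛc
  have hGtgt : ∀ᶠ p : M × (Fin n → ℝ) in 𝓝 (x₀, 0), G (φ p.1) p.2 ∈ φ.target := by
    have h1 : ContinuousAt (fun q : EuclideanSpace ℝ (Fin n) × (Fin n → ℝ) => G q.1 q.2)
      (φ x₀, 0) := hGc.self_of_nhds.1
    refine (h1.tendsto.comp hl1).eventually ((isOpen_extChartAt_target x₀).mem_nhds ?_)
    change G (φ x₀) 0 ∈ φ.target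
    rw [hG0]
    exact mem_extChartAt_target x₀
  have hfst : ∀ᶠ p : M × (Fin n → ℝ) in 𝓝 (x₀, 0), p.1 ∈ φ.source :=
    (continuous_fst.tendsto (x₀, (0 : Fin n → ℝ))).eventually hsrc
  have hfst' : ∀ᶠ p : M × M in 𝓝 (x₀, x₀), p.1 ∈ φ.source :=
    (continuous_fst.tendsto (x₀, x₀)).eventually hsrc
  have hsnd' : ∀ᶠ p : M × M in 𝓝 (x₀, x₀), p.2 ∈ φ.source :=
    (continuous_snd.tendsto (x₀, x₀)).eventually hsrc
  refine ⟨fun x a => φ.symm (G (φ x) a), fun x y => Λ (φ x) (φ y), ?_, ?_, hΛ0, ?_, ?_⟩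
  · filter_upwards [hl1c, hGtgt, hfst] with p hp hp2 hp3
    refine ⟨?_, by rw [φ.right_inv hp2, hp.2]⟩
    have h1 : ContinuousAt (fun q : M × (Fin n → ℝ) => (φ q.1, q.2)) p :=
      ((continuousAt_extChartAt' hp3).comp continuousAt_fst).prodMk continuousAt_snd
    have h2 : ContinuousAt (fun q : M × (Fin n → ℝ) => G (φ q.1) q.2) p :=
      ContinuousAt.comp (f := fun q : M × (Fin n → ℝ) => (φ q.1, q.2)) hp.1 h1
    exact ContinuousAt.comp (f := fun q : M × (Fin n → ℝ) => G (φ q.1) q.2)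
      (continuousAt_extChartAt_symm'' hp2) h2
  · filter_upwards [hl2c, hfst', hsnd'] with p hp hp1 hp2
    refine ⟨?_, by rw [hp.2, φ.left_inv hp2]⟩
    exact ContinuousAt.comp (f := fun q : M × M => (φ q.1, φ q.2)) hp.1
      (((continuousAt_extChartAt' hp1).comp continuousAt_fst).prodMk
        ((continuousAt_extChartAt' hp2).comp continuousAt_snd))
  · change φ.symm (G (φ x₀) 0) = x₀
    rw [hG0]
    exact extChartAt_to_inv x₀
  -- The flow moves by at most `n ‖a‖ B`, so this bound confines it to the ball on which the model
  -- fields are the given ones.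
  · have hsmall : ∀ᶠ p : M × (Fin n → ℝ) in 𝓝 (x₀, 0),
        dist (φ p.1) (φ x₀) + n * (‖p.2‖ * B) < r := by
      have h1 : Tendsto (fun p : M × (Fin n → ℝ) => dist (φ p.1) (φ x₀) + n * (‖p.2‖ * B))
          (𝓝 (x₀, 0)) (𝓝 (dist (φ x₀) (φ x₀) + n * (‖(0 : Fin n → ℝ)‖ * B))) :=
by
        rw [nhds_prod_eq]
        exact ((hφc.tendsto.comp tendsto_fst).dist tendsto_const_nhds).add
          ((tendsto_snd.norm.mul_const _).const_mul _)
      refine h1.eventually (gt_mem_nhds ?_)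
      simpa using h.pos
    filter_upwards [hsmall, hfst] with p hp hp1
    obtain ⟨γ, hγ, hγ1⟩ := hG (φ p.1) p.2
    have hball : ∀ t ∈ Icc (0 : ℝ) 1, γ t ∈ Metric.ball (φ x₀) r := fun t ht => by
      have h1 := hγ.norm_sub_le hB ht
      rw [← dist_eq_norm] at h1
      rw [Metric.mem_ball]
      linarith [dist_triangle (γ t) (φ p.1) (φ x₀)]
    have h1 := h.isExp hγ hball
    have h2 := fun y => h.eq_of_isExp hK hγ hball (y := y)
    rw [← hφ, φ.left_inv hp1, hγ1] at h1
    rw [← hφ, φ.left_inv hp1, hγ1] at h2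
    exact ⟨h1, h2⟩

end Curves

/-! ## The Carnot-Carathéodory distance -/

section AbsolutelyContinuous

open AbsolutelyContinuousOnInterval in
-- A monotone or antitone 1-Lipschitz change of parameter sends disjoint intervals to disjoint
-- intervals that are no longer. It is applied to reflections and to clamps.
theorem AbsolutelyContinuousOnInterval.comp_of_dist_le {f : ℝ → ℝ} {φ : ℝ → ℝ} {a b a' b' : ℝ}
    (hf : AbsolutelyContinuousOnInterval f a' b') (hφ : Monotone φ ∨ Antitone φ)
    (hd : ∀ s t, dist (φ s) (φ t) ≤ dist s t) (hm : MapsTo φ (uIcc a b) (uIcc a' b')) :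
    AbsolutelyContinuousOnInterval (f ∘ φ) a b := by
  rw [absolutelyContinuousOnInterval_iff] at hf ⊢
  intro ε hε
  obtain ⟨δ, hδ, h⟩ := hf ε hε
  refine ⟨δ, hδ, fun E hE hlt => h (E.1, fun i => (φ (E.2 i).1, φ (E.2 i).2)) ⟨fun i hi => ?_, ?_⟩
    ((Finset.sum_le_sum fun i _ => hd _ _).trans_lt hlt)⟩
  · exact ⟨hm (hE.1 i hi).1, hm (hE.1 i hi).2⟩
  · intro i hi j hj hij
    have := hE.2 hi hj hij
    simp only [Function.onFun, uIoc, Set.Ioc_disjoint_Ioc] at this ⊢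
    rcases hφ with hφ | hφ
    · simp only [← hφ.map_max, ← hφ.map_min]
      exact hφ this
    · simp only [← hφ.map_max, ← hφ.map_min]
      exact hφ this

theorem ite_eventuallyEq_left {α : Type*} {c₁ c₂ : ℝ → α} {b t : ℝ} (h : t < b) :
    (fun s => if s ≤ b then c₁ s else c₂ s) =ᶠ[𝓝 t] c₁ := by
  filter_upwards [Iio_mem_nhds h] with s hs
  exact if_pos (le_of_lt hs)

theorem ite_eventuallyEq_right {α : Type*} {c₁ c₂ : ℝ → α} {b t : ℝ} (h : b < t) :
    (fun s => if s ≤ b then c₁ s else c₂ s) =ᶠ[𝓝 t] c₂ := by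
  filter_upwards [Ioi_mem_nhds h] with s hs
  exact if_neg (not_le_of_gt hs)

end AbsolutelyContinuous

/-! ### The Carnot–Carathéodory distance as a pseudometric -/

section CC

variable {n m : ℕ} {M : Type*} [TopologicalSpace M] [ChartedSpace (EuclideanSpace ℝ (Fin n)) M]

theorem velocity_congr {c c' : ℝ → M} {t : ℝ} (h : c =ᶠ[𝓝 t] c') :
    (velocity n c t : EuclideanSpace ℝ (Fin n)) = velocity n c' t := by
  have := h.mfderiv_eq (I := 𝓘(ℝ, ℝ)) (I' := 𝓡 n)
  unfold velocity
  exact congrArg (fun D : ℝ →L[ℝ] EuclideanSpace ℝ (Fin n) => D 1) this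

theorem hasMFDerivAt_const_sub {c : ℝ → M} {r t : ℝ}
    (h : MDifferentiableAt 𝓘(ℝ, ℝ) (𝓡 n) c (r - t)) :
    MDifferentiableAt 𝓘(ℝ, ℝ) (𝓡 n) (fun s => c (r - s)) t ∧
      (velocity n (fun s => c (r - s)) t : EuclideanSpace ℝ (Fin n)) = -velocity n c (r - t) := by
  have h1 : HasMFDerivAt 𝓘(ℝ, ℝ) 𝓘(ℝ, ℝ) (fun s : ℝ => r - s) t
      ((1 : ℝ →L[ℝ] ℝ).smulRight (-1 : ℝ)) :=
    ((hasDerivAt_id t).const_sub r).hasFDerivAt.hasMFDerivAt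
  have h2 := HasMFDerivAt.comp t h.hasMFDerivAt h1
  refine ⟨h2.mdifferentiableAt, ?_⟩
  unfold velocity
  have h3 := h2.mfderiv
  let L : ℝ →L[ℝ] EuclideanSpace ℝ (Fin n) := mfderiv 𝓘(ℝ, ℝ) (𝓡 n) c (r - t)
  have h4 := congrArg (fun D : ℝ →L[ℝ] EuclideanSpace ℝ (Fin n) => D 1) h3
  refine h4.trans ?_
  change L (((1 : ℝ →L[ℝ] ℝ).smulRight (-1 : ℝ)) 1) = - L 1
  rw [← map_neg]
  simp

variable [IsManifold (𝓡 n) ∞ M]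

theorem SubRiemannian.hnorm_neg (S : SubRiemannian n m M) (x : M) (v : TangentSpace (𝓡 n) x) :
    S.hnorm x (-v) = S.hnorm x v := by
  unfold SubRiemannian.hnorm
  by_cases h : v ∈ S.D.fiber x
  · have h' : -v ∈ S.D.fiber x := neg_mem h
    rw [dif_pos h, dif_pos h']
    have : (⟨-v, h'⟩ : S.D.fiber x) = -⟨v, h⟩ := rfl
    rw [this, map_neg, map_neg, LinearMap.neg_apply, neg_neg]
  · rw [dif_neg h, dif_neg (fun h' => h (by simpa using neg_mem h'))]

theorem SubRiemannian.hnorm_congr (S : SubRiemannian n m M) {x y : M} (hxy : x = y)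
    {v w : EuclideanSpace ℝ (Fin n)} (hvw : v = w) : S.hnorm x v = S.hnorm y w := by
  subst hxy hvw; rfl

theorem TangentDistribution.mem_fiber_congr (D : TangentDistribution n m M) {x y : M} (hxy : x = y)
    {v : TangentSpace (𝓡 n) x} {w : TangentSpace (𝓡 n) y}
    (hvw : (v : EuclideanSpace ℝ (Fin n)) = w) (hv : v ∈ D.fiber x) : w ∈ D.fiber y := by
  subst hxy
  have : v = w := hvw
  exact this ▸ hv

variable {D : TangentDistribution n m M}

theorem isHorizontal_const (x : M) (a : ℝ) : IsHorizontal D (fun _ => x) a a := by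
  refine ⟨le_rfl, continuousOn_const, fun f _ => ?_, ?_⟩
  · exact (LipschitzOnWith.of_dist_le_mul (K := 0) (by simp)).absolutelyContinuousOnInterval
  · simp

theorem IsHorizontal.const_sub {c : ℝ → M} {a b : ℝ} (h : IsHorizontal D c a b) (r : ℝ) :
    IsHorizontal D (fun t => c (r - t)) (r - b) (r - a) := by
  have hmaps : MapsTo (fun t => r - t) (Icc (r - b) (r - a)) (Icc a b) := fun t ht =>
    ⟨by linarith [ht.2], by linarith [ht.1]⟩
  refine ⟨by linarith [h.1], h.2.1.comp (by fun_prop) hmaps, fun f hf => ?_, ?_⟩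
  · refine (h.2.2.1 f hf).comp_of_dist_le (φ := fun t => r - t) (Or.inr fun s t hst => ?_)
      (fun s t => ?_) ?_
    · simp only; linarith
    · rw [dist_sub_left]
    · rwa [uIcc_of_le h.1, uIcc_of_le (by linarith [h.1])]
  · have h4 := h.2.2.2
    rw [ae_restrict_iff' measurableSet_Icc] at h4 ⊢
    have h5 := (volume.measurePreserving_sub_left r).quasiMeasurePreserving.ae h4
    filter_upwards [h5] with t ht hts
    obtain ⟨h6, h7⟩ := ht (hmaps hts)
    obtain ⟨h8, h9⟩ := hasMFDerivAt_const_sub h6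
    refine ⟨h8, ?_⟩
    exact D.mem_fiber_congr rfl h9.symm (neg_mem h7)

theorem SubRiemannian.length_const_sub (S : SubRiemannian n m M) {c : ℝ → M} {a b : ℝ}
    (h : IsHorizontal S.D c a b) (r : ℝ) :
    S.length (fun t => c (r - t)) (r - b) (r - a) = S.length c a b := by
  unfold SubRiemannian.length
  have hp : (fun t => r - t) ⁻¹' Icc a b = Icc (r - b) (r - a) := by simp
  rw [← (volume.measurePreserving_sub_left r).setLIntegral_comp_preimage_emb
    (MeasurableEquiv.subLeft r).measurableEmbedding _ (Icc a b), hp]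
  have h4 := h.2.2.2
  rw [ae_restrict_iff' measurableSet_Icc] at h4
  have h5 := (volume.measurePreserving_sub_left r).quasiMeasurePreserving.ae h4
  refine setLIntegral_congr_fun_ae measurableSet_Icc ?_
  filter_upwards [h5] with t ht hts
  rw [← hp] at hts
  have h9 := (hasMFDerivAt_const_sub (ht hts).1).2
  rw [S.hnorm_congr (rfl : c (r - t) = c (r - t)) h9]
  exact congrArg _ (S.hnorm_neg _ _)

theorem IsHorizontal.glue {c₁ c₂ : ℝ → M} {a b e : ℝ} (h₁ : IsHorizontal D c₁ a b)
    (h₂ : IsHorizontal D c₂ b e) (hb : c₁ b = c₂ b) :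
    IsHorizontal D (fun t => if t ≤ b then c₁ t else c₂ t) a e := by
  have hae := h₁.1.trans h₂.1
  have e₂ : ∀ t, b ≤ t → (if t ≤ b then c₁ t else c₂ t) = c₂ t := by
    intro t ht
    split_ifs with h
    · rw [le_antisymm h ht, hb]
    · rfl
  refine ⟨hae, ?_, fun f hf => ?_, ?_⟩
  · rw [← Icc_union_Icc_eq_Icc h₁.1 h₂.1]
    refine ContinuousOn.union_of_isClosed (h₁.2.1.congr fun t ht => if_pos ht.2)
      (h₂.2.1.congr fun t ht => e₂ t ht.1) isClosed_Icc isClosed_Icc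
  · have k₁ : AbsolutelyContinuousOnInterval ((f ∘ c₁) ∘ fun t => min t b) a e := by
      refine (h₁.2.2.1 f hf).comp_of_dist_le (Or.inl fun s t hst => min_le_min_right _ hst)
        (fun s t => ?_) ?_
      · exact (abs_min_sub_min_le_max s b t b).trans (by simp [Real.dist_eq])
      · rw [uIcc_of_le h₁.1, uIcc_of_le hae]
        exact fun t ht => ⟨le_min ht.1 h₁.1, min_le_right _ _⟩
    have k₂ : AbsolutelyContinuousOnInterval ((f ∘ c₂) ∘ fun t => max t b) a e := by
      refine (h₂.2.2.1 f hf).comp_of_dist_le (Or.inl fun s t hst => max_le_max_right _ hst)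
        (fun s t => ?_) ?_
      · exact (abs_max_sub_max_le_max s b t b).trans (by simp [Real.dist_eq])
      · rw [uIcc_of_le h₂.1, uIcc_of_le hae]
        exact fun t ht => ⟨le_max_right _ _, max_le ht.2 h₂.1⟩
    have k₃ : AbsolutelyContinuousOnInterval (fun _ : ℝ => f (c₁ b)) a e :=
      (LipschitzOnWith.of_dist_le_mul (K := 0) (by simp)).absolutelyContinuousOnInterval
    convert! (k₁.add k₂).sub k₃ using 1
    funext t
    simp only [Function.comp_apply, Pi.add_apply, Pi.sub_apply]
    rcases le_or_gt t b with ht | ht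
    · rw [if_pos ht, min_eq_left ht, max_eq_right ht, ← hb]; ring
    · rw [if_neg ht.not_ge, min_eq_right ht.le, max_eq_left ht.le]; ring
  · have h3 := h₁.2.2.2
    have h4 := h₂.2.2.2
    rw [ae_restrict_iff' measurableSet_Icc] at h3 h4 ⊢
    have h5 : ∀ᵐ t : ℝ, t ≠ b := by simp [ae_iff, measure_singleton]
    filter_upwards [h3, h4, h5] with t ht₁ ht₂ ht hts
    rcases lt_or_gt_of_ne ht with h | h
    · have hE := ite_eventuallyEq_left (c₁ := c₁) (c₂ := c₂) h
      obtain ⟨h6, h7⟩ := ht₁ ⟨hts.1, h.le⟩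
      exact ⟨h6.congr_of_eventuallyEq hE,
        D.mem_fiber_congr hE.eq_of_nhds.symm (velocity_congr hE).symm h7⟩
    · have hE := ite_eventuallyEq_right (c₁ := c₁) (c₂ := c₂) h
      obtain ⟨h6, h7⟩ := ht₂ ⟨h.le, hts.2⟩
      exact ⟨h6.congr_of_eventuallyEq hE,
        D.mem_fiber_congr hE.eq_of_nhds.symm (velocity_congr hE).symm h7⟩

theorem SubRiemannian.length_glue_le (S : SubRiemannian n m M) {c₁ c₂ : ℝ → M} {a b e : ℝ}
    (hab : a ≤ b) (hbe : b ≤ e) :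
    S.length (fun t => if t ≤ b then c₁ t else c₂ t) a e ≤ S.length c₁ a b + S.length c₂ b e := by
  unfold SubRiemannian.length
  rw [← Icc_union_Icc_eq_Icc hab hbe]
  have h5 : ∀ᵐ t : ℝ, t ≠ b := by simp [ae_iff, measure_singleton]
  refine (lintegral_union_le _ _ _).trans (add_le_add (le_of_eq ?_) (le_of_eq ?_))
  · refine setLIntegral_congr_fun_ae measurableSet_Icc ?_
    filter_upwards [h5] with t ht hts
    have hE := ite_eventuallyEq_left (c₁ := c₁) (c₂ := c₂) (lt_of_le_of_ne hts.2 ht)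
    exact congrArg _ (S.hnorm_congr hE.eq_of_nhds (velocity_congr hE))
  · refine setLIntegral_congr_fun_ae measurableSet_Icc ?_
    filter_upwards [h5] with t ht hts
    have hE := ite_eventuallyEq_right (c₁ := c₁) (c₂ := c₂) (lt_of_le_of_ne hts.1 ht.symm)
    exact congrArg _ (S.hnorm_congr hE.eq_of_nhds (velocity_congr hE))

namespace SubRiemannian

variable (S : SubRiemannian n m M)

theorem ccEDist_le {c : ℝ → M} {a b : ℝ} (h : IsHorizontal S.D c a b) :
    S.ccEDist (c a) (c b) ≤ S.length c a b :=
  iInf_le_of_le c <| iInf_le_of_le a <| iInf_le_of_le b <| iInf_le _ ⟨h, rfl, rfl⟩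

theorem exists_isHorizontal_of_ccEDist_lt {x y : M} {l : ℝ≥0∞} (h : S.ccEDist x y < l) :
    ∃ c a b, IsHorizontal S.D c a b ∧ c a = x ∧ c b = y ∧ S.length c a b < l := by
  simp only [ccEDist, iInf_lt_iff] at h
  obtain ⟨c, a, b, h, hl⟩ := h
  exact ⟨c, a, b, h.1, h.2.1, h.2.2, hl⟩

theorem ccEDist_self (x : M) : S.ccEDist x x = 0 := by
  have h := S.ccEDist_le (isHorizontal_const (D := S.D) x 0)
  have : S.length (fun _ => x) 0 0 = 0 := by simp [length]
  exact le_antisymm (this ▸ h) bot_le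

theorem ccEDist_comm_le (x y : M) : S.ccEDist x y ≤ S.ccEDist y x := by
  refine le_iInf fun c => le_iInf fun a => le_iInf fun b => le_iInf fun h => ?_
  have h1 := S.ccEDist_le (h.1.const_sub 0)
  rw [S.length_const_sub h.1] at h1
  simpa [h.2.1, h.2.2] using h1

theorem ccEDist_comm (x y : M) : S.ccEDist x y = S.ccEDist y x :=
  le_antisymm (S.ccEDist_comm_le x y) (S.ccEDist_comm_le y x)

theorem ccEDist_triangle (x y z : M) : S.ccEDist x z ≤ S.ccEDist x y + S.ccEDist y z := by
  refine le_of_forall_gt fun l hl => ?_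
  obtain ⟨p, hp, q, hq, hpq⟩ : ∃ p, S.ccEDist x y < p ∧ ∃ q, S.ccEDist y z < q ∧ p + q ≤ l := by
    obtain ⟨ε, hε, h⟩ := ENNReal.lt_iff_exists_add_pos_lt.1 hl
    have hfin : S.ccEDist x y + S.ccEDist y z ≠ ⊤ := hl.ne_top
    rw [ENNReal.add_ne_top] at hfin
    have hε' : (ε : ℝ≥0∞) / 2 ≠ 0 := by simp [hε.ne']
    refine ⟨_, ENNReal.lt_add_right hfin.1 hε', _, ENNReal.lt_add_right hfin.2 hε', ?_⟩
    refine le_of_eq_of_le ?_ h.le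
    rw [add_add_add_comm, ENNReal.add_halves]
  obtain ⟨c₁, a₁, b₁, h₁, hx, hy, hl₁⟩ := S.exists_isHorizontal_of_ccEDist_lt hp
  obtain ⟨c₂, a₂, b₂, h₂, hy', hz, hl₂⟩ := S.exists_isHorizontal_of_ccEDist_lt hq
  -- Two reflections make the translation that lets the second curve start at time `b₁`.
  have h₃ := (h₂.const_sub 0).const_sub (b₁ - a₂)
  have hl₃ := S.length_const_sub (h₂.const_sub 0) (b₁ - a₂)
  rw [S.length_const_sub h₂] at hl₃
  rw [show b₁ - a₂ - (0 - a₂) = b₁ by ring] at h₃ hl₃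
  have h₄ := h₁.glue h₃ (by rw [hy]; simp [hy'])
  have h₅ := (S.ccEDist_le h₄).trans (S.length_glue_le h₁.1 h₃.1)
  rw [hl₃] at h₅
  have e₁ : (if a₁ ≤ b₁ then c₁ a₁ else c₂ (0 - (b₁ - a₂ - a₁))) = x := by rw [if_pos h₁.1, hx]
  have e₂ : ∀ t, b₁ ≤ t → (if t ≤ b₁ then c₁ t else c₂ (0 - (b₁ - a₂ - t))) =
      c₂ (0 - (b₁ - a₂ - t)) := by
    intro t ht
    split_ifs with h
    · rw [le_antisymm h ht, hy, ← hy']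
      congr 1
      ring
    · rfl
  rw [e₁, e₂ _ h₃.1, show (0 - (b₁ - a₂ - (b₁ - a₂ - (0 - b₂)))) = b₂ by ring, hz] at h₅
  exact (h₅.trans_lt (ENNReal.add_lt_add hl₁ hl₂)).trans_le hpq

end SubRiemannian

end CC

/-! ### Balls of the Carnot–Carathéodory distance are small -/

section CCLower

variable {n m : ℕ} {M : Type*} [TopologicalSpace M] [ChartedSpace (EuclideanSpace ℝ (Fin n)) M]

/-- The derivative of a function along a vector field. -/
noncomputable def mfderivAlong (f : M → ℝ) (x : M) (v : TangentSpace (𝓡 n) x) : ℝ :=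
  mfderiv (𝓡 n) 𝓘(ℝ, ℝ) f x v

theorem mfderivAlong_sum {ι : Type*} (s : Finset ι) (f : M → ℝ) (x : M) (a : ι → ℝ)
    (v : ι → TangentSpace (𝓡 n) x) :
    mfderivAlong f x (∑ i ∈ s, a i • v i) = ∑ i ∈ s, a i * mfderivAlong f x (v i) := by
  let L : EuclideanSpace ℝ (Fin n) →L[ℝ] ℝ := mfderiv (𝓡 n) 𝓘(ℝ, ℝ) f x
  have h : ∀ w : ι → EuclideanSpace ℝ (Fin n), L (∑ i ∈ s, a i • w i) = ∑ i ∈ s, a i * L (w i) :=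
    fun w => by simp
  exact h v

theorem hasDerivAt_comp_velocity {f : M → ℝ} (hf : ContMDiff (𝓡 n) 𝓘(ℝ, ℝ) ∞ f) {c : ℝ → M}
    {t : ℝ} (hc : MDifferentiableAt 𝓘(ℝ, ℝ) (𝓡 n) c t) :
    HasDerivAt (f ∘ c) (mfderivAlong f (c t) (velocity n c t)) t := by
  have h1 := (hf.mdifferentiableAt (x := c t) (by simp)).hasMFDerivAt.comp t hc.hasMFDerivAt
  let L : ℝ →L[ℝ] EuclideanSpace ℝ (Fin n) := mfderiv 𝓘(ℝ, ℝ) (𝓡 n) c t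
  let L' : EuclideanSpace ℝ (Fin n) →L[ℝ] ℝ := mfderiv (𝓡 n) 𝓘(ℝ, ℝ) f (c t)
  have h2 : HasFDerivAt (f ∘ c) (L' ∘L L) t := h1.hasFDerivAt
  exact h2.hasDerivAt

variable [IsManifold (𝓡 n) ∞ M]

theorem SmoothField.continuousOn_mfderivAlong {O : Set M} {X : VField n M} (hX : SmoothField O X)
    {f : M → ℝ} (hf : ContMDiff (𝓡 n) 𝓘(ℝ, ℝ) ∞ f) :
    ContinuousOn (fun x => mfderivAlong f x (X x)) O := by
  have h1 := hf.continuous_tangentMap (by simp)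
  have h2 := (contMDiff_snd_tangentBundle_modelSpace (n := 0) ℝ 𝓘(ℝ, ℝ)).continuous
  exact (h2.comp h1).comp_continuousOn hX.continuousOn

variable (S : SubRiemannian n m M)

theorem SubRiemannian.hnorm_nonneg (x : M) (v : TangentSpace (𝓡 n) x) : 0 ≤ S.hnorm x v := by
  unfold SubRiemannian.hnorm
  split_ifs <;> positivity

theorem OrthonormalOn.hnorm_sum {S : SubRiemannian n m M} {O : Set M} {X : Fin m → VField n M}
    (hX : OrthonormalOn S O X) {x : M} (hx : x ∈ O) (a : Fin m → ℝ) :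
    S.hnorm x (∑ i, a i • X i x) = √(∑ i, a i ^ 2) := by
  obtain ⟨h, hg⟩ := hX x hx
  have hm : ∑ i, a i • X i x ∈ S.D.fiber x :=
    sum_mem fun i _ => Submodule.smul_mem _ _ (h i)
  have e : (⟨∑ i, a i • X i x, hm⟩ : S.D.fiber x) = ∑ i, a i • ⟨X i x, h i⟩ :=
    Subtype.ext (by simp)
  unfold SubRiemannian.hnorm
  rw [dif_pos hm, e]
  congr 1
  simp only [map_sum, map_smul, LinearMap.sum_apply, LinearMap.smul_apply, hg, smul_eq_mul]
  simp [sq]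

theorem OrthonormalOn.abs_mfderivAlong_le {S : SubRiemannian n m M} {O : Set M}
    {X : Fin m → VField n M} (hX : OrthonormalOn S O X) {x : M} (hx : x ∈ O)
    (hspan : Submodule.span ℝ (range fun i => X i x) = S.D.fiber x) (f : M → ℝ)
    {v : TangentSpace (𝓡 n) x} (hv : v ∈ S.D.fiber x) :
    |mfderivAlong f x v| ≤ (∑ i, |mfderivAlong f x (X i x)|) * S.hnorm x v := by
  rw [← hspan, Submodule.mem_span_range_iff_exists_fun] at hv
  obtain ⟨a, rfl⟩ := hv
  rw [hX.hnorm_sum hx, mfderivAlong_sum, Finset.sum_mul]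
  refine (Finset.abs_sum_le_sum_abs _ _).trans (Finset.sum_le_sum fun i _ => ?_)
  rw [abs_mul, mul_comm]
  gcongr
  rw [← Real.sqrt_sq_eq_abs]
  exact Real.sqrt_le_sqrt (Finset.single_le_sum (f := fun i => a i ^ 2)
    (fun i _ => sq_nonneg _) (Finset.mem_univ i))

variable {S}

/-- On the domain of an orthonormal family the derivatives of `f` along its members are continuous,
hence locally bounded. The compact support of `f` gives one constant, and `f` has zero derivative
elsewhere. -/
theorem SubRiemannian.IsRegular.exists_abs_mfderivAlong_le (hS : S.IsRegular) {f : M → ℝ}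
    (hf : ContMDiff (𝓡 n) 𝓘(ℝ, ℝ) ∞ f) (hfc : HasCompactSupport f) :
    ∃ C : ℝ, 0 ≤ C ∧ ∀ x, ∀ v ∈ S.D.fiber x, |mfderivAlong f x v| ≤ C * S.hnorm x v := by
  obtain ⟨k, ν, h⟩ := hS
  have hnn := S.hnorm_nonneg
  have key : ∃ C : ℝ, 0 ≤ C ∧ ∀ x ∈ tsupport f, ∀ v ∈ S.D.fiber x,
      |mfderivAlong f x v| ≤ C * S.hnorm x v := by
    refine hfc.isCompact.induction_on
      (p := fun K => ∃ C : ℝ, 0 ≤ C ∧ ∀ x ∈ K, ∀ v ∈ S.D.fiber x,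
        |mfderivAlong f x v| ≤ C * S.hnorm x v) ?_ ?_ ?_ ?_
    · exact ⟨0, le_rfl, fun x hx => hx.elim⟩
    · rintro s t hst ⟨C, hC, h⟩
      exact ⟨C, hC, fun x hx => h x (hst hx)⟩
    · rintro s t ⟨C, hC, h⟩ ⟨C', hC', h'⟩
      refine ⟨max C C', le_max_of_le_left hC, fun x hx v hv => ?_⟩
      rcases hx with hx | hx
      · exact (h x hx v hv).trans (mul_le_mul_of_nonneg_right (le_max_left _ _) (hnn _ _))
      · exact (h' x hx v hv).trans (mul_le_mul_of_nonneg_right (le_max_right _ _) (hnn _ _))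
    · intro x _
      obtain ⟨O, hO, hx, ⟨X, hXo, hXs, hXc⟩, -⟩ := h x
      have hcont : ContinuousAt (fun y => ∑ i, |mfderivAlong f y (X i y)|) x := by
        have : ContinuousOn (fun y => ∑ i, |mfderivAlong f y (X i y)|) O :=
          continuousOn_finsetSum _ fun i _ => ((hXs i).continuousOn_mfderivAlong hf).abs
        exact this.continuousAt (hO.mem_nhds hx)
      have hev := hcont.eventually_lt_const (lt_add_one _)
      refine ⟨_, mem_nhdsWithin_of_mem_nhds (inter_mem hev (hO.mem_nhds hx)),
        (∑ i, |mfderivAlong f x (X i x)|) + 1, by positivity, fun y hy v hv => ?_⟩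
      refine (hXo.abs_mfderivAlong_le hy.2 (hXc y hy.2).1 f hv).trans ?_
      exact mul_le_mul_of_nonneg_right (le_of_lt hy.1) (hnn _ _)
  obtain ⟨C, hC, h⟩ := key
  refine ⟨C, hC, fun x v hv => ?_⟩
  by_cases hx : x ∈ tsupport f
  · exact h x hx v hv
  · have : f =ᶠ[𝓝 x] fun _ => 0 := notMem_tsupport_iff_eventuallyEq.1 hx
    have h0 : mfderivAlong f x v = 0 := by
      unfold mfderivAlong
      have h1 := this.mfderiv_eq (I := 𝓡 n) (I' := 𝓘(ℝ, ℝ))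
      rw [mfderiv_const] at h1
      exact congrArg (fun D : EuclideanSpace ℝ (Fin n) →L[ℝ] ℝ => D v) h1
    rw [h0, abs_zero]
    exact mul_nonneg hC (hnn _ _)

theorem SubRiemannian.ofReal_abs_sub_le_length {f : M → ℝ}
    (hf : ContMDiff (𝓡 n) 𝓘(ℝ, ℝ) ∞ f) {C : ℝ} (hC : 0 ≤ C)
    (h : ∀ x, ∀ v ∈ S.D.fiber x, |mfderivAlong f x v| ≤ C * S.hnorm x v) {c : ℝ → M} {a b : ℝ}
    (hc : IsHorizontal S.D c a b) :
    ENNReal.ofReal |f (c a) - f (c b)| ≤ ENNReal.ofReal C * S.length c a b := by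
  have h1 := (hc.2.2.1 f hf).integral_deriv_eq_sub
  rw [intervalIntegral.integral_of_le hc.1, ← integral_Icc_eq_integral_Ioc] at h1
  simp only [Function.comp_apply] at h1
  rw [abs_sub_comm, ← h1, ← Real.enorm_eq_ofReal_abs]
  refine (enorm_integral_le_lintegral_enorm _).trans ?_
  unfold SubRiemannian.length
  rw [← lintegral_const_mul' _ _ ENNReal.ofReal_ne_top]
  refine lintegral_mono_ae ?_
  filter_upwards [hc.2.2.2] with t ht
  rw [(hasDerivAt_comp_velocity hf ht.1).deriv, Real.enorm_eq_ofReal_abs, ← ENNReal.ofReal_mul hC]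
  exact ENNReal.ofReal_le_ofReal (h _ _ ht.2)

theorem SubRiemannian.IsRegular.exists_abs_sub_le_ccEDist (hS : S.IsRegular) {f : M → ℝ}
    (hf : ContMDiff (𝓡 n) 𝓘(ℝ, ℝ) ∞ f) (hfc : HasCompactSupport f) :
    ∃ C : ℝ, 0 < C ∧ ∀ x y, ENNReal.ofReal |f x - f y| ≤ ENNReal.ofReal C * S.ccEDist x y := by
  obtain ⟨C, hC, h⟩ := hS.exists_abs_mfderivAlong_le hf hfc
  have hC1 : 0 < C + 1 := by linarith
  have h' : ∀ x, ∀ v ∈ S.D.fiber x, |mfderivAlong f x v| ≤ (C + 1) * S.hnorm x v := by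
    intro x v hv
    linarith [h x v hv, S.hnorm_nonneg x v]
  refine ⟨C + 1, hC1, fun x y => ?_⟩
  have h0 : ENNReal.ofReal (C + 1) ≠ 0 := by simpa using hC1
  rw [mul_comm, ← ENNReal.div_le_iff h0 ENNReal.ofReal_ne_top]
  refine le_iInf fun c => le_iInf fun a => le_iInf fun b => le_iInf fun hc => ?_
  rw [ENNReal.div_le_iff h0 ENNReal.ofReal_ne_top, mul_comm]
  rw [← hc.2.1, ← hc.2.2]
  exact ofReal_abs_sub_le_length hf hC1.le h' hc.1

/-- A bump function supported in `N` drops from 1 at `x` to 0 outside `N`. Being `C`-Lipschitz for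
the distance, it keeps points outside `N` at distance at least `C⁻¹` from `x`. -/
theorem SubRiemannian.IsRegular.exists_mem_of_ccEDist_lt [T2Space M] (hS : S.IsRegular) {x : M}
    {N : Set M} (hN : N ∈ 𝓝 x) :
    ∃ r : ℝ, 0 < r ∧ ∀ y, S.ccEDist y x < ENNReal.ofReal r → y ∈ N := by
  obtain ⟨f, -, hf⟩ := (SmoothBumpFunction.nhds_basis_support (I := 𝓡 n) (c := x) hN).mem_iff.1 hN
  obtain ⟨C, hC, h⟩ := hS.exists_abs_sub_le_ccEDist f.contMDiff f.hasCompactSupport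
  refine ⟨C⁻¹, inv_pos.2 hC, fun y hy => ?_⟩
  by_contra hyN
  have hy0 : f y = 0 := by
    by_contra h0
    exact hyN (hf h0)
  have h1 := h y x
  rw [hy0, f.eq_one] at h1
  have h2 : ENNReal.ofReal C * S.ccEDist y x < ENNReal.ofReal C * ENNReal.ofReal C⁻¹ :=
    ENNReal.mul_lt_mul_right (by simpa using hC) ENNReal.ofReal_ne_top hy
  rw [← ENNReal.ofReal_mul hC.le, mul_inv_cancel₀ hC.ne'] at h2
  simp at h1 h2
  exact absurd h1 (not_le.2 h2)

end CCLower

/-! ### Nearby points are joined by short horizontal curves -/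

section CCUpper

variable {n m : ℕ} {M : Type*} [TopologicalSpace M] [ChartedSpace (EuclideanSpace ℝ (Fin n)) M]
  [IsManifold (𝓡 n) ∞ M] {S : SubRiemannian n m M} {x₀ : M} {O : Set M} {X : Fin m → VField n M}
  {Y : Fin m → SmoothMaps (EuclideanSpace ℝ (Fin n))} {r : ℝ}

theorem OrthonormalOn.hnorm_smul (hX : OrthonormalOn S O X) {x : M} (hx : x ∈ O) (i : Fin m)
    (σ : ℝ) : S.hnorm x (σ • X i x) = |σ| := by
  have h := hX.hnorm_sum hx (Pi.single i σ)
  have e1 : ∑ j, (Pi.single i σ : Fin m → ℝ) j • X j x = σ • X i x := by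
    rw [Finset.sum_eq_single i]
    · rw [Pi.single_eq_same]
    · intro j _ hj
      rw [Pi.single_eq_of_ne hj, zero_smul]
    · simp
  have e2 : ∑ j, (Pi.single i σ : Fin m → ℝ) j ^ 2 = σ ^ 2 := by
    rw [Finset.sum_eq_single i]
    · rw [Pi.single_eq_same]
    · intro j _ hj
      rw [Pi.single_eq_of_ne hj]
      simp
    · simp
  rw [e1, e2, Real.sqrt_sq_eq_abs] at h
  exact h

theorem IsChartModel.exists_velocity_eq (h : IsChartModel x₀ O X Y r)
    {c : ℝ → EuclideanSpace ℝ (Fin n)} {t : ℝ}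
    (hc : c t ∈ Metric.ball (extChartAt (𝓡 n) x₀ x₀) r) {i : Fin m} {σ : ℝ}
    (hd : HasDerivAt c (σ • (Y i).1 (c t)) t) :
    MDifferentiableAt 𝓘(ℝ, ℝ) (𝓡 n) (fun s => (extChartAt (𝓡 n) x₀).symm (c s)) t ∧
      velocity n (fun s => (extChartAt (𝓡 n) x₀).symm (c s)) t =
        σ • X i ((extChartAt (𝓡 n) x₀).symm (c t)) := by
  have h1 := hasMFDerivAt_extChartAt_symm_comp hd (h.subset_target hc)
  refine ⟨h1.mdifferentiableAt, ?_⟩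
  unfold velocity
  rw [h1.mfderiv, ← h.mfderiv_apply hc i]
  let L : EuclideanSpace ℝ (Fin n) →L[ℝ] EuclideanSpace ℝ (Fin n) :=
    mfderiv 𝓘(ℝ, EuclideanSpace ℝ (Fin n)) (𝓡 n) (extChartAt (𝓡 n) x₀).symm (c t)
  have h2 : ((1 : ℝ →L[ℝ] ℝ).smulRight (L (σ • (Y i).1 (c t)))) 1 = σ • L ((Y i).1 (c t)) := by
    simp
  exact h2

theorem IsReachCurve.isHorizontal (h : IsChartModel x₀ O X Y r) (hX : OrthonormalOn S O X)
    {B : NNReal} {c : ℝ → EuclideanSpace ℝ (Fin n)} {T : ℝ} {z z' : EuclideanSpace ℝ (Fin n)}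
    (hc : IsReachCurve (fun i => (Y i).1) B c T z z') {r' : ℝ} (hr' : r' < r)
    (hball : ∀ t ∈ Icc 0 T, c t ∈ Metric.closedBall (extChartAt (𝓡 n) x₀ x₀) r') :
    IsHorizontal S.D (fun s => (extChartAt (𝓡 n) x₀).symm (c s)) 0 T ∧
      S.length (fun s => (extChartAt (𝓡 n) x₀).symm (c s)) 0 T ≤ ENNReal.ofReal T := by
  have hsub : Metric.closedBall (extChartAt (𝓡 n) x₀ x₀) r' ⊆
      Metric.ball (extChartAt (𝓡 n) x₀ x₀) r := Metric.closedBall_subset_ball hr'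
  obtain ⟨s, hs, hd⟩ := hc.deriv
  have hae : ∀ᵐ t ∂(volume.restrict (Icc 0 T)),
      c t ∈ Metric.ball (extChartAt (𝓡 n) x₀ x₀) r ∧
        ∃ (i : Fin m) (σ : ℝ), |σ| ≤ 1 ∧ HasDerivAt c (σ • (Y i).1 (c t)) t := by
    rw [ae_restrict_iff' measurableSet_Icc]
    have h5 : ∀ᵐ t : ℝ, t ∉ insert 0 (insert T s) :=
      ((hs.insert T).insert 0).ae_notMem volume
    filter_upwards [h5] with t ht htI
    simp only [mem_insert_iff, not_or] at ht
    exact ⟨hsub (hball t htI), hd t ⟨lt_of_le_of_ne htI.1 (Ne.symm ht.1),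
      lt_of_le_of_ne htI.2 ht.2.1⟩ ht.2.2⟩
  refine ⟨⟨hc.nonneg, ?_, fun f hf => ?_, ?_⟩, ?_⟩
  · exact (continuousOn_extChartAt_symm x₀).comp hc.lipschitz.continuous.continuousOn
      fun t ht => h.subset_target (hsub (hball t ht))
  · have h1 : ContDiffOn ℝ 1 (fun z => f ((extChartAt (𝓡 n) x₀).symm z))
        (Metric.closedBall (extChartAt (𝓡 n) x₀ x₀) r') := by
      rw [← contMDiffOn_iff_contDiffOn]
      exact ((hf.comp_contMDiffOn (contMDiffOn_extChartAt_symm (n := ∞) x₀)).mono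
        (hsub.trans h.subset_target)).of_le (by simp)
    obtain ⟨K, hK⟩ := h1.exists_lipschitzOnWith (by simp) (convex_closedBall _ _)
      (isCompact_closedBall _ _)
    have h2 := hK.comp (hc.lipschitz.lipschitzOnWith (s := Icc 0 T)) hball
    rw [← uIcc_of_le hc.nonneg] at h2
    exact h2.absolutelyContinuousOnInterval
  · filter_upwards [hae] with t ht
    obtain ⟨hb, i, σ, -, hder⟩ := ht
    obtain ⟨h1, h2⟩ := h.exists_velocity_eq hb hder
    refine ⟨h1, ?_⟩
    rw [h2]
    exact Submodule.smul_mem _ _ ((hX _ (h.symm_mem _ hb)).1 i)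
  · have : ENNReal.ofReal T = ∫⁻ t in Icc 0 T, 1 := by simp
    rw [this]
    refine lintegral_mono_ae ?_
    filter_upwards [hae] with t ht
    obtain ⟨hb, i, σ, hσ, hder⟩ := ht
    rw [(h.exists_velocity_eq hb hder).2, hX.hnorm_smul (h.symm_mem _ hb)]
    simpa using hσ

theorem ChowCondition.span_wordField_eq_top {k : ℕ} (hO : IsOpen O) (hx₀ : x₀ ∈ O)
    (hX : ChowCondition S.D O k X) (h : IsChartModel x₀ O X Y r) :
    Submodule.span ℝ {v | ∃ w : List (Fin m), w.length ≤ k ∧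
      v = (wordField Y w).1 (extChartAt (𝓡 n) x₀ x₀)} = ⊤ := by
  obtain ⟨z₀, hz₀⟩ : ∃ z₀, z₀ = extChartAt (𝓡 n) x₀ x₀ := ⟨_, rfl⟩
  have hx : (extChartAt (𝓡 n) x₀).symm z₀ = x₀ := by rw [hz₀]; exact extChartAt_to_inv x₀
  have hzt : z₀ ∈ (extChartAt (𝓡 n) x₀).target := hz₀ ▸ mem_extChartAt_target x₀
  have hw : ∀ w, (wordField Y w).1 z₀ = chartField x₀ (wordBracket X w) z₀ := fun w =>
    h.wordField_eq hO hX.1 w (hz₀ ▸ Metric.mem_ball_self h.pos)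
  let L : EuclideanSpace ℝ (Fin n) →L[ℝ] EuclideanSpace ℝ (Fin n) :=
    mfderiv 𝓘(ℝ, EuclideanSpace ℝ (Fin n)) (𝓡 n) (extChartAt (𝓡 n) x₀).symm z₀
  have hL : L.IsInvertible := isInvertible_mfderiv_extChartAt_symm hzt
  obtain ⟨e, he⟩ := hL
  have hLw : ∀ w, L ((wordField Y w).1 z₀) = wordBracket X w ((extChartAt (𝓡 n) x₀).symm z₀) :=
    fun w => by
      rw [hw]
      exact mfderiv_extChartAt_symm_chartField hzt _
  have hspan := (hX.2 x₀ hx₀).2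
  rw [← hx] at hspan
  rw [← hz₀]
  let e' : EuclideanSpace ℝ (Fin n) ≃ₗ[ℝ] EuclideanSpace ℝ (Fin n) := e.toLinearEquiv
  have hmap : (Submodule.span ℝ {v | ∃ w : List (Fin m), w.length ≤ k ∧
      v = (wordField Y w).1 z₀}).map e'.toLinearMap = ⊤ := by
    rw [Submodule.map_span]
    refine Eq.trans (congrArg _ ?_) hspan
    ext v
    constructor
    · rintro ⟨_, ⟨w, hwk, rfl⟩, rfl⟩
      refine ⟨w, hwk, ?_⟩
      rw [← hLw, ← he]
      rfl
    · rintro ⟨w, hwk, rfl⟩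
      refine ⟨_, ⟨w, hwk, rfl⟩, ?_⟩
      rw [← hLw, ← he]
      rfl
  have htop : (⊤ : Submodule ℝ (EuclideanSpace ℝ (Fin n))).map e'.toLinearMap = ⊤ :=
    Submodule.map_top _ |>.trans (LinearEquiv.range e')
  exact Submodule.map_injective_of_injective e'.injective (hmap.trans htop.symm)

/-- In the chart, `y` is reached in a time at most `C ‖·‖^κ`, which tends to 0. The Lipschitz bound
keeps the curve in the ball where the model is faithful, and there its length is at most the time
because the fields are orthonormal. -/
theorem SubRiemannian.IsRegular.eventually_ccEDist_lt (hS : S.IsRegular) (x₀ : M) {η : ℝ≥0∞}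
    (hη : 0 < η) : ∀ᶠ y in 𝓝 x₀, S.ccEDist x₀ y < η := by
  obtain ⟨k, ν, hS⟩ := hS
  obtain ⟨O, hO, hx₀, ⟨X, hXo, hXc⟩, -⟩ := hS x₀
  obtain ⟨Y, r, h⟩ := exists_isChartModel hO hx₀ hXc.1
  obtain ⟨K, B, -, hB⟩ := exists_lipschitz_bound h.hasCompactSupport
  obtain ⟨r', hr', C, κ, hκ, hreach⟩ := exists_reach_of_span h.hasCompactSupport hB
    (hXc.span_wordField_eq_top hO hx₀ h)
  have hφ : ContinuousAt (extChartAt (𝓡 n) x₀) x₀ := continuousAt_extChartAt x₀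
  have hlim : Tendsto (fun y => C * ‖extChartAt (𝓡 n) x₀ x₀ - extChartAt (𝓡 n) x₀ y‖ ^ κ) (𝓝 x₀)
      (𝓝 0) := by
    have h1 : Tendsto (fun y => ‖extChartAt (𝓡 n) x₀ x₀ - extChartAt (𝓡 n) x₀ y‖) (𝓝 x₀) (𝓝 0) := by
      have := (tendsto_const_nhds (x := extChartAt (𝓡 n) x₀ x₀)).sub hφ.tendsto
      simpa using this.norm
    have h2 := (h1.rpow_const (Or.inr hκ.le)).const_mul C
    rwa [Real.zero_rpow hκ.ne', mul_zero] at h2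
  have hlim₁ : ∀ᶠ y in 𝓝 x₀, ENNReal.ofReal
      (C * ‖extChartAt (𝓡 n) x₀ x₀ - extChartAt (𝓡 n) x₀ y‖ ^ κ) < η := by
    have := (ENNReal.continuous_ofReal.tendsto 0).comp hlim
    rw [ENNReal.ofReal_zero] at this
    exact this.eventually_lt_const hη
  have hlim₂ : ∀ᶠ y in 𝓝 x₀, B *
      (C * ‖extChartAt (𝓡 n) x₀ x₀ - extChartAt (𝓡 n) x₀ y‖ ^ κ) < r / 2 := by
    have := hlim.const_mul (B : ℝ)
    rw [mul_zero] at this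
    exact this.eventually_lt_const (half_pos h.pos)
  filter_upwards [hlim₁, hlim₂, hφ.tendsto (Metric.ball_mem_nhds _ hr'),
    extChartAt_source_mem_nhds (I := 𝓡 n) x₀] with y h₁ h₂ h₃ h₄
  obtain ⟨T, hT, c, hc⟩ := hreach _ (Metric.mem_ball_self hr') _ h₃
  have hball : ∀ t ∈ Icc 0 T, c t ∈ Metric.closedBall (extChartAt (𝓡 n) x₀ x₀) (r / 2) := by
    intro t ht
    have h5 := hc.lipschitz.dist_le_mul t 0
    rw [hc.left 0 le_rfl, Real.dist_eq, sub_zero, abs_of_nonneg ht.1] at h5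
    exact (h5.trans (mul_le_mul_of_nonneg_left (ht.2.trans hT) B.2)).trans h₂.le
  obtain ⟨h6, h7⟩ := hc.isHorizontal h hXo (half_lt_self h.pos) hball
  have h8 := S.ccEDist_le h6
  rw [hc.left 0 le_rfl, hc.right T le_rfl, extChartAt_to_inv, (extChartAt (𝓡 n) x₀).left_inv h₄]
    at h8
  exact (h8.trans (h7.trans (ENNReal.ofReal_le_ofReal hT))).trans_lt h₁

/-- Distances are finite locally, so by the triangle inequality the points at finite distance from
`x` form a clopen set. -/
theorem SubRiemannian.IsRegular.ccEDist_lt_top [ConnectedSpace M] (hS : S.IsRegular) (x y : M) :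
    S.ccEDist x y < ⊤ := by
  have key : ∀ z, ∀ᶠ w in 𝓝 z, (S.ccEDist x w < ⊤ ↔ S.ccEDist x z < ⊤) := by
    intro z
    filter_upwards [hS.eventually_ccEDist_lt z ENNReal.zero_lt_top] with w hw
    constructor
    · intro h
      exact (S.ccEDist_triangle x w z).trans_lt (ENNReal.add_lt_top.2 ⟨h, S.ccEDist_comm w z ▸ hw⟩)
    · intro h
      exact (S.ccEDist_triangle x z w).trans_lt (ENNReal.add_lt_top.2 ⟨h, hw⟩)
  have hclopen : IsClopen {w | S.ccEDist x w < ⊤} := by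
    constructor
    · rw [← isOpen_compl_iff, isOpen_iff_mem_nhds]
      intro z hz
      filter_upwards [key z] with w hw h
      exact hz (hw.1 h)
    · rw [isOpen_iff_mem_nhds]
      intro z hz
      filter_upwards [key z] with w hw
      exact hw.2 hz
  have h := hclopen.eq_univ ⟨x, by rw [mem_ofPred_eq, S.ccEDist_self]; exact ENNReal.zero_lt_top⟩
  have hy : y ∈ {w | S.ccEDist x w < ⊤} := h ▸ mem_univ y
  exact hy

end CCUpper

/-! ## Infinitesimal limits of exponential coordinates -/

section Limits

/-- The uniform limit inherits continuity at `z`, and this upgrades uniform convergence to joint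
convergence. -/
theorem TendstoUniformlyOn.tendsto_prod_nhds {ι Z T : Type*} [TopologicalSpace Z]
    [PseudoMetricSpace T] {l : Filter ι} [l.NeBot] {f : ι → Z → T} {g : Z → T} {s : Set Z} {z : Z}
    (hu : TendstoUniformlyOn f g l s) (hs : s ∈ 𝓝 z) (hc : ∀ᶠ ε in l, ContinuousAt (f ε) z) :
    Tendsto (fun p : ι × Z => f p.1 p.2) (l ×ˢ 𝓝 z) (𝓝 (g z)) := by
  have hg : ContinuousAt g z := by
    refine continuousAt_of_locally_uniform_approx_of_continuousAt fun u hu' => ?_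
    obtain ⟨ε, h1, h2⟩ := ((hu u hu').and hc).exists
    exact ⟨s, hs, f ε, h2, h1⟩
  rw [Metric.tendsto_nhds]
  intro η hη
  rw [Metric.tendstoUniformlyOn_iff] at hu
  have h1 := (hu (η / 2) (half_pos hη)).prod_mk
    ((Metric.tendsto_nhds.1 hg.tendsto (η / 2) (half_pos hη)).and hs)
  filter_upwards [h1] with p hp
  have h2 := hp.1 p.2 hp.2.2
  rw [dist_comm] at h2
  linarith [dist_triangle (f p.1 p.2) (g p.2) (g z), hp.2.1]

theorem tendsto_div_prodMk_nhds {Z Z' : Type*} [TopologicalSpace Z] [TopologicalSpace Z']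
    {g : Z → Z'} (hg : Continuous g) {r : ℝ} (hr : 0 < r) (z : Z) :
    Tendsto (fun p : ℝ × Z => (p.1 / r, g p.2)) (𝓝[>] 0 ×ˢ 𝓝 z) (𝓝[>] 0 ×ˢ 𝓝 (g z)) := by
  refine Tendsto.prodMk ?_ ((hg.tendsto z).comp tendsto_snd)
  refine Tendsto.comp (g := fun ε : ℝ => ε / r) (y := 𝓝[>] (0 : ℝ)) ?_ tendsto_fst
  refine tendsto_nhdsWithin_iff.2 ⟨?_, ?_⟩
  · have : Tendsto (fun ε : ℝ => ε / r) (𝓝 0) (𝓝 (0 / r)) := tendsto_id.div_const r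
    rw [zero_div] at this
    exact this.mono_left nhdsWithin_le_nhds
  · filter_upwards [self_mem_nhdsWithin] with ε hε
    exact div_pos hε hr

/-- Local coordinates `E x`, with inverse `L x`, that parametrize a relation `R`. -/
structure IsLocalExp {Y V : Type*} [TopologicalSpace Y] [TopologicalSpace V] [Zero V]
    (R : V → Y → Y → Prop) (E : Y → V → Y) (L : Y → Y → V) : Prop where
  E_zero : ∀ x, E x 0 = x
  L_self : ∀ x, L x x = 0
  E_good : ∀ x₀, ∀ᶠ p : Y × V in 𝓝 (x₀, 0),
    ContinuousAt (fun q : Y × V => E q.1 q.2) p ∧ L p.1 (E p.1 p.2) = p.2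
  L_good : ∀ x₀, ∀ᶠ p : Y × Y in 𝓝 (x₀, x₀),
    ContinuousAt (fun q : Y × Y => L q.1 q.2) p ∧ E p.1 (L p.1 p.2) = p.2
  rel_iff : ∀ x₀, ∀ᶠ p : Y × V in 𝓝 (x₀, 0), ∀ y, R p.2 p.1 y ↔ y = E p.1 p.2

variable {Y : Type*} [MetricSpace Y] {n : ℕ} {deg : Fin n → ℕ}
  {R : (Fin n → ℝ) → Y → Y → Prop} {E : Y → (Fin n → ℝ) → Y} {L : Y → Y → Fin n → ℝ}

theorem exists_nhds_eventually_weightedDil_mem (hdeg : ∀ i, 0 < deg i) {x : Y}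
    {S : Set (Y × (Fin n → ℝ))} (hS : S ∈ 𝓝 (x, 0)) {W : Set (Fin n → ℝ)}
    (hW : Bornology.IsBounded W) :
    ∃ N ∈ 𝓝 x, ∀ᶠ ε in 𝓝[>] (0 : ℝ), ∀ y ∈ N, ∀ a ∈ W, (y, weightedDil deg ε a) ∈ S := by
  obtain ⟨N, hN, B, hB, hNB⟩ := mem_nhds_prod_iff.1 hS
  obtain ⟨s, hs, hsB⟩ := Metric.mem_nhds_iff.1 hB
  obtain ⟨C, hC⟩ := hW.exists_norm_le
  refine ⟨N, hN, ?_⟩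
  have h1 : ∀ᶠ ε in 𝓝[>] (0 : ℝ), ε ∈ Ioo 0 (min 1 (s / (|C| + 1))) :=
    Ioo_mem_nhdsGT (by positivity)
  filter_upwards [h1] with ε hε y hy a ha
  refine hNB ⟨hy, hsB ?_⟩
  have h2 := lt_min_iff.1 hε.2
  rw [mem_ball_zero_iff]
  refine (norm_weightedDil_le hdeg hε.1.le h2.1.le a).trans_lt ?_
  have h3 := (hC a ha).trans (le_abs_self C)
  calc ε * ‖a‖ ≤ ε * (|C| + 1) := mul_le_mul_of_nonneg_left (by linarith) hε.1.le
    _ < s := (lt_div_iff₀ (by positivity)).1 h2.2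

/-- Condition (a) of a normal frame gives the joint limit for vectors in the interior of `W`. An
arbitrary `a` is dilated into it by some `r`, and `ε` is replaced by `ε / r`. -/
theorem IsLocalExp.exists_tendsto_dist [LocallyCompactSpace Y] (h : IsLocalExp R E L)
    (hdeg : ∀ i, 0 < deg i) {W : Set (Fin n → ℝ)} (hWc : IsCompact W) (hW : W ∈ 𝓝 0)
    {A : Y → (Fin n → ℝ) → ℝ} (hA : ∀ y, ∀ a ∈ W, a ≠ 0 → 0 < A y a)
    (hlim : ∀ K : Set Y, IsCompact K → ∀ η > 0, ∃ ε₀ > 0, ∀ ε ∈ Ioo (0 : ℝ) ε₀, ∀ y ∈ K, ∀ a ∈ W,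
      ∃ z, R (weightedDil deg ε a) y z ∧ |1 / ε * dist z y - A y a| < η)
    (x : Y) (a : Fin n → ℝ) : ∃ v, Tendsto
      (fun p : ℝ × Y × (Fin n → ℝ) => p.1⁻¹ * dist (E p.2.1 (weightedDil deg p.1 p.2.2)) p.2.1)
      (𝓝[>] 0 ×ˢ 𝓝 (x, a)) (𝓝 v) ∧ (a ≠ 0 → 0 < v) := by
  obtain ⟨N, hN, hNε⟩ := exists_nhds_eventually_weightedDil_mem hdeg
    ((h.E_good x).and (h.rel_iff x)) hWc.isBounded
  obtain ⟨K, hK, hKN, hKc⟩ := LocallyCompactSpace.local_compact_nhds x N hN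
  have hu : TendstoUniformlyOn (fun (ε : ℝ) (q : Y × (Fin n → ℝ)) =>
      ε⁻¹ * dist (E q.1 (weightedDil deg ε q.2)) q.1) (fun q => A q.1 q.2) (𝓝[>] 0) (K ×ˢ W) := by
    rw [Metric.tendstoUniformlyOn_iff]
    intro η hη
    obtain ⟨ε₀, hε₀, hlim⟩ := hlim K hKc η hη
    filter_upwards [hNε, Ioo_mem_nhdsGT hε₀] with ε h1 h2 q hq
    obtain ⟨z, hz, hlt⟩ := hlim ε h2 q.1 hq.1 q.2 hq.2
    rw [((h1 q.1 (hKN hq.1) q.2 hq.2).2 z).1 hz, one_div] at hlt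
    rwa [dist_comm, Real.dist_eq]
  have key : ∀ a ∈ interior W, Tendsto
      (fun p : ℝ × Y × (Fin n → ℝ) => p.1⁻¹ * dist (E p.2.1 (weightedDil deg p.1 p.2.2)) p.2.1)
      (𝓝[>] 0 ×ˢ 𝓝 (x, a)) (𝓝 (A x a)) := by
    intro a ha
    refine hu.tendsto_prod_nhds (z := (x, a))
      (prod_mem_nhds hK (mem_interior_iff_mem_nhds.1 ha)) ?_
    filter_upwards [hNε] with ε h1
    have h2 := (h1 x (hKN (mem_of_mem_nhds hK)) a (interior_subset ha)).1.1
    have h3 : ContinuousAt (fun q : Y × (Fin n → ℝ) => E q.1 (weightedDil deg ε q.2)) (x, a) :=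
      ContinuousAt.comp (g := fun q : Y × (Fin n → ℝ) => E q.1 q.2)
        (f := fun q : Y × (Fin n → ℝ) => (q.1, weightedDil deg ε q.2)) h2
        (continuous_fst.prodMk ((continuous_weightedDil_right deg ε).comp
          continuous_snd)).continuousAt
    exact continuousAt_const.mul (h3.dist continuousAt_fst)
  have h0 : Tendsto (fun r : ℝ => weightedDil deg r a) (𝓝[>] 0) (𝓝 0) :=
    (tendsto_weightedDil_zero hdeg a).comp (tendsto_id.prodMk tendsto_const_nhds)
  obtain ⟨r, hr, hr0⟩ := ((h0.eventually (interior_mem_nhds.2 hW)).and self_mem_nhdsWithin).exists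
  have hr0 : 0 < r := hr0
  refine ⟨r⁻¹ * A x (weightedDil deg r a), ?_, fun ha => ?_⟩
  · have h1 := ((key _ hr).comp (tendsto_div_prodMk_nhds (g := fun q : Y × (Fin n → ℝ) =>
      (q.1, weightedDil deg r q.2)) (continuous_fst.prodMk
        ((continuous_weightedDil_right deg r).comp continuous_snd)) hr0 (x, a))).const_mul r⁻¹
    refine h1.congr fun p => ?_
    simp only [Function.comp_apply, weightedDil_mul, div_mul_cancel₀ _ hr0.ne', inv_div]
    rw [← mul_assoc]
    congr 1
    field_simp
  · refine mul_pos (inv_pos.2 hr0) (hA x _ (interior_subset hr) fun h2 => ha ?_)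
    rw [← weightedDil_inv_self hr0.ne' (deg := deg) a, h2, weightedDil_zero_right]

/-- A family of solutions of `R (P a b x) (E x b) (E x a)` that is asymptotically homogeneous
consists of the small solutions. -/
theorem IsLocalExp.exists_eq_of_asymptotically_homogeneous (h : IsLocalExp R E L)
    (hdeg : ∀ i, 0 < deg i) {x₀ : Y} {K : Set Y} (hK : K ∈ 𝓝 x₀) {W : Set (Fin n → ℝ)}
    (hW : W ∈ 𝓝 0) {P Q : (Fin n → ℝ) → (Fin n → ℝ) → Y → Fin n → ℝ}
    (hP : ∀ x ∈ K, ∀ a ∈ W, ∀ b ∈ W, ∃ z w, R a x z ∧ R b x w ∧ R (P a b x) w z)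
    (hlim : ∃ ε₀ > 0, ∀ ε ∈ Ioo (0 : ℝ) ε₀, ∀ x ∈ K, ∀ a ∈ W, ∀ b ∈ W, ∀ i,
      |(ε ^ deg i)⁻¹ * P (weightedDil deg ε a) (weightedDil deg ε b) x i - Q a b x i| < 1) :
    ∃ K' ∈ 𝓝 x₀, K' ⊆ K ∧ ∃ t > 0, ∃ ε₀ > 0, Metric.ball 0 t ⊆ W ∧
      ∀ x ∈ K', ∀ a ∈ Metric.ball 0 t, ∀ b ∈ Metric.ball 0 t,
        ContinuousAt (fun q : Y × (Fin n → ℝ) × (Fin n → ℝ) => L (E q.1 q.2.2) (E q.1 q.2.1))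
          (x, a, b) ∧
        ∀ ε ∈ Ioo 0 ε₀, P (weightedDil deg ε a) (weightedDil deg ε b) x =
          L (E x (weightedDil deg ε b)) (E x (weightedDil deg ε a)) := by
  obtain ⟨N, hN, B, hB, hNB⟩ := mem_nhds_prod_iff.1 ((h.E_good x₀).and (h.rel_iff x₀))
  obtain ⟨s, hs, hsB⟩ := Metric.mem_nhds_iff.1 hB
  have hgood : ∀ x ∈ N, ∀ a, ‖a‖ < s → (ContinuousAt (fun q : Y × (Fin n → ℝ) => E q.1 q.2) (x, a)
      ∧ L x (E x a) = a) ∧ ∀ y, R a x y ↔ y = E x a := fun x hx a ha =>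
    hNB (mk_mem_prod hx (hsB (mem_ball_zero_iff.2 ha)))
  have hE₀ : Tendsto (fun q : Y × (Fin n → ℝ) => E q.1 q.2) (𝓝 (x₀, 0)) (𝓝 x₀) := by
    have := (h.E_good x₀).self_of_nhds.1.tendsto
    rwa [h.E_zero] at this
  have hEa : Tendsto (fun q : Y × (Fin n → ℝ) × (Fin n → ℝ) => E q.1 q.2.1) (𝓝 (x₀, 0, 0))
      (𝓝 x₀) := Tendsto.comp (g := fun q : Y × (Fin n → ℝ) => E q.1 q.2)
        (f := fun q : Y × (Fin n → ℝ) × (Fin n → ℝ) => (q.1, q.2.1)) hE₀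
        (Continuous.tendsto' (by fun_prop) _ _ rfl)
  have hEb : Tendsto (fun q : Y × (Fin n → ℝ) × (Fin n → ℝ) => E q.1 q.2.2) (𝓝 (x₀, 0, 0))
      (𝓝 x₀) := Tendsto.comp (g := fun q : Y × (Fin n → ℝ) => E q.1 q.2)
        (f := fun q : Y × (Fin n → ℝ) × (Fin n → ℝ) => (q.1, q.2.2)) hE₀
        (Continuous.tendsto' (by fun_prop) _ _ rfl)
  have hL₀ : Tendsto (fun q : Y × Y => L q.1 q.2) (𝓝 (x₀, x₀)) (𝓝 0) := by
    have := (h.L_good x₀).self_of_nhds.1.tendsto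
    rwa [h.L_self] at this
  have hT : Tendsto (fun q : Y × (Fin n → ℝ) × (Fin n → ℝ) => L (E q.1 q.2.2) (E q.1 q.2.1))
      (𝓝 (x₀, 0, 0)) (𝓝 0) := hL₀.comp (hEb.prodMk_nhds hEa)
  have hev : ∀ᶠ q : Y × (Fin n → ℝ) × (Fin n → ℝ) in 𝓝 (x₀, 0, 0),
      (q.1 ∈ K ∧ q.1 ∈ N ∧ E q.1 q.2.2 ∈ N) ∧ (q.2.1 ∈ W ∧ q.2.2 ∈ W) ∧
      (q.2.1 ∈ Metric.ball 0 s ∧ q.2.2 ∈ Metric.ball 0 s) ∧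
      L (E q.1 q.2.2) (E q.1 q.2.1) ∈ Metric.ball 0 (s / 2) ∧
      ContinuousAt (fun q : Y × Y => L q.1 q.2) (E q.1 q.2.2, E q.1 q.2.1) := by
    have c1 : Tendsto (fun q : Y × (Fin n → ℝ) × (Fin n → ℝ) => q.1) (𝓝 (x₀, 0, 0)) (𝓝 x₀) :=
      continuous_fst.tendsto _
    have c2 : Tendsto (fun q : Y × (Fin n → ℝ) × (Fin n → ℝ) => q.2.1) (𝓝 (x₀, 0, 0)) (𝓝 0) :=
      (by fun_prop : Continuous fun q : Y × (Fin n → ℝ) × (Fin n → ℝ) => q.2.1).tendsto _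
    have c3 : Tendsto (fun q : Y × (Fin n → ℝ) × (Fin n → ℝ) => q.2.2) (𝓝 (x₀, 0, 0)) (𝓝 0) :=
      (by fun_prop : Continuous fun q : Y × (Fin n → ℝ) × (Fin n → ℝ) => q.2.2).tendsto _
    filter_upwards [c1 hK, c1 hN, hEb hN, c2 hW, c3 hW, c2 (Metric.ball_mem_nhds 0 hs),
      c3 (Metric.ball_mem_nhds 0 hs), hT (Metric.ball_mem_nhds 0 (half_pos hs)),
      (hEb.prodMk_nhds hEa).eventually ((h.L_good x₀).mono fun _ h => h.1)]
      with q h1 h2 h3 h4 h5 h6 h7 h8 h9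
    exact ⟨⟨h1, h2, h3⟩, ⟨h4, h5⟩, ⟨h6, h7⟩, h8, h9⟩
  obtain ⟨K', hK', B', hB', hKB⟩ := mem_nhds_prod_iff.1 hev
  obtain ⟨t, ht, htB⟩ := Metric.mem_nhds_iff.1 hB'
  have hall : ∀ x ∈ K', ∀ a ∈ Metric.ball (0 : Fin n → ℝ) t, ∀ b ∈ Metric.ball (0 : Fin n → ℝ) t,
      (x ∈ K ∧ x ∈ N ∧ E x b ∈ N) ∧ (a ∈ W ∧ b ∈ W) ∧
      (a ∈ Metric.ball 0 s ∧ b ∈ Metric.ball 0 s) ∧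
      L (E x b) (E x a) ∈ Metric.ball 0 (s / 2) ∧
      ContinuousAt (fun q : Y × Y => L q.1 q.2) (E x b, E x a) := fun x hx a ha b hb => by
    have hab : (a, b) ∈ Metric.ball ((0, 0) : (Fin n → ℝ) × (Fin n → ℝ)) t := by
      rw [← ball_prod_same]
      exact ⟨ha, hb⟩
    exact hKB (mk_mem_prod hx (htB hab))
  have h0t : (0 : Fin n → ℝ) ∈ Metric.ball (0 : Fin n → ℝ) t := Metric.mem_ball_self ht
  -- A gap: a solution of norm below `s` is the logarithm, whose norm is even below `s / 2`. No
  -- solution has norm in `[s/2, s)`.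
  have hbranch : ∀ x ∈ K', ∀ a ∈ Metric.ball (0 : Fin n → ℝ) t,
      ∀ b ∈ Metric.ball (0 : Fin n → ℝ) t, ‖P a b x‖ < s →
      P a b x = L (E x b) (E x a) ∧ ‖P a b x‖ < s / 2 := by
    intro x hx a ha b hb hlt
    obtain ⟨⟨hxK, hxN, hwN⟩, ⟨haW, hbW⟩, ⟨has, hbs⟩, hLs, -⟩ := hall x hx a ha b hb
    rw [mem_ball_zero_iff] at has hbs hLs
    obtain ⟨z, w, hz, hw, hzw⟩ := hP x hxK a haW b hbW
    rw [(hgood x hxN a has).2] at hz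
    rw [(hgood x hxN b hbs).2] at hw
    subst hz hw
    have h1 := hgood _ hwN _ hlt
    have h2 := (h1.2 _).1 hzw
    have h3 := h1.1.2
    rw [← h2] at h3
    exact ⟨h3.symm, h3 ▸ hLs⟩
  obtain ⟨ε₁, hε₁, hlim⟩ := hlim
  refine ⟨K', hK', fun x hx => (hall x hx 0 h0t 0 h0t).1.1, t, ht, min ε₁ (min 1 (s / 16)),
    by positivity, fun a ha => (hall x₀ (mem_of_mem_nhds hK') a ha a ha).2.1.1,
    fun x hx a ha b hb => ⟨?_, fun ε hε => ?_⟩⟩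
  · obtain ⟨⟨hxK, hxN, hwN⟩, -, ⟨has, hbs⟩, -, hc⟩ := hall x hx a ha b hb
    rw [mem_ball_zero_iff] at has hbs
    have e1 : ContinuousAt (fun q : Y × (Fin n → ℝ) × (Fin n → ℝ) => E q.1 q.2.2) (x, a, b) :=
      ContinuousAt.comp (g := fun q : Y × (Fin n → ℝ) => E q.1 q.2)
        (f := fun q : Y × (Fin n → ℝ) × (Fin n → ℝ) => (q.1, q.2.2)) (hgood x hxN b hbs).1.1
        (by fun_prop)
    have e2 : ContinuousAt (fun q : Y × (Fin n → ℝ) × (Fin n → ℝ) => E q.1 q.2.1) (x, a, b) :=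
      ContinuousAt.comp (g := fun q : Y × (Fin n → ℝ) => E q.1 q.2)
        (f := fun q : Y × (Fin n → ℝ) × (Fin n → ℝ) => (q.1, q.2.1)) (hgood x hxN a has).1.1
        (by fun_prop)
    exact ContinuousAt.comp (g := fun q : Y × Y => L q.1 q.2)
      (f := fun q : Y × (Fin n → ℝ) × (Fin n → ℝ) => (E q.1 q.2.2, E q.1 q.2.1)) hc (e1.prodMk e2)
  · obtain ⟨hε0, hεlt⟩ := hε
    rw [lt_min_iff, lt_min_iff] at hεlt
    obtain ⟨hεε₁, hε1, hεs⟩ := hεlt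
    have hdil : ∀ c ∈ Metric.ball (0 : Fin n → ℝ) t, ∀ r : ℝ, 0 < r → r ≤ 1 →
        weightedDil deg r c ∈ Metric.ball (0 : Fin n → ℝ) t := fun c hc r hr0 hr1 => by
      rw [mem_ball_zero_iff] at hc ⊢
      exact ((norm_weightedDil_le hdeg hr0.le hr1 c).trans
        (mul_le_of_le_one_left (norm_nonneg _) hr1)).trans_lt hc
    have haW := (hall x hx a ha b hb).2.1
    have hxK := (hall x hx a ha b hb).1.1
    refine (hbranch x hx _ (hdil a ha ε hε0 hε1.le) _ (hdil b hb ε hε0 hε1.le) ?_).1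
    by_contra hlt
    rw [not_lt] at hlt
    set p := P (weightedDil deg ε a) (weightedDil deg ε b) x with hp
    have hp0 : p ≠ 0 := fun h0 => by
      rw [h0, norm_zero] at hlt
      exact hs.not_ge hlt
    -- If `p` were large, its dilation by some `r < 1` would have norm `3s/4`. Both rescaled values
    -- are within 1 of the same limit, so the solution `p'` for `ε * r` differs from this dilation
    -- by at most `2 ε r ≤ s/8`. Its norm would then lie between `5s/8` and `7s/8`, inside the gap.
    obtain ⟨r, hr0, hr⟩ := exists_norm_weightedDil_eq hdeg hp0 (by positivity : 0 < 3 * s / 4)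
    have hr1 : r < 1 := by
      by_contra hr1
      rw [not_lt] at hr1
      have h1 := norm_le_norm_weightedDil hdeg hr1 p
      nlinarith
    have hεr : ε * r < ε := mul_lt_of_lt_one_right hε0 hr1
    have hεr0 : 0 < ε * r := mul_pos hε0 hr0
    set p' := P (weightedDil deg (ε * r) a) (weightedDil deg (ε * r) b) x with hp'
    have hdiff : ‖p' - weightedDil deg r p‖ ≤ s / 8 := by
      refine (pi_norm_le_iff_of_nonneg (by positivity)).2 fun i => ?_
      have h1 := hlim ε ⟨hε0, hεε₁⟩ x hxK a haW.1 b haW.2 i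
      have h2 := hlim (ε * r) ⟨hεr0, hεr.trans hεε₁⟩ x hxK a haW.1 b haW.2 i
      rw [← hp] at h1
      rw [← hp'] at h2
      have h3 : |((ε * r) ^ deg i)⁻¹ * (p' i - r ^ deg i * p i)| < 2 := by
        have e : ((ε * r) ^ deg i)⁻¹ * (p' i - r ^ deg i * p i) =
            (((ε * r) ^ deg i)⁻¹ * p' i - Q a b x i) - ((ε ^ deg i)⁻¹ * p i - Q a b x i) := by
          have : r ^ deg i ≠ 0 := (pow_pos hr0 _).ne'
          have : ε ^ deg i ≠ 0 := (pow_pos hε0 _).ne'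
          rw [mul_pow]
          field_simp
          ring
        rw [e]
        exact (abs_sub _ _).trans_lt (by linarith)
      rw [abs_mul, abs_inv, abs_of_pos (pow_pos hεr0 _), inv_mul_lt_iff₀ (pow_pos hεr0 _)] at h3
      have h4 : (ε * r) ^ deg i ≤ ε * r :=
        pow_le_of_le_one hεr0.le (hεr.le.trans hε1.le) (hdeg i).ne'
      rw [Real.norm_eq_abs, Pi.sub_apply]
      change |p' i - r ^ deg i * p i| ≤ s / 8
      linarith
    have h1 : ‖p'‖ ≤ ‖p' - weightedDil deg r p‖ + ‖weightedDil deg r p‖ := by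
      simpa using norm_add_le (p' - weightedDil deg r p) (weightedDil deg r p)
    have h2 : ‖weightedDil deg r p‖ ≤ ‖p'‖ + ‖p' - weightedDil deg r p‖ := by
      rw [norm_sub_rev]
      simpa using norm_add_le p' (weightedDil deg r p - p')
    have h3 := (hbranch x hx _ (hdil a ha _ hεr0 (hεr.le.trans hε1.le)) _
      (hdil b hb _ hεr0 (hεr.le.trans hε1.le)) (by rw [← hp']; linarith)).2
    rw [← hp'] at h3
    linarith

/-- Once `P` is identified with the logarithm along small dilations, it is continuous there, and its
uniform limit becomes a joint limit. Rescaling removes the smallness of `a` and `b`. -/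
theorem IsLocalExp.exists_tendsto_comp (h : IsLocalExp R E L)
    (hdeg : ∀ i, 0 < deg i) {x : Y} {K : Set Y} (hK : K ∈ 𝓝 x) {W : Set (Fin n → ℝ)}
    (hW : W ∈ 𝓝 0) {P Q : (Fin n → ℝ) → (Fin n → ℝ) → Y → Fin n → ℝ}
    (hP : ∀ x ∈ K, ∀ a ∈ W, ∀ b ∈ W, ∃ z w, R a x z ∧ R b x w ∧ R (P a b x) w z)
    (hlim : ∀ η > 0, ∃ ε₀ > 0, ∀ ε ∈ Ioo (0 : ℝ) ε₀, ∀ x ∈ K, ∀ a ∈ W, ∀ b ∈ W, ∀ i,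
      |(ε ^ deg i)⁻¹ * P (weightedDil deg ε a) (weightedDil deg ε b) x i - Q a b x i| < η)
    (a b : Fin n → ℝ) : ∃ v, Tendsto
      (fun p : ℝ × Y × (Fin n → ℝ) × (Fin n → ℝ) => weightedDil deg p.1⁻¹
        (L (E p.2.1 (weightedDil deg p.1 p.2.2.2)) (E p.2.1 (weightedDil deg p.1 p.2.2.1))))
      (𝓝[>] 0 ×ˢ 𝓝 (x, a, b)) (𝓝 v) := by
  obtain ⟨K', hK', hKK, t, ht, ε₀, hε₀, htW, hPE⟩ :=
    h.exists_eq_of_asymptotically_homogeneous hdeg hK hW hP (hlim 1 one_pos)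
  have hball := Metric.ball_mem_nhds (0 : Fin n → ℝ) ht
  have hu : TendstoUniformlyOn (fun (ε : ℝ) (q : Y × (Fin n → ℝ) × (Fin n → ℝ)) =>
      weightedDil deg ε⁻¹ (L (E q.1 (weightedDil deg ε q.2.2)) (E q.1 (weightedDil deg ε q.2.1))))
      (fun q => Q q.2.1 q.2.2 q.1) (𝓝[>] 0)
      (K' ×ˢ Metric.ball 0 t ×ˢ Metric.ball 0 t) := by
    rw [Metric.tendstoUniformlyOn_iff]
    intro η hη
    obtain ⟨ε₁, hε₁, hlim⟩ := hlim η hη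
    filter_upwards [Ioo_mem_nhdsGT hε₀, Ioo_mem_nhdsGT hε₁] with ε h1 h2 q hq
    rw [← (hPE q.1 hq.1 q.2.1 hq.2.1 q.2.2 hq.2.2).2 ε h1, dist_comm, dist_pi_lt_iff hη]
    intro i
    have := hlim ε h2 q.1 (hKK hq.1) q.2.1 (htW hq.2.1) q.2.2 (htW hq.2.2) i
    rwa [Real.dist_eq, weightedDil, inv_pow]
  have key : ∀ a ∈ Metric.ball (0 : Fin n → ℝ) t, ∀ b ∈ Metric.ball (0 : Fin n → ℝ) t, Tendsto
      (fun p : ℝ × Y × (Fin n → ℝ) × (Fin n → ℝ) => weightedDil deg p.1⁻¹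
        (L (E p.2.1 (weightedDil deg p.1 p.2.2.2)) (E p.2.1 (weightedDil deg p.1 p.2.2.1))))
      (𝓝[>] 0 ×ˢ 𝓝 (x, a, b)) (𝓝 (Q a b x)) := by
    intro a ha b hb
    refine hu.tendsto_prod_nhds (z := (x, a, b)) (prod_mem_nhds hK' (prod_mem_nhds
      (Metric.isOpen_ball.mem_nhds ha) (Metric.isOpen_ball.mem_nhds hb))) ?_
    filter_upwards [Ioo_mem_nhdsGT one_pos] with ε hε
    have hdil : ∀ c ∈ Metric.ball (0 : Fin n → ℝ) t,
        weightedDil deg ε c ∈ Metric.ball (0 : Fin n → ℝ) t := fun c hc => by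
      rw [mem_ball_zero_iff] at hc ⊢
      exact ((norm_weightedDil_le hdeg hε.1.le hε.2.le c).trans
        (mul_le_of_le_one_left (norm_nonneg _) hε.2.le)).trans_lt hc
    have h1 := (hPE x (mem_of_mem_nhds hK') _ (hdil a ha) _ (hdil b hb)).1
    have hw := continuous_weightedDil_right deg ε
    have h2 : ContinuousAt (fun q : Y × (Fin n → ℝ) × (Fin n → ℝ) =>
        L (E q.1 (weightedDil deg ε q.2.2)) (E q.1 (weightedDil deg ε q.2.1))) (x, a, b) :=
      ContinuousAt.comp
        (g := fun q : Y × (Fin n → ℝ) × (Fin n → ℝ) => L (E q.1 q.2.2) (E q.1 q.2.1))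
        (f := fun q : Y × (Fin n → ℝ) × (Fin n → ℝ) =>
          (q.1, weightedDil deg ε q.2.1, weightedDil deg ε q.2.2)) h1
        (by fun_prop)
    exact (continuous_weightedDil_right deg ε⁻¹).continuousAt.comp h2
  have h0 : ∀ c : Fin n → ℝ, Tendsto (fun r : ℝ => weightedDil deg r c) (𝓝[>] 0) (𝓝 0) := fun c =>
    (tendsto_weightedDil_zero hdeg c).comp (tendsto_id.prodMk tendsto_const_nhds)
  obtain ⟨r, ⟨hra, hrb⟩, hr0⟩ := ((((h0 a).eventually hball).and
    ((h0 b).eventually hball)).and self_mem_nhdsWithin).exists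
  have hr0 : 0 < r := hr0
  have hw := continuous_weightedDil_right deg r
  have h1 := ((continuous_weightedDil_right deg r⁻¹).tendsto _).comp
    ((key _ hra _ hrb).comp (tendsto_div_prodMk_nhds
      (g := fun q : Y × (Fin n → ℝ) × (Fin n → ℝ) =>
        (q.1, weightedDil deg r q.2.1, weightedDil deg r q.2.2)) (by fun_prop) hr0 (x, a, b)))
  refine ⟨_, h1.congr fun p => ?_⟩
  simp only [Function.comp_apply, weightedDil_mul, div_mul_cancel₀ _ hr0.ne', inv_div]
  congr 1
  field_simp

end Limits

/-! ## Exponential coordinates defined by a relation -/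

section RelExp

variable {Y V : Type*}

open Classical in
/-- A point related to `x` by `a`, if there is one. -/
noncomputable def relExp (R : V → Y → Y → Prop) (x : Y) (a : V) : Y :=
  if h : ∃ y, R a x y then h.choose else x

open Classical in
/-- A smallest vector that relates `x` to `y`, if there is one. -/
noncomputable def relLog [Norm V] [Zero V] (R : V → Y → Y → Prop) (x y : Y) : V :=
  if h : ∃ a, R a x y ∧ ∀ b, R b x y → ‖a‖ ≤ ‖b‖ then h.choose else 0

theorem relExp_eq {R : V → Y → Y → Prop} {x y : Y} {a : V} (h : R a x y)
    (hu : ∀ y', R a x y' → y' = y) : relExp R x a = y := by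
  have h' : ∃ y, R a x y := ⟨y, h⟩
  rw [relExp, dif_pos h']
  exact hu _ h'.choose_spec

theorem relLog_eq [Norm V] [Zero V] {R : V → Y → Y → Prop} {x y : Y} {a : V} (h : R a x y)
    (hu : ∀ b, R b x y → b = a ∨ ‖a‖ < ‖b‖) : relLog R x y = a := by
  have h' : ∃ a, R a x y ∧ ∀ b, R b x y → ‖a‖ ≤ ‖b‖ :=
    ⟨a, h, fun b hb => (hu b hb).elim (fun e => e ▸ le_rfl) le_of_lt⟩
  rw [relLog, dif_pos h']
  exact (hu _ h'.choose_spec.1).resolve_right (not_lt.2 (h'.choose_spec.2 a h))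

/-- The local coordinates at different points come from unrelated choices. The only related point
and the shortest relating vector are canonical and agree locally with any such choice, so globally
defined maps arise without gluing. -/
theorem isLocalExp_relExp [TopologicalSpace Y] [NormedAddCommGroup V] {R : V → Y → Y → Prop}
    (hR : ∀ x₀, ∃ (G : Y → V → Y) (Λ : Y → Y → V),
      (∀ᶠ p : Y × V in 𝓝 (x₀, 0),
        ContinuousAt (fun q : Y × V => G q.1 q.2) p ∧ Λ p.1 (G p.1 p.2) = p.2) ∧
      (∀ᶠ p : Y × Y in 𝓝 (x₀, x₀),
        ContinuousAt (fun q : Y × Y => Λ q.1 q.2) p ∧ G p.1 (Λ p.1 p.2) = p.2) ∧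
      Λ x₀ x₀ = 0 ∧ G x₀ 0 = x₀ ∧
      ∀ᶠ p : Y × V in 𝓝 (x₀, 0), R p.2 p.1 (G p.1 p.2) ∧ ∀ y, R p.2 p.1 y → y = G p.1 p.2) :
    IsLocalExp R (relExp R) (relLog R) := by
  have key : ∀ x₀, ∃ (G : Y → V → Y) (Λ : Y → Y → V),
      (∀ᶠ p : Y × V in 𝓝 (x₀, 0),
        ContinuousAt (fun q : Y × V => G q.1 q.2) p ∧ Λ p.1 (G p.1 p.2) = p.2) ∧
      (∀ᶠ p : Y × Y in 𝓝 (x₀, x₀),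
        ContinuousAt (fun q : Y × Y => Λ q.1 q.2) p ∧ G p.1 (Λ p.1 p.2) = p.2) ∧
      Λ x₀ x₀ = 0 ∧ G x₀ 0 = x₀ ∧
      (∀ᶠ p : Y × V in 𝓝 (x₀, 0), relExp R p.1 p.2 = G p.1 p.2) ∧
      (∀ᶠ p : Y × Y in 𝓝 (x₀, x₀), relLog R p.1 p.2 = Λ p.1 p.2) ∧
      ∀ᶠ p : Y × V in 𝓝 (x₀, 0), ∀ y, R p.2 p.1 y ↔ y = G p.1 p.2 := by
    intro x₀
    obtain ⟨G, Λ, hG, hΛ, hΛ0, hG0, hrel⟩ := hR x₀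
    refine ⟨G, Λ, hG, hΛ, hΛ0, hG0, hrel.mono fun p hp => relExp_eq hp.1 hp.2, ?_,
      hrel.mono fun p hp y => ⟨hp.2 y, fun e => e ▸ hp.1⟩⟩
    obtain ⟨N, hN, B, hB, hNB⟩ := mem_nhds_prod_iff.1 (hG.and hrel)
    obtain ⟨s, hs, hsB⟩ := Metric.mem_nhds_iff.1 hB
    have hgood : ∀ x ∈ N, ∀ a, ‖a‖ < s → Λ x (G x a) = a ∧ R a x (G x a) ∧
        ∀ y, R a x y → y = G x a := fun x hx a ha => by
      have := hNB (mk_mem_prod hx (hsB (mem_ball_zero_iff.2 ha)))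
      exact ⟨this.1.2, this.2⟩
    have hΛs : Tendsto (fun q : Y × Y => Λ q.1 q.2) (𝓝 (x₀, x₀)) (𝓝 0) := by
      have := hΛ.self_of_nhds.1.tendsto
      rwa [hΛ0] at this
    filter_upwards [hΛ, hΛs (Metric.ball_mem_nhds 0 hs), continuous_fst.tendsto (x₀, x₀) hN]
      with p h1 h2 h3
    have h2 : ‖Λ p.1 p.2‖ < s := mem_ball_zero_iff.1 h2
    have h4 := (hgood p.1 h3 _ h2).2.1
    rw [h1.2] at h4
    refine relLog_eq h4 fun b hb => ?_
    -- A vector of norm below `s` is recovered from its endpoint by `Λ`; any other is longer than `Λ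
    -- p.1 p.2`.
    rcases lt_or_ge ‖b‖ s with hbs | hbs
    · have h5 := hgood p.1 h3 b hbs
      have h6 := h5.2.2 _ hb
      left
      rw [← h5.1, ← h6]
    · exact Or.inr (h2.trans_le hbs)
  constructor
  · intro x
    obtain ⟨G, Λ, -, -, -, hG0, hE, -, hrel⟩ := key x
    have h1 := hE.self_of_nhds
    simp only at h1
    rw [h1, hG0]
  · intro x
    obtain ⟨G, Λ, -, -, hΛ0, -, -, hL, -⟩ := key x
    have h1 := hL.self_of_nhds
    simp only at h1
    rw [h1, hΛ0]
  · intro x₀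
    obtain ⟨G, Λ, hG, -, -, hG0, hE, hL, -⟩ := key x₀
    have hGt : Tendsto (fun p : Y × V => (p.1, G p.1 p.2)) (𝓝 (x₀, 0)) (𝓝 (x₀, x₀)) := by
      have := hG.self_of_nhds.1.tendsto
      rw [hG0] at this
      exact (continuous_fst.tendsto (x₀, (0 : V))).prodMk_nhds this
    filter_upwards [hG, hE.eventually_nhds, hGt.eventually hL] with p h1 h2 h3
    refine ⟨h1.1.congr (h2.mono fun q hq => hq.symm), ?_⟩
    rw [h2.self_of_nhds, h3, h1.2]
  · intro x₀
    obtain ⟨G, Λ, -, hΛ, hΛ0, -, hE, hL, -⟩ := key x₀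
    have hΛt : Tendsto (fun p : Y × Y => (p.1, Λ p.1 p.2)) (𝓝 (x₀, x₀)) (𝓝 (x₀, 0)) := by
      have := hΛ.self_of_nhds.1.tendsto
      rw [hΛ0] at this
      exact (continuous_fst.tendsto (x₀, x₀)).prodMk_nhds this
    filter_upwards [hΛ, hL.eventually_nhds, hΛt.eventually hE] with p h1 h2 h3
    refine ⟨h1.1.congr (h2.mono fun q hq => hq.symm), ?_⟩
    rw [h2.self_of_nhds, h3, h1.2]
  · intro x₀
    obtain ⟨G, Λ, -, -, -, -, hE, -, hrel⟩ := key x₀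
    filter_upwards [hE, hrel] with p h1 h2 y
    rw [h1, h2]

end RelExp

/-! ### Normal frames yield strong dilation structures -/

section Final

variable {n m : ℕ} {M : Type*} [TopologicalSpace M] [ChartedSpace (EuclideanSpace ℝ (Fin n)) M]
  {U : Set M} {X : Fin n → VField n M} {Y : Type*} {j : Y → M}

theorem IsExp.mem {a : Fin n → ℝ} {x y : M} (h : IsExp U X a x y) : y ∈ U := by
  obtain ⟨γ, -, h1, hU, -⟩ := h
  exact h1 ▸ hU 1 (by simp)

variable [IsManifold (𝓡 n) ∞ M]

/-- `Y` stands for `U` with the topology of its metric, which equals the subspace topology only by a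
proof; an abstract open embedding `j` absorbs the difference. Exponentials remain in `U`, so they
can be pulled back along `j`. -/
theorem isLocalExp_isExp [T2Space M] [TopologicalSpace Y] (hj : IsOpenEmbedding j)
    (hr : range j = U) (hX : ∀ i, SmoothField U (X i))
    (hind : ∀ y ∈ U, LinearIndependent ℝ fun i => X i y) :
    IsLocalExp (fun a x y => IsExp U X a (j x) (j y))
      (relExp fun a x y => IsExp U X a (j x) (j y))
      (relLog fun a x y => IsExp U X a (j x) (j y)) := by
  have hU : IsOpen U := hr ▸ hj.isOpen_range
  have hjU : ∀ x, j x ∈ U := fun x => hr ▸ mem_range_self x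
  refine isLocalExp_relExp fun x₀ => ?_
  obtain ⟨G, Λ, hG, hΛ, hΛ0, hG0, hrel⟩ := exists_local_isExp hU hX hind (hjU x₀)
  have : Nonempty Y := ⟨x₀⟩
  have hinv : ∀ z ∈ U, j (Function.invFun j z) = z := fun z hz =>
    Function.invFun_eq (by rwa [← hr] at hz)
  have hinv' : ∀ y, Function.invFun j (j y) = y := Function.leftInverse_invFun hj.injective
  have c1 : Continuous fun p : Y × (Fin n → ℝ) => (j p.1, p.2) :=
    (hj.continuous.comp continuous_fst).prodMk continuous_snd
  have c2 : Continuous fun p : Y × Y => (j p.1, j p.2) :=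
    (hj.continuous.comp continuous_fst).prodMk (hj.continuous.comp continuous_snd)
  have hG' := (c1.tendsto (x₀, 0)).eventually hG
  have hrel' := (c1.tendsto (x₀, 0)).eventually hrel
  have hΛ' := (c2.tendsto (x₀, x₀)).eventually hΛ
  refine ⟨fun x a => Function.invFun j (G (j x) a), fun x y => Λ (j x) (j y), ?_, ?_, hΛ0, ?_, ?_⟩
  · filter_upwards [hG', hrel'.eventually_nhds] with p h1 h2
    have h3 : ∀ᶠ q : Y × (Fin n → ℝ) in 𝓝 p,
        j (Function.invFun j (G (j q.1) q.2)) = G (j q.1) q.2 :=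
      h2.mono fun q hq => hinv _ hq.1.mem
    refine ⟨?_, ?_⟩
    · rw [hj.isEmbedding.isInducing.continuousAt_iff]
      have h4 : ContinuousAt (fun q : Y × (Fin n → ℝ) => G (j q.1) q.2) p :=
        ContinuousAt.comp (g := fun q : M × (Fin n → ℝ) => G q.1 q.2)
          (f := fun q : Y × (Fin n → ℝ) => (j q.1, q.2)) h1.1 c1.continuousAt
      exact h4.congr (h3.mono fun q hq => hq.symm)
    · rw [h3.self_of_nhds]
      exact h1.2
  · filter_upwards [hΛ'] with p h1
    refine ⟨ContinuousAt.comp (g := fun q : M × M => Λ q.1 q.2)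
      (f := fun q : Y × Y => (j q.1, j q.2)) h1.1 c2.continuousAt, ?_⟩
    have h2 : G (j p.1) (Λ (j p.1) (j p.2)) = j p.2 := h1.2
    change Function.invFun j (G (j p.1) (Λ (j p.1) (j p.2))) = p.2
    rw [h2, hinv']
  · change Function.invFun j (G (j x₀) 0) = x₀
    rw [hG0, hinv']
  · filter_upwards [hrel'] with p h1
    have h2 := hinv _ h1.1.mem
    refine ⟨?_, fun y hy => ?_⟩
    · rw [h2]
      exact h1.1
    · rw [← h1.2 _ hy, hinv']

variable {S : SubRiemannian n m M} {deg : Fin n → ℕ}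

theorem IsNormalFrame.exists_dilationLimits [T2Space M] [MetricSpace Y] (hj : IsOpenEmbedding j)
    (hr : range j = U) (hd : ∀ x y, ENNReal.ofReal (dist x y) = S.ccEDist (j x) (j y))
    (hX : IsNormalFrame S U X deg) [LocallyCompactSpace Y] :
    ∃ N Q, HasDilationLimits deg (relExp fun a x y => IsExp U X a (j x) (j y))
      (relLog fun a x y => IsExp U X a (j x) (j y)) N Q := by
  have hexp := isLocalExp_isExp hj hr hX.smooth hX.independent
  have hjU : ∀ x, j x ∈ U := fun x => hr ▸ mem_range_self x
  have hmem : ∀ {a : Fin n → ℝ} {x z}, IsExp U X a x z → ∃ y, j y = z := fun h => by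
    have := h.mem
    rwa [← hr] at this
  have himg : ∀ K : Set Y, j '' K ⊆ U := fun K => by
    rintro _ ⟨x, -, rfl⟩
    exact hjU x
  obtain ⟨W, hWc, hW, A, hA, hlim⟩ := hX.limit_dist
  have hN := hexp.exists_tendsto_dist hX.deg_pos hWc hW (A := fun y a => A (j y) a)
    (fun y => hA (j y) (hjU y)) (fun K hK η hη => by
      obtain ⟨ε₀, hε₀, h⟩ := hlim (j '' K) (himg K) (hK.image hj.continuous) η hη
      refine ⟨ε₀, hε₀, fun ε hε y hy a ha => ?_⟩
      obtain ⟨z, hz, hlt⟩ := h ε hε (j y) (mem_image_of_mem j hy) a ha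
      obtain ⟨z, rfl⟩ := hmem hz
      rw [← hd, ENNReal.toReal_ofReal dist_nonneg] at hlt
      exact ⟨z, hz, hlt⟩)
  have hQ : ∀ (x : Y) (a b : Fin n → ℝ), ∃ v, Tendsto
      (fun p : ℝ × Y × (Fin n → ℝ) × (Fin n → ℝ) => weightedDil deg p.1⁻¹
        (relLog (fun a x y => IsExp U X a (j x) (j y))
          (relExp (fun a x y => IsExp U X a (j x) (j y)) p.2.1 (weightedDil deg p.1 p.2.2.2))
          (relExp (fun a x y => IsExp U X a (j x) (j y)) p.2.1 (weightedDil deg p.1 p.2.2.1))))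
      (𝓝[>] 0 ×ˢ 𝓝 (x, a, b)) (𝓝 v) := by
    intro x a b
    obtain ⟨r, hr0, h⟩ := hX.limit_comp (j x) (hjU x)
    -- A compact neighbourhood within distance `r / 2` of `x` has mutual distances below `r`, as
    -- condition (b) requires.
    obtain ⟨K, hK, hKb, hKc⟩ := LocallyCompactSpace.local_compact_nhds x _
      (Metric.ball_mem_nhds x (half_pos hr0))
    obtain ⟨W, -, hW, P, hP, Q, hQ⟩ := h (j '' K) (himg K) (hKc.image hj.continuous)
      (mem_image_of_mem j (mem_of_mem_nhds hK)) (by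
        rintro _ ⟨y, hy, rfl⟩ _ ⟨z, hz, rfl⟩
        rw [← hd]
        refine (ENNReal.ofReal_lt_ofReal_iff hr0).2 ?_
        have h1 : dist y x < r / 2 := hKb hy
        have h2 : dist z x < r / 2 := hKb hz
        linarith [dist_triangle_right y z x])
    refine hexp.exists_tendsto_comp hX.deg_pos hK hW (P := fun a b x => P a b (j x))
      (Q := fun a b x => Q a b (j x)) (fun y hy a ha b hb => ?_) (fun η hη => ?_) a b
    · obtain ⟨z, w, hz, hw, hzw⟩ := hP (j y) (mem_image_of_mem j hy) a ha b hb
      obtain ⟨z, rfl⟩ := hmem hz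
      obtain ⟨w, rfl⟩ := hmem hw
      exact ⟨z, w, hz, hw, hzw⟩
    · obtain ⟨ε₀, hε₀, h⟩ := hQ η hη
      exact ⟨ε₀, hε₀, fun ε hε y hy => h ε hε (j y) (mem_image_of_mem j hy)⟩
  choose N hN hNpos using hN
  choose Q hQ using hQ
  exact ⟨N, Q, hX.deg_pos, hexp.E_zero, hexp.L_self, hexp.E_good, hexp.L_good, hN, hNpos, hQ⟩

theorem IsNormalFrame.exists_dilationData [T2Space M] [MetricSpace Y] (hj : IsOpenEmbedding j)
    (hr : range j = U) (hd : ∀ x y, ENNReal.ofReal (dist x y) = S.ccEDist (j x) (j y))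
    (hX : IsNormalFrame S U X deg) :
    ∃ Dil : DilationData Y, Dil.IsStrongDilationStructure ∧
      ∀ x, ∃ (O : Set (Fin n → ℝ)) (e : (Fin n → ℝ) → Y), IsOpen O ∧ 0 ∈ O ∧
        (∀ a ∈ O, ∀ ε ∈ Ioc (0 : ℝ) 1, weightedDil deg ε a ∈ O) ∧
        IsHomeoOn e O (Dil.U x) ∧ (∀ a ∈ O, IsExp U X a (j x) (j (e a))) ∧
        ∀ a ∈ O, ∀ ε > 0, e a ∈ Dil.dom ε x →
          IsExp U X (weightedDil deg ε a) (j x) (j (Dil.δ ε x (e a))) := by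
  have : LocallyCompactSpace M :=
    ChartedSpace.locallyCompactSpace (EuclideanSpace ℝ (Fin n)) M
  have : LocallyCompactSpace Y := hj.locallyCompactSpace
  have hexp := isLocalExp_isExp hj hr hX.smooth hX.independent
  obtain ⟨N, Q, h⟩ := hX.exists_dilationLimits hj hr hd
  set E := relExp fun a x y => IsExp U X a (j x) (j y) with hE
  obtain ⟨ρ, hρc, hρ⟩ := h.exists_scale (Rel := fun x a => IsExp U X a (j x) (j (E x a)))
    fun x₀ => (hexp.rel_iff x₀).mono fun p hp => (hp _).2 rfl
  refine ⟨_, gaugeDilation_isStrongDilationStructure h hρ hρc, fun x => ?_⟩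
  obtain ⟨O, hO, h0, hdil, hhom, hrel, hδ⟩ := gaugeDilation_coordinates h hρ x
  refine ⟨O, E x, hO, h0, hdil, hhom, hrel, fun a ha ε hε hdom => ?_⟩
  obtain ⟨h1, h2⟩ := hδ a ha ε hε hdom
  rw [h2]
  exact h1

/-- Short connecting curves put manifold neighbourhoods inside metric balls, the Lipschitz bump
functions put metric balls inside manifold neighbourhoods. The latter also separate points. -/
theorem SubRiemannian.IsRegular.exists_metricSpace [T2Space M] [ConnectedSpace M]
    (hS : S.IsRegular) (U : Set M) : ∃ d : MetricSpace U,
      d.toPseudoMetricSpace.toUniformSpace.toTopologicalSpace = instTopologicalSpaceSubtype ∧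
      ∀ x y : U, ENNReal.ofReal (d.toPseudoMetricSpace.dist x y) = S.ccEDist x y := by
  have hfin : ∀ x y, S.ccEDist x y ≠ ⊤ := fun x y => (hS.ccEDist_lt_top x y).ne
  let d : MetricSpace U :=
    { dist := fun x y => (S.ccEDist x y).toReal
      dist_self := fun x => by simp [S.ccEDist_self]
      dist_comm := fun x y => by simp only [S.ccEDist_comm]
      dist_triangle := fun x y z => by
        rw [← ENNReal.toReal_add (hfin _ _) (hfin _ _)]
        exact ENNReal.toReal_mono (ENNReal.add_ne_top.2 ⟨hfin _ _, hfin _ _⟩)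
          (S.ccEDist_triangle _ _ _)
      eq_of_dist_eq_zero := fun {x y} hxy => by
        by_contra hne
        have hne' : (x : M) ≠ y := fun e => hne (Subtype.ext e)
        obtain ⟨r, hr, h⟩ := hS.exists_mem_of_ccEDist_lt (isOpen_ne.mem_nhds hne'.symm)
        refine h x ?_ rfl
        have h0 : (S.ccEDist x y).toReal = 0 := hxy
        rw [ENNReal.toReal_eq_zero_iff] at h0
        rw [h0.resolve_right (hfin _ _)]
        simpa using hr }
  refine ⟨d, ?_, fun x y => ENNReal.ofReal_toReal (hfin x y)⟩
  refine TopologicalSpace.ext_nhds fun x => Filter.ext fun s => ?_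
  rw [@Metric.mem_nhds_iff U d.toPseudoMetricSpace, mem_nhds_subtype]
  constructor
  · rintro ⟨ε, hε, hs⟩
    refine ⟨_, hS.eventually_ccEDist_lt (x : M) (ENNReal.ofReal_pos.2 hε), fun y hy => hs ?_⟩
    have hy : S.ccEDist x y < ENNReal.ofReal ε := hy
    rw [S.ccEDist_comm] at hy
    exact (ENNReal.lt_ofReal_iff_toReal_lt (hfin _ _)).1 hy
  · rintro ⟨N, hN, hs⟩
    obtain ⟨r, hr, h⟩ := hS.exists_mem_of_ccEDist_lt hN
    refine ⟨r, hr, fun y hy => hs (h y ?_)⟩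
    exact (ENNReal.lt_ofReal_iff_toReal_lt (hfin _ _)).2 hy

end Final

theorem mainTheorem6 {n m : ℕ} {M : Type*} [TopologicalSpace M]
    [ChartedSpace (EuclideanSpace ℝ (Fin n)) M] [IsManifold (𝓡 n) ∞ M]
    [T2Space M] [SecondCountableTopology M] [ConnectedSpace M]
    (S : SubRiemannian n m M) (hS : S.IsRegular)
    (U : Set M) (hU : IsOpen U)
    (X : Fin n → VField n M) (deg : Fin n → ℕ) (hX : IsNormalFrame S U X deg) :
    ∃ d : MetricSpace U,
      d.toPseudoMetricSpace.toUniformSpace.toTopologicalSpace = instTopologicalSpaceSubtype ∧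
      (∀ x y : U, ENNReal.ofReal (d.toPseudoMetricSpace.dist x y) = S.ccEDist x y) ∧
      ∃ Dil : DilationData U,
        @DilationData.IsStrongDilationStructure U Dil d ∧ IsFrameDilation U X deg Dil := by
  obtain ⟨d, htop, hd⟩ := hS.exists_metricSpace U
  refine ⟨d, htop, hd, ?_⟩
  have hj : @IsOpenEmbedding U M d.toPseudoMetricSpace.toUniformSpace.toTopologicalSpace _
      Subtype.val := by
    rw [htop]
    exact hU.isOpenEmbedding_subtypeVal
  obtain ⟨Dil, hDil, hfr⟩ := @IsNormalFrame.exists_dilationData n m M _ _ U X U Subtype.val _ S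
    deg _ d hj Subtype.range_val hd hX
  refine ⟨Dil, hDil, ?_⟩
  rw [htop] at hfr
  exact hfr
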